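/- Consider a homogeneous Poisson point process of intensity $1$ in the plane. For $(x,s),(y,t)\in\mathbb R^2$ let $L((x,s),(y,t))$ be the maximal length $k$ of a sequence $(x_1,t_1),\dots,(x_k,t_k)$ of Poisson points in the rectangle $(x,y]\times(s,t]$ with $x_1<\dots<x_k$ and $t_1<\dots<t_k$ (so $L=0$ if the rectangle is empty), and write $L[x]_t:=L((0,0),(x,t))$. For integers $n\ge1$ and $u\in\mathbb R$ put $$\mathcal A_n(u):=\frac{L[n+2un^{2/3}]_n-(2n+2un^{2/3})+u^2n^{1/3}}{n^{1/3}}.$$ Let $a<b$ be real numbers, and let $D[a,b]$ be the space of cadlag functions $[a,b]\to\mathbb R$ (right-continuous with left limits) with the Skorokhod ($J_1$) topology and its Borel $\sigma$-algebra. Then the restrictions of the $\mathcal A_n$ to $[a,b]$ are random elements of $D[a,b]$, and the collection $\{\mathcal A_n : n\ge1\}$ is tight in $D[a,b]$: for every $\varepsilon>0$ there is a compact set $K\subseteq D[a,b]$ such that $\mathbb P(\mathcal A_n\notin K)\le\varepsilon$ for all $n\ge1$. Furthermore, every weak limit of $(\mathcal A_n)$ lives on the continuous functions: if a subsequence $\mathcal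 A_{n_k}$, with $n_1<n_2<\cdots$, converges in distribution in $D[a,b]$ to a probability measure $\mu$, then $\mu$-almost every $f\in D[a,b]$ is continuous. -/

import Mathlib

open MeasureTheory ProbabilityTheory Filter Topology Set

/-! ### Point configurations and the Poisson point process in the plane -/

/-- A locally finite set of points of the plane. -/
structure PointConfig where
  /-- the set of points -/
  points : Set (ℝ × ℝ)
  /-- every bounded region contains finitely many points -/
  finite_inter : ∀ B : Set (ℝ × ℝ), Bornology.IsBounded B → (points ∩ B).Finite

/-- The number of points of the configuration `S` in the region `B` (meaningful for bounded `B`). -/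
noncomputable def PointConfig.count (S : PointConfig) (B : Set (ℝ × ℝ)) : ℕ :=
  (S.points ∩ B).ncard

/-- The random locally finite set `N`, defined on `(Ω, P)`, is a Poisson point process in the plane
with intensity measure `Λ`: numbers of points in bounded Borel sets are Poisson random variables
with parameter `Λ B`, and they are independent for pairwise disjoint sets. -/
structure IsPoissonPointProcess {Ω : Type*} [MeasurableSpace Ω] (P : Measure Ω)
    (N : Ω → PointConfig) (Λ : Measure (ℝ × ℝ)) : Prop where
  measurable_count : ∀ B : Set (ℝ × ℝ), MeasurableSet B → Bornology.IsBounded B →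
    Measurable fun ω => (N ω).count B
  map_count : ∀ B : Set (ℝ × ℝ), MeasurableSet B → Bornology.IsBounded B →
    P.map (fun ω => (N ω).count B) = poissonMeasure (Λ B).toNNReal
  iIndepFun_count : ∀ (m : ℕ) (B : Fin m → Set (ℝ × ℝ)),
    (∀ i, MeasurableSet (B i)) → (∀ i, Bornology.IsBounded (B i)) →
    (∀ i j, i ≠ j → Disjoint (B i) (B j)) →
    iIndepFun (fun i ω => (N ω).count (B i)) P

/-! ### Last-passage times -/

/-- `S.HasIncreasingPath x s y t k`: there is an increasing sequence of `k` points of `S` (both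
coordinates strictly increase) lying in the rectangle `(x, y] × (s, t]`. -/
def PointConfig.HasIncreasingPath (S : PointConfig) (x s y t : ℝ) (k : ℕ) : Prop :=
  ∃ p : Fin k → ℝ × ℝ, (StrictMono fun i => (p i).1) ∧ (StrictMono fun i => (p i).2) ∧
    ∀ i, p i ∈ S.points ∩ Ioc x y ×ˢ Ioc s t

/-- The last-passage time `L([x]_s, [y]_t)`: the maximal number of points of `S` in an increasing
sequence of points lying in `(x, y] × (s, t]` (so it is `0` if the rectangle is empty). -/
noncomputable def PointConfig.lastPassage (S : PointConfig) (x s y t : ℝ) : ℕ :=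
  sSup {k : ℕ | S.HasIncreasingPath x s y t k}

/-- The rescaled last-passage profile
`𝒜ₙ(u) = (L[n + 2 u n^{2/3}]_n - (2 n + 2 u n^{2/3}) + u² n^{1/3}) / n^{1/3}`. -/
noncomputable def PointConfig.profile (S : PointConfig) (n : ℕ) (u : ℝ) : ℝ :=
  ((S.lastPassage 0 0 (n + 2 * u * (n : ℝ) ^ (2 / 3 : ℝ)) n : ℝ)
      - (2 * n + 2 * u * (n : ℝ) ^ (2 / 3 : ℝ)) + u ^ 2 * (n : ℝ) ^ (1 / 3 : ℝ))
    / (n : ℝ) ^ (1 / 3 : ℝ)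

/-! ### The Skorokhod space -/

/-- The space `D[a, b]` of cadlag functions `[a, b] → ℝ`: right-continuous with left limits. -/
structure Cadlag (a b : ℝ) where
  /-- the underlying function -/
  toFun : Icc a b → ℝ
  /-- right-continuity -/
  right_cont : ∀ t, ContinuousWithinAt toFun (Ici t) t
  /-- existence of (finite) left limits -/
  left_lim : ∀ t, ∃ l : ℝ, Tendsto toFun (𝓝[<] t) (𝓝 l)

namespace Cadlag

variable {a b : ℝ}

instance : CoeFun (Cadlag a b) fun _ => Icc a b → ℝ := ⟨toFun⟩

/-- The cost of the time change `l` (an increasing bijection of `[a, b]`) in the comparison of `f`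
with `g`: the maximum of `sup |l t - t|` and `sup |f t - g (l t)|`. -/
noncomputable def cost (f g : Cadlag a b) (l : Icc a b ≃o Icc a b) : ENNReal :=
  max (⨆ t, edist (l t) t) (⨆ t, edist (f t) (g (l t)))

theorem cost_refl (f : Cadlag a b) : cost f f (OrderIso.refl _) = 0 := by
  simp [cost]

theorem cost_symm (f g : Cadlag a b) (l : Icc a b ≃o Icc a b) :
    cost g f l.symm = cost f g l := by
  unfold cost
  congr 1
  · rw [← l.toEquiv.iSup_comp]
    simp [edist_comm]
  · rw [← l.toEquiv.iSup_comp]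
    simp [edist_comm]

theorem cost_trans (f g h : Cadlag a b) (l m : Icc a b ≃o Icc a b) :
    cost f h (l.trans m) ≤ cost f g l + cost g h m := by
  unfold cost
  refine max_le (iSup_le fun t => ?_) (iSup_le fun t => ?_)
  · rw [add_comm]
    refine (edist_triangle _ (l t) _).trans (add_le_add ?_ ?_)
    · exact (le_iSup (fun t => edist (m t) t) (l t)).trans (le_max_left _ _)
    · exact (le_iSup (fun t => edist (l t) t) t).trans (le_max_left _ _)
  · refine (edist_triangle _ (g (l t)) _).trans (add_le_add ?_ ?_)
    · exact (le_iSup (fun t => edist (f t) (g (l t))) t).trans (le_max_right _ _)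
    · exact (le_iSup (fun t => edist (g t) (h (m t))) (l t)).trans (le_max_right _ _)

/-- The Skorokhod distance
`d(f, g) = inf over time changes l of max (sup |l t - t|) (sup |f t - g (l t)|)`,
which induces the Skorokhod (J1) topology on `D[a, b]`. -/
noncomputable instance : PseudoEMetricSpace (Cadlag a b) where
  edist f g := ⨅ l : Icc a b ≃o Icc a b, cost f g l
  edist_self f := le_antisymm ((iInf_le _ (OrderIso.refl _)).trans (cost_refl f).le) zero_le
  edist_comm f g := by
    refine le_antisymm (le_iInf fun l => ?_) (le_iInf fun l => ?_)
    · exact (iInf_le _ l.symm).trans (cost_symm g f l).le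
    · exact (iInf_le _ l.symm).trans (cost_symm f g l).le
  edist_triangle f g h := ENNReal.le_iInf_add_iInf fun l m =>
    (iInf_le _ (l.trans m)).trans (cost_trans f g h l m)

/-- `D[a, b]` carries the Borel σ-algebra of the Skorokhod topology. -/
noncomputable instance : MeasurableSpace (Cadlag a b) := borel _

instance : BorelSpace (Cadlag a b) := ⟨rfl⟩

end Cadlag

/-! ### The profiles are cadlag -/

namespace PointConfig

variable (S : PointConfig)

theorem finite_rect (x s y t : ℝ) : (S.points ∩ Ioc x y ×ˢ Ioc s t).Finite :=
  S.finite_inter _ ((Metric.isBounded_Ioc x y).prod (Metric.isBounded_Ioc s t))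

theorem bddAbove_path (x s y t : ℝ) : BddAbove {k : ℕ | S.HasIncreasingPath x s y t k} := by
  refine ⟨(S.points ∩ Ioc x y ×ˢ Ioc s t).ncard, ?_⟩
  rintro k ⟨p, hp, -, hmem⟩
  have hinj : Function.Injective p := fun i j h => hp.injective (congrArg Prod.fst h)
  have := Set.ncard_le_ncard (range_subset_iff.2 hmem) (S.finite_rect x s y t)
  rwa [← Set.image_univ, Set.ncard_image_of_injective _ hinj, Set.ncard_univ, Nat.card_fin] at this

theorem lastPassage_mono (x s t : ℝ) : Monotone fun y => S.lastPassage x s y t := by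
  intro y z hyz
  refine csSup_le_csSup (S.bddAbove_path x s z t) ⟨0, ?_⟩ ?_
  · exact ⟨fun i => i.elim0, fun i => i.elim0, fun i => i.elim0, fun i => i.elim0⟩
  · rintro k ⟨p, h1, h2, h3⟩
    exact ⟨p, h1, h2, fun i =>
      ⟨(h3 i).1, ⟨(h3 i).2.1.1, (h3 i).2.1.2.trans hyz⟩, (h3 i).2.2⟩⟩

theorem lastPassage_right_cont (x s t y : ℝ) :
    ContinuousWithinAt (fun z => (S.lastPassage x s z t : ℝ)) (Ici y) y := by
  have hfin : (Prod.fst '' (S.points ∩ Ioc y (y + 1) ×ˢ Ioc s t)).Finite :=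
    (S.finite_rect y s (y + 1) t).image _
  have hnot : y ∉ Prod.fst '' (S.points ∩ Ioc y (y + 1) ×ˢ Ioc s t) := by
    rintro ⟨p, hp, hpy⟩
    exact absurd hpy hp.2.1.1.ne'
  have hev : ∀ᶠ z in 𝓝[≥] y, z < y + 1 ∧
      Disjoint (Icc y z) (Prod.fst '' (S.points ∩ Ioc y (y + 1) ×ˢ Ioc s t)) := by
    obtain ⟨ε, hε, hball⟩ := Metric.isOpen_iff.1 hfin.isClosed.isOpen_compl y hnot
    have h : ∀ᶠ z in 𝓝[≥] y, z < y + min ε 1 :=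
      nhdsWithin_le_nhds (Iio_mem_nhds (by linarith [lt_min hε one_pos]))
    filter_upwards [h] with z hz
    refine ⟨by linarith [min_le_right ε 1], Set.disjoint_left.2 fun w hw => hball ?_⟩
    rw [Metric.mem_ball, Real.dist_eq, abs_lt]
    constructor <;> linarith [hw.1, hw.2, min_le_left ε 1]
  refine tendsto_const_nhds.congr' ?_
  filter_upwards [hev, self_mem_nhdsWithin] with z hz hyz
  norm_cast
  refine le_antisymm (S.lastPassage_mono x s t hyz) ?_
  refine csSup_le_csSup (S.bddAbove_path x s y t) ⟨0, ?_⟩ ?_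
  · exact ⟨fun i => i.elim0, fun i => i.elim0, fun i => i.elim0, fun i => i.elim0⟩
  · rintro k ⟨p, h1, h2, h3⟩
    refine ⟨p, h1, h2, fun i => ⟨(h3 i).1, ⟨(h3 i).2.1.1, ?_⟩, (h3 i).2.2⟩⟩
    by_contra! hlt
    exact Set.disjoint_left.1 hz.2 ⟨hlt.le, (h3 i).2.1.2⟩
      ⟨p i, ⟨(h3 i).1, ⟨hlt, (h3 i).2.1.2.trans hz.1.le⟩, (h3 i).2.2⟩, rfl⟩

theorem profile_right_cont (n : ℕ) (u : ℝ) : ContinuousWithinAt (S.profile n) (Ici u) u := by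
  have hc : (0 : ℝ) ≤ (n : ℝ) ^ (2 / 3 : ℝ) := by positivity
  have h : ContinuousWithinAt (fun v : ℝ =>
      (S.lastPassage 0 0 (n + 2 * v * (n : ℝ) ^ (2 / 3 : ℝ)) n : ℝ)) (Ici u) u := by
    refine (S.lastPassage_right_cont 0 0 n (n + 2 * u * (n : ℝ) ^ (2 / 3 : ℝ))).comp
      (f := fun v : ℝ => n + 2 * v * (n : ℝ) ^ (2 / 3 : ℝ)) (by fun_prop) fun v hv => ?_
    have : u ≤ v := hv
    simp only [mem_Ici]
    gcongr
  unfold profile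
  exact (((h.sub (by fun_prop)).add (by fun_prop)).div_const _)

theorem profile_left_lim (n : ℕ) (u : ℝ) : ∃ l : ℝ, Tendsto (S.profile n) (𝓝[<] u) (𝓝 l) := by
  have hc : (0 : ℝ) ≤ (n : ℝ) ^ (2 / 3 : ℝ) := by positivity
  have hm : Monotone (fun v : ℝ =>
      (S.lastPassage 0 0 (n + 2 * v * (n : ℝ) ^ (2 / 3 : ℝ)) n : ℝ)) := by
    intro v w hvw
    have := S.lastPassage_mono 0 0 n
      (show (n : ℝ) + 2 * v * (n : ℝ) ^ (2 / 3 : ℝ) ≤ n + 2 * w * (n : ℝ) ^ (2 / 3 : ℝ) by gcongr)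
    exact Nat.cast_le.2 this
  have h1 : ContinuousWithinAt (fun v : ℝ => 2 * n + 2 * v * (n : ℝ) ^ (2 / 3 : ℝ)) (Iio u) u := by
    fun_prop
  have h2 : ContinuousWithinAt (fun v : ℝ => v ^ 2 * (n : ℝ) ^ (1 / 3 : ℝ)) (Iio u) u := by
    fun_prop
  exact ⟨_, (((hm.tendsto_nhdsLT u).sub h1).add h2).div_const _⟩

/-- The restriction of the profile `𝒜ₙ` to `[a, b]`, as an element of `D[a, b]`. -/
noncomputable def cadlagProfile (a b : ℝ) (n : ℕ) : Cadlag a b where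
  toFun u := S.profile n u
  right_cont t := (S.profile_right_cont n t).comp (f := ((↑) : Icc a b → ℝ))
    continuous_subtype_val.continuousWithinAt fun _ h => h
  left_lim t := by
    obtain ⟨l, hl⟩ := S.profile_left_lim n t
    refine ⟨l, hl.comp (tendsto_nhdsWithin_iff.2 ⟨?_, ?_⟩)⟩
    · exact continuous_subtype_val.continuousWithinAt
    · filter_upwards [self_mem_nhdsWithin] with v hv using hv

end PointConfig

/-! The profile is compared with stationary versions of Hammersley's process, in the spirit of
Cator, Groeneboom and Pimentel. Add sources of intensity `w` on the horizontal axis and sinks of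
intensity `1 / w` on the vertical axis. By Burke's theorem the increments of the last-passage time
along every horizontal line then have the law of the sources. The plane is cut into cells of side `1
/ m`, which makes the environment a finite array of coins. Expectations there are finite sums,
handled as abstract linear functionals, and Burke's theorem reduces to one identity for a single
cell (`coin_cell`, `burke`).

The last-passage time is the number of sinks plus the increments on the top line. Tilting the sinks
from intensity `1 / w` to `1 / z` therefore gives it an explicit generating function
(`mean_pow_lpp`). For intensities `1 + κ n^{-1/3}` the resulting Chernoff exponent converges, as the
mesh and then `n` tend to their limits, to a difference of two values of the cubic `κ³/3 + aκ² -
σκ`. This bounds the upper tail without boundary. It also shows that for large `r` sources win over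
sinks at intensity `1 + r n^{-1/3}`, and sinks win at `1 - r n^{-1/3}`, with probability close to
one (`exists_exit_hor`, `exists_exit_ver`).

When sources win at the left end of an interval, the increments without boundary on that interval
are at most the stationary ones; when sinks win at the right end, they are at least the stationary
ones. So the profile is squeezed between two random walks whose drifts differ from the centring by
order `n^{-1/3}`. An exponential maximal inequality on windows of order `n^{2/3}` then controls the
modulus of continuity at scale `n^{1/3}` (`exists_bulk_oscillates_le`). The lower tail at one point
follows from localising the exit point of the model with sources and rotating the environment by a
half turn (`exists_bulk_lt_le`). All bounds pass to the Poisson process because, for a fixed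
configuration, the discretized passage times are eventually exact.

In `D[a, b]`, boundedness together with asymptotic equicontinuity gives compactness. The finitely
many small `n` not covered by the estimates are handled by compact sets of functions with finitely
many separated jumps; these also yield Borel measurability, by rounding jump times to a grid.
Finally, functions with a prescribed modulus form a closed set, so the portmanteau theorem passes
the modulus bound to any weak limit, which must charge only continuous functions. -/

/-! ### Positive normalised linear functionals -/

/-- `e` is a positive normalised linear functional: the expectation of a finitely supported law. -/
structure IsMean {A : Type*} (e : (A → ℝ) → ℝ) : Prop where
  map_add : ∀ F G : A → ℝ, e (fun a => F a + G a) = e F + e G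
  map_mul : ∀ (c : ℝ) (F : A → ℝ), e (fun a => c * F a) = c * e F
  mono : ∀ F G : A → ℝ, (∀ a, F a ≤ G a) → e F ≤ e G
  map_const : ∀ c : ℝ, e (fun _ => c) = c

/-- The two functionals can be interchanged. -/
def MeanComm {A B : Type*} (e : (A → ℝ) → ℝ) (f : (B → ℝ) → ℝ) : Prop :=
  ∀ F : A → B → ℝ, e (fun a => f (fun b => F a b)) = f (fun b => e (fun a => F a b))

open Classical in
/-- The probability of `S` under the law with expectation `e`. -/
noncomputable def meanProb {A : Type*} (e : (A → ℝ) → ℝ) (S : A → Prop) : ℝ :=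
  e fun a => if S a then 1 else 0

/-- Expectation for a coin showing `true` with probability `p`. -/
def coin (p : ℝ) (F : Bool → ℝ) : ℝ := p * F true + (1 - p) * F false

/-- Prepend a term to a sequence. -/
def scons {A : Type*} (a : A) (η : ℕ → A) : ℕ → A
  | 0 => a
  | n + 1 => η n

/-- Expectation for a sequence whose first `n` terms are independent with expectation `e` and whose
other terms are equal to `d`. -/
def iidMean {A : Type*} (e : (A → ℝ) → ℝ) (d : A) : ℕ → ((ℕ → A) → ℝ) → ℝ
  | 0, F => F fun _ => d
  | n + 1, F => e fun a => iidMean e d n fun η => F (scons a η)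

theorem scons_zero {A : Type*} (a : A) (η : ℕ → A) : scons a η 0 = a := rfl

theorem scons_succ {A : Type*} (a : A) (η : ℕ → A) (n : ℕ) : scons a η (n + 1) = η n := rfl

theorem IsMean.coin {p : ℝ} (h0 : 0 ≤ p) (h1 : p ≤ 1) : IsMean (coin p) where
  map_add F G := by simp only [_root_.coin]; ring
  map_mul c F := by simp only [_root_.coin]; ring
  mono F G h := by
    have h2 : 0 ≤ 1 - p := by linarith
    simp only [_root_.coin]
    gcongr <;> exact h _
  map_const c := by simp only [_root_.coin]; ring

theorem IsMean.iid {A : Type*} {e : (A → ℝ) → ℝ} (he : IsMean e) (d : A) (n : ℕ) :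
    IsMean (iidMean e d n) := by
  induction n with
  | zero => exact ⟨fun _ _ => rfl, fun _ _ => rfl, fun _ _ h => h _, fun _ => rfl⟩
  | succ n ih =>
    refine ⟨fun F G => ?_, fun c F => ?_, fun F G h => ?_, fun c => ?_⟩
    · simp only [iidMean, ih.map_add, he.map_add]
    · simp only [iidMean, ih.map_mul, he.map_mul]
    · exact he.mono _ _ fun a => ih.mono _ _ fun η => h _
    · simp only [iidMean, ih.map_const, he.map_const]

theorem MeanComm.symm {A B : Type*} {e : (A → ℝ) → ℝ} {f : (B → ℝ) → ℝ} (h : MeanComm e f) :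
    MeanComm f e := fun F => (h fun a b => F b a).symm

theorem MeanComm.coin {A : Type*} {e : (A → ℝ) → ℝ} (he : IsMean e) (p : ℝ) :
    MeanComm (coin p) e := by
  intro F
  simp only [_root_.coin, he.map_add, he.map_mul]

theorem MeanComm.iid {A B : Type*} {e : (A → ℝ) → ℝ} {f : (B → ℝ) → ℝ} (h : MeanComm e f)
    (d : A) (n : ℕ) : MeanComm (iidMean e d n) f := by
  induction n with
  | zero => intro F; rfl
  | succ n ih =>
    intro F
    simp only [iidMean]
    rw [← h]
    congr 1
    funext a
    exact ih _

section Prob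

variable {A : Type*} {e : (A → ℝ) → ℝ} (he : IsMean e)

include he

theorem IsMean.prob_le {S : A → Prop} {F : A → ℝ} (h0 : ∀ a, 0 ≤ F a) (h : ∀ a, S a → 1 ≤ F a) :
    meanProb e S ≤ e F := by
  refine he.mono _ _ fun a => ?_
  split_ifs with hs
  · exact h a hs
  · exact h0 a

theorem IsMean.prob_mono {S T : A → Prop} (h : ∀ a, S a → T a) : meanProb e S ≤ meanProb e T := by
  refine he.mono _ _ fun a => ?_
  split_ifs with h1 h2 h2
  · exact le_rfl
  · exact absurd (h a h1) h2
  · exact zero_le_one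
  · exact le_rfl

theorem IsMean.prob_or {S T : A → Prop} :
    meanProb e (fun a => S a ∨ T a) ≤ meanProb e S + meanProb e T := by
  unfold meanProb
  rw [← he.map_add]
  refine he.mono _ _ fun a => ?_
  by_cases h1 : S a <;> by_cases h2 : T a <;> simp [h1, h2]

theorem IsMean.prob_le_one (S : A → Prop) : meanProb e S ≤ 1 := by
  rw [← he.map_const 1]
  refine he.mono _ _ fun a => ?_
  split_ifs <;> norm_num

theorem IsMean.prob_exists_lt {S : ℕ → A → Prop} (n : ℕ) {c : ℝ}
    (h : ∀ i < n, meanProb e (S i) ≤ c) :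
    meanProb e (fun a => ∃ i < n, S i a) ≤ n * c := by
  induction n with
  | zero =>
    simp only [not_lt_zero, false_and, exists_false, meanProb, if_false, Nat.cast_zero, zero_mul]
    exact (he.map_const 0).le
  | succ n ih =>
    have h1 : meanProb e (fun a => ∃ i < n + 1, S i a) ≤
        meanProb e (fun a => (∃ i < n, S i a) ∨ S n a) := by
      refine he.prob_mono ?_
      rintro a ⟨i, hi, ha⟩
      rcases Nat.lt_succ_iff_lt_or_eq.1 hi with h' | rfl
      · exact Or.inl ⟨i, h', ha⟩
      · exact Or.inr ha
    have h2 := ih fun i hi => h i (by omega)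
    have h3 := h n (by omega)
    have h4 := he.prob_or (S := fun a => ∃ i < n, S i a) (T := S n)
    push_cast
    linarith

end Prob

/-! ### The Bernoulli model: horizontal and vertical increments -/

/-- Vertical increments in a row, given the horizontal increments `U` below the row, the left
vertical increment `v` and the weights `w` of the row. -/
def vert (U : ℕ → Bool) (v : Bool) (w : ℕ → Bool) : ℕ → Bool
  | 0 => v
  | k + 1 => !U k && (vert U v w k || w k)

/-- Horizontal increments above a row. -/
def horz (U : ℕ → Bool) (v : Bool) (w : ℕ → Bool) (k : ℕ) : Bool :=
  !vert U v w k && (U k || w k)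

/-- Horizontal increments at level `j`. -/
def level (U V : ℕ → Bool) (w : ℕ → ℕ → Bool) : ℕ → ℕ → Bool
  | 0 => U
  | j + 1 => horz (level U V w j) (V j) (w j)

/-- Number of `true` among the first `k` terms. -/
def cnt (U : ℕ → Bool) (k : ℕ) : ℕ := ∑ i ∈ Finset.range k, (U i).toNat

/-- Last-passage value at `(k, j)` for boundary sources `U`, boundary sinks `V` and weights `w`
(row index first). -/
def lpp (U V : ℕ → Bool) (w : ℕ → ℕ → Bool) (k j : ℕ) : ℕ := cnt V j + cnt (level U V w j) k

theorem vert_scons (u : Bool) (U : ℕ → Bool) (v x : Bool) (w : ℕ → Bool) (k : ℕ) :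
    vert (scons u U) v (scons x w) (k + 1) = vert U (!u && (v || x)) w k := by
  induction k with
  | zero => rfl
  | succ k ih =>
    rw [vert, ih, vert]
    rfl

theorem horz_scons (u : Bool) (U : ℕ → Bool) (v x : Bool) (w : ℕ → Bool) :
    horz (scons u U) v (scons x w) =
      scons (!v && (u || x)) (horz U (!u && (v || x)) w) := by
  funext k
  cases k with
  | zero => rfl
  | succ k =>
    simp only [horz, vert_scons, scons_succ]

theorem level_scons (U : ℕ → Bool) (v : Bool) (V x : ℕ → Bool) (w : ℕ → ℕ → Bool) (j : ℕ) :
    level U (scons v V) (scons x w) (j + 1) = level (horz U v x) V w j := by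
  induction j with
  | zero => rfl
  | succ j ih =>
    rw [level, ih, level]
    rfl

theorem cnt_succ (U : ℕ → Bool) (k : ℕ) : cnt U (k + 1) = cnt U k + (U k).toNat :=
  Finset.sum_range_succ _ _

theorem cnt_scons (u : Bool) (U : ℕ → Bool) (k : ℕ) :
    cnt (scons u U) (k + 1) = u.toNat + cnt U k := by
  unfold cnt
  rw [Finset.sum_range_succ', add_comm]
  rfl

/-- A cell changes the pair of increments only in two cases: a source meeting a sink is annihilated,
and an empty pair with an occupied cell creates both. The hypothesis says that these two exchanges
of mass balance, so the product law is invariant. -/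
theorem coin_cell {p r q : ℝ} (h : (1 - p) * (1 - r) * q = p * r) (Φ : Bool → Bool → ℝ) :
    coin p (fun u => coin r fun v => coin q fun x => Φ (!v && (u || x)) (!u && (v || x))) =
      coin p fun u => coin r fun v => Φ u v := by
  simp only [coin, Bool.not_true, Bool.not_false, Bool.or_true,
    Bool.or_false, Bool.and_true, Bool.and_false]
  linear_combination (Φ true true - Φ false false) * h

/-! ### Burke's theorem for one row and for the whole grid. -/

section Burke

variable {p r q : ℝ} (hp0 : 0 ≤ p) (hp1 : p ≤ 1) (hr0 : 0 ≤ r) (hr1 : r ≤ 1)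
  (h : (1 - p) * (1 - r) * q = p * r)

include hp0 hp1 hr0 hr1 h

/-- The first cell turns its two incoming increments into an independent pair with the same law. The
horizontal one is final, and the vertical one enters the remaining `X` cells as a fresh left
boundary, to which induction applies. -/
theorem burke_row (X : ℕ) (F : (ℕ → Bool) → ℝ) :
    iidMean (coin p) false X (fun U => coin r fun v =>
      iidMean (coin q) false X fun x => F (horz U v x)) = iidMean (coin p) false X F := by
  induction X generalizing F with
  | zero =>
    simp only [iidMean]
    have : ∀ v, horz (fun _ => false) v (fun _ => false) = fun _ => false := by
      intro v; funext k; simp [horz]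
    simp only [this]
    exact (IsMean.coin hr0 hr1).map_const _
  | succ X ih =>
    have hP := (IsMean.coin hp0 hp1).iid false X
    have c1 : MeanComm (iidMean (coin p) false X) (coin r) := (MeanComm.coin hP r).symm
    have c2 : MeanComm (iidMean (coin p) false X) (coin q) := (MeanComm.coin hP q).symm
    simp only [iidMean, horz_scons]
    calc _ = coin p fun u => coin r fun v => coin q fun x =>
          iidMean (coin p) false X fun U => iidMean (coin q) false X fun y =>
            F (scons (!v && (u || x)) (horz U (!u && (v || x)) y)) := by
          congr 1; funext u
          rw [c1]
          congr 1; funext v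
          rw [c2]
      _ = coin p fun u => coin r fun v =>
          iidMean (coin p) false X fun U => iidMean (coin q) false X fun y =>
            F (scons u (horz U v y)) :=
          coin_cell h fun i j => iidMean (coin p) false X fun U => iidMean (coin q) false X fun y =>
            F (scons i (horz U j y))
      _ = _ := by
          congr 1; funext u
          rw [← c1]
          exact ih fun U => F (scons u U)

/-- Burke's theorem: the horizontal increments at level `T` are independent coins. -/
theorem burke (X T : ℕ) (F : (ℕ → Bool) → ℝ) :
    iidMean (coin p) false X (fun U => iidMean (coin r) false T fun V =>
      iidMean (iidMean (coin q) false X) (fun _ => false) T fun w => F (level U V w T)) =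
        iidMean (coin p) false X F := by
  induction T with
  | zero => rfl
  | succ T ih =>
    have hR := (IsMean.coin hr0 hr1).iid false T
    have c : MeanComm (iidMean (coin r) false T) (iidMean (coin q) false X) :=
      ((MeanComm.coin hR q).iid false X).symm
    simp only [iidMean, level_scons]
    refine Eq.trans ?_ ((burke_row hp0 hp1 hr0 hr1 h X fun U =>
      iidMean (coin r) false T fun V =>
        iidMean (iidMean (coin q) false X) (fun _ => false) T fun w => F (level U V w T)).trans ih)
    congr 1; funext U
    congr 1; funext v
    rw [c]

theorem burke_prob (X T : ℕ) (S : (ℕ → Bool) → Prop) :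
    iidMean (coin p) false X (fun U => iidMean (coin r) false T fun V =>
      meanProb (iidMean (iidMean (coin q) false X) (fun _ => false) T)
        fun w => S (level U V w T)) = meanProb (iidMean (coin p) false X) S :=
  burke hp0 hp1 hr0 hr1 h X T fun U => open Classical in if S U then 1 else 0

end Burke

/-- Change of measure between two coin laws: the density depends on the sequence only through its
number of successes. -/
theorem iidMean_tilt {r r' c ρ : ℝ} (h1 : c * ρ * r = r') (h2 : c * (1 - r) = 1 - r')
    (hr0 : 0 ≤ r) (hr1 : r ≤ 1) (T : ℕ) (F : (ℕ → Bool) → ℝ) :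
    iidMean (coin r') false T F =
      c ^ T * iidMean (coin r) false T fun V => ρ ^ cnt V T * F V := by
  induction T generalizing F with
  | zero => simp [iidMean, cnt]
  | succ T ih =>
    have hR := (IsMean.coin hr0 hr1).iid false T
    simp only [iidMean, ih, cnt_scons, pow_add, mul_assoc, hR.map_mul]
    simp only [coin, Bool.toNat_true, Bool.toNat_false, pow_zero, one_mul, pow_succ]
    rw [← h2, ← h1]
    ring

theorem iidMean_pow_cnt {p : ℝ} (hp0 : 0 ≤ p) (hp1 : p ≤ 1) (θ : ℝ) (X k : ℕ) (hk : k ≤ X) :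
    iidMean (coin p) false X (fun U => θ ^ cnt U k) = (1 + p * (θ - 1)) ^ k := by
  induction X generalizing k with
  | zero =>
    obtain rfl : k = 0 := by omega
    simp [iidMean, cnt]
  | succ X ih =>
    have hP := (IsMean.coin hp0 hp1).iid false X
    cases k with
    | zero => simpa [cnt] using ((IsMean.coin hp0 hp1).iid false (X + 1)).map_const 1
    | succ k =>
      simp only [iidMean, cnt_scons, pow_add, hP.map_mul, ih k (by omega)]
      simp only [coin, Bool.toNat_true, Bool.toNat_false, pow_one, pow_zero]
      ring

/-- The generating function of the last-passage time with tilted sinks is explicit. -/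
theorem mean_pow_lpp {p r r' q c ρ θ : ℝ} (hp0 : 0 ≤ p) (hp1 : p ≤ 1) (hr0 : 0 ≤ r) (hr1 : r ≤ 1)
    (hq0 : 0 ≤ q) (hq1 : q ≤ 1) (h : (1 - p) * (1 - r) * q = p * r)
    (h1 : c * ρ * r = r') (h2 : c * (1 - r) = 1 - r') (hθ : ρ * θ = 1) (X T k : ℕ) (hk : k ≤ X) :
    iidMean (coin p) false X (fun U => iidMean (coin r') false T fun V =>
      iidMean (iidMean (coin q) false X) (fun _ => false) T fun w => θ ^ lpp U V w k T) =
        c ^ T * (1 + p * (θ - 1)) ^ k := by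
  have hW := ((IsMean.coin hq0 hq1).iid false X).iid (fun _ => false) T
  have hP := (IsMean.coin hp0 hp1).iid false X
  have hB := burke hp0 hp1 hr0 hr1 h X T fun U => θ ^ cnt U k
  rw [← iidMean_pow_cnt hp0 hp1 θ X k hk, ← hB, ← hP.map_mul]
  congr 1; funext U
  -- The tilt turns the sinks into those of the stationary model. Its density `ρ ^ cnt V T` cancels
  -- the factor `θ ^ cnt V T` of `θ ^ lpp`, so only the top increments remain, and Burke's theorem
  -- gives their law.
  rw [iidMean_tilt h1 h2 hr0 hr1]
  congr 2; funext V
  rw [← hW.map_mul]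
  congr 1; funext w
  rw [lpp, pow_add, ← mul_assoc, ← mul_pow, hθ, one_pow, one_mul]

/-- Maximal inequality for partial sums of independent steps. -/
theorem meanProb_exists_sum_ge {p : ℝ} (hp0 : 0 ≤ p) (hp1 : p ≤ 1) (f : Bool → ℝ) {φ : ℝ}
    (hφ : coin p (fun b => Real.exp (f b)) ≤ φ) (hφ1 : 1 ≤ φ) (K X : ℕ) (hK : K ≤ X) (s : ℝ) :
    meanProb (iidMean (coin p) false X) (fun U => ∃ k ≤ K, s ≤ ∑ i ∈ Finset.range k, f (U i)) ≤
      Real.exp (-s) * φ ^ K := by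
  induction X generalizing K s with
  | zero =>
    obtain rfl : K = 0 := by omega
    rcases le_or_gt s 0 with hs | hs
    · refine (((IsMean.coin hp0 hp1).iid false 0).prob_le_one _).trans ?_
      simpa using hs
    · refine le_trans (le_of_eq ?_) (by positivity : (0 : ℝ) ≤ _)
      simp [meanProb, iidMean, hs]
  | succ X ih =>
    have hP := (IsMean.coin hp0 hp1).iid false X
    rcases le_or_gt s 0 with hs | hs
    · refine (((IsMean.coin hp0 hp1).iid false (X + 1)).prob_le_one _).trans ?_
      exact one_le_mul_of_one_le_of_one_le (Real.one_le_exp (by linarith)) (one_le_pow₀ hφ1)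
    cases K with
    | zero =>
      refine le_trans (le_of_eq ?_) (by positivity : (0 : ℝ) ≤ _)
      simp only [nonpos_iff_eq_zero, exists_eq_left, Finset.range_zero, Finset.sum_empty,
        not_le.2 hs, meanProb, if_false]
      exact ((IsMean.coin hp0 hp1).iid false (X + 1)).map_const 0
    | succ K =>
      -- Conditioning on the first step replaces the threshold `s` by `s - f b`. Once a threshold is
      -- nonpositive the claimed bound is at least one, since `1 ≤ φ`; this plays the role of
      -- optional stopping.
      have key : ∀ b : Bool, meanProb (iidMean (coin p) false X)
          (fun η => ∃ k ≤ K + 1, s ≤ ∑ i ∈ Finset.range k, f (scons b η i)) ≤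
          Real.exp (f b) * (Real.exp (-s) * φ ^ K) := by
        intro b
        refine (hP.prob_mono (T := fun η => ∃ k ≤ K, s - f b ≤
          ∑ i ∈ Finset.range k, f (η i)) ?_).trans ((ih K (by omega) (s - f b)).trans_eq ?_)
        · rintro η ⟨k, hk, hsk⟩
          cases k with
          | zero => simp at hsk; linarith
          | succ k =>
            refine ⟨k, by omega, ?_⟩
            rw [Finset.sum_range_succ'] at hsk
            simp only [scons_zero, scons_succ] at hsk
            linarith
        · rw [← mul_assoc, ← Real.exp_add]
          congr 2
          ring
      calc
        _ = coin p fun b => meanProb (iidMean (coin p) false X)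
            (fun η => ∃ k ≤ K + 1, s ≤ ∑ i ∈ Finset.range k, f (scons b η i)) := rfl
        _ ≤ coin p fun b => Real.exp (f b) * (Real.exp (-s) * φ ^ K) :=
          (IsMean.coin hp0 hp1).mono _ _ key
        _ = coin p (fun b => Real.exp (f b)) * (Real.exp (-s) * φ ^ K) := by
          simp only [coin]; ring
        _ ≤ φ * (Real.exp (-s) * φ ^ K) := by gcongr
        _ = _ := by ring

/-! ### Deterministic properties of the Bernoulli model -/

/-- The sequence without points. -/
def noPoints : ℕ → Bool := fun _ => false

theorem cnt_noPoints (k : ℕ) : cnt noPoints k = 0 := by simp [cnt, noPoints]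

theorem cnt_zero (U : ℕ → Bool) : cnt U 0 = 0 := rfl

theorem cnt_mono (U : ℕ → Bool) : Monotone (cnt U) :=
  monotone_nat_of_le_succ fun k => by rw [cnt_succ]; omega

theorem cnt_add (U : ℕ → Bool) (c k : ℕ) :
    cnt U (c + k) = cnt U c + cnt (fun i => U (c + i)) k := by
  unfold cnt
  rw [Finset.sum_range_add]

/-- The two ways round a cell carry the same total increment. Hence `lpp`, defined by going up the
left side and then along the top, also has `vert` as its vertical increments. -/
theorem vert_add_horz (U : ℕ → Bool) (v : Bool) (w : ℕ → Bool) (k : ℕ) :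
    (U k).toNat + (vert U v w (k + 1)).toNat = (vert U v w k).toNat + (horz U v w k).toNat := by
  rw [vert, horz]
  generalize vert U v w k = a
  generalize U k = b
  generalize w k = c
  revert a b c
  decide

theorem lpp_succ_left (U V : ℕ → Bool) (w : ℕ → ℕ → Bool) (k j : ℕ) :
    lpp U V w (k + 1) j = lpp U V w k j + (level U V w j k).toNat := by
  rw [lpp, lpp, cnt_succ, add_assoc]

theorem lpp_succ_right (U V : ℕ → Bool) (w : ℕ → ℕ → Bool) (k j : ℕ) :
    lpp U V w k (j + 1) = lpp U V w k j + (vert (level U V w j) (V j) (w j) k).toNat := by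
  induction k with
  | zero => simp [lpp, cnt_succ, cnt_zero, vert]
  | succ k ih =>
    have := vert_add_horz (level U V w j) (V j) (w j) k
    rw [lpp_succ_left, lpp_succ_left, ih, level]
    omega

theorem lpp_zero_left (U V : ℕ → Bool) (w : ℕ → ℕ → Bool) (j : ℕ) : lpp U V w 0 j = cnt V j := rfl

theorem lpp_zero_right (U V : ℕ → Bool) (w : ℕ → ℕ → Bool) (k : ℕ) : lpp U V w k 0 = cnt U k := by
  simp [lpp, cnt_zero, level]

theorem lpp_succ_succ (U V : ℕ → Bool) (w : ℕ → ℕ → Bool) (k j : ℕ) :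
    lpp U V w (k + 1) (j + 1) =
      max (max (lpp U V w k (j + 1)) (lpp U V w (k + 1) j)) (lpp U V w k j + (w j k).toNat) := by
  rw [lpp_succ_right U V w (k + 1), lpp_succ_left, lpp_succ_right, vert]
  generalize vert (level U V w j) (V j) (w j) k = a
  generalize level U V w j k = b
  generalize w j k = c
  cases a <;> cases b <;> cases c <;> simp

/-- An optimal path collects either sources or sinks, never both. Formally, the recursion commutes
with maxima, so it suffices to compare boundary values. -/
theorem lpp_eq_max (U V : ℕ → Bool) (w : ℕ → ℕ → Bool) (k j : ℕ) :
    lpp U V w k j = max (lpp U noPoints w k j) (lpp noPoints V w k j) := by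
  induction j generalizing k with
  | zero => simp [lpp_zero_right, cnt_noPoints]
  | succ j ihj =>
    induction k with
    | zero => simp [lpp_zero_left, cnt_noPoints]
    | succ k ihk =>
      rw [lpp_succ_succ, lpp_succ_succ, lpp_succ_succ, ihk, ihj, ihj]
      omega

theorem lpp_noPoints (w : ℕ → ℕ → Bool) (k j : ℕ) :
    lpp noPoints noPoints w k j = cnt (level noPoints noPoints w j) k := by
  rw [lpp, cnt_noPoints, zero_add]

theorem vert_anti {U U' : ℕ → Bool} (hU : U ≤ U') {v v' : Bool} (hv : v' ≤ v) (w : ℕ → Bool) :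
    vert U' v' w ≤ vert U v w := by
  intro k
  change (vert U' v' w k : Bool) ≤ vert U v w k
  induction k with
  | zero => exact hv
  | succ k ih =>
    have : (U k : Bool) ≤ U' k := hU k
    rw [vert, vert]
    revert ih this
    generalize vert U v w k = a
    generalize vert U' v' w k = a'
    generalize U k = b
    generalize U' k = b'
    generalize w k = c
    revert a a' b b' c
    decide

theorem horz_mono {U U' : ℕ → Bool} (hU : U ≤ U') {v v' : Bool} (hv : v' ≤ v) (w : ℕ → Bool) :
    horz U v w ≤ horz U' v' w := by
  intro k
  have h1 : (vert U' v' w k : Bool) ≤ vert U v w k := vert_anti hU hv w k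
  have h2 : (U k : Bool) ≤ U' k := hU k
  change (horz U v w k : Bool) ≤ horz U' v' w k
  rw [horz, horz]
  revert h1 h2
  generalize vert U v w k = a
  generalize vert U' v' w k = a'
  generalize U k = b
  generalize U' k = b'
  generalize w k = c
  revert a a' b b' c
  decide

/-- Attractiveness: more sources and fewer sinks increase the horizontal increments. -/
theorem level_mono {U U' V V' : ℕ → Bool} (hU : U ≤ U') (hV : V' ≤ V) (w : ℕ → ℕ → Bool) (j : ℕ) :
    level U V w j ≤ level U' V' w j := by
  induction j with
  | zero => exact hU
  | succ j ih => exact horz_mono ih (hV j) _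

theorem noPoints_le (U : ℕ → Bool) : noPoints ≤ U := fun _ => Bool.false_le _

/-! ### Comparison of increments with and without boundary. -/

theorem cnt_increment_le {U U' : ℕ → Bool} (h : U ≤ U') {k k' : ℕ} (hk : k ≤ k') :
    cnt U k' + cnt U' k ≤ cnt U' k' + cnt U k := by
  induction k', hk using Nat.le_induction with
  | base => omega
  | succ m hm ih =>
    have h1 := Bool.toNat_le_toNat (h m)
    rw [cnt_succ, cnt_succ]
    omega

/-- By attractiveness the source-only value grows at least as fast in `k` as the sink-only value, so
once sources win at `k₀` they win everywhere to the right. There the full model has the increments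
of the source-only one, which dominate those without boundary. -/
theorem increment_le_of_hor {U V : ℕ → Bool} {w : ℕ → ℕ → Bool} {T k₀ k k' : ℕ}
    (h : lpp noPoints V w k₀ T ≤ lpp U noPoints w k₀ T) (hk : k₀ ≤ k) (hk' : k ≤ k') :
    lpp noPoints noPoints w k' T + cnt (level U V w T) k ≤
      cnt (level U V w T) k' + lpp noPoints noPoints w k T := by
  have dom : ∀ l, k₀ ≤ l → lpp noPoints V w l T ≤ lpp U noPoints w l T := by
    intro l hl
    have := cnt_increment_le (level_mono (noPoints_le U) (noPoints_le V) w T) hl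
    unfold lpp at h ⊢
    rw [cnt_noPoints] at h ⊢
    omega
  have e1 := lpp_eq_max U V w k T
  have e2 := lpp_eq_max U V w k' T
  rw [max_eq_left (dom k hk), lpp, lpp, cnt_noPoints] at e1
  rw [max_eq_left (dom k' (hk.trans hk')), lpp, lpp, cnt_noPoints] at e2
  have := cnt_increment_le (level_mono (noPoints_le U) le_rfl w T :
    level noPoints noPoints w T ≤ level U noPoints w T) hk'
  rw [lpp_noPoints, lpp_noPoints]
  omega

/-- Mirror image of `increment_le_of_hor`: if sinks win at `k₁` they win everywhere to the left, and
sinks decrease horizontal increments. -/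
theorem le_increment_of_ver {U V : ℕ → Bool} {w : ℕ → ℕ → Bool} {T k₁ k k' : ℕ}
    (h : lpp U noPoints w k₁ T ≤ lpp noPoints V w k₁ T) (hk : k ≤ k') (hk' : k' ≤ k₁) :
    cnt (level U V w T) k' + lpp noPoints noPoints w k T ≤
      lpp noPoints noPoints w k' T + cnt (level U V w T) k := by
  have dom : ∀ l, l ≤ k₁ → lpp U noPoints w l T ≤ lpp noPoints V w l T := by
    intro l hl
    have := cnt_increment_le (level_mono (noPoints_le U) (noPoints_le V) w T) hl
    unfold lpp at h ⊢
    rw [cnt_noPoints] at h ⊢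
    omega
  have e1 := lpp_eq_max U V w k T
  have e2 := lpp_eq_max U V w k' T
  rw [max_eq_right (dom k (hk.trans hk')), lpp, lpp] at e1
  rw [max_eq_right (dom k' hk'), lpp, lpp] at e2
  have := cnt_increment_le (level_mono le_rfl (noPoints_le V) w T :
    level noPoints V w T ≤ level noPoints noPoints w T) hk
  rw [lpp_noPoints, lpp_noPoints]
  omega

/-! ### Chains of cells -/

/-- There is a chain of `len` open cells in the columns `[i, k)` and the rows `[0, j)`. -/
def HasChain (w : ℕ → ℕ → Bool) (i k j len : ℕ) : Prop :=
  ∃ p : Fin len → ℕ × ℕ, (StrictMono fun a => (p a).1) ∧ (StrictMono fun a => (p a).2) ∧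
    ∀ a, i ≤ (p a).1 ∧ (p a).1 < k ∧ (p a).2 < j ∧ w (p a).2 (p a).1 = true

theorem HasChain.zero (w : ℕ → ℕ → Bool) (i k j : ℕ) : HasChain w i k j 0 :=
  ⟨fun a => a.elim0, fun a => a.elim0, fun a => a.elim0, fun a => a.elim0⟩

theorem HasChain.mono {w : ℕ → ℕ → Bool} {i k j i' k' j' len : ℕ} (h : HasChain w i k j len)
    (hi : i' ≤ i) (hk : k ≤ k') (hj : j ≤ j') : HasChain w i' k' j' len := by
  obtain ⟨p, h1, h2, h3⟩ := h
  refine ⟨p, h1, h2, fun a => ?_⟩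
  have := h3 a
  exact ⟨by omega, by omega, by omega, this.2.2.2⟩

theorem HasChain.snoc {w : ℕ → ℕ → Bool} {i k j len : ℕ} (h : HasChain w i k j len)
    (hi : i ≤ k) (hw : w j k = true) : HasChain w i (k + 1) (j + 1) (len + 1) := by
  obtain ⟨p, h1, h2, h3⟩ := h
  refine ⟨Fin.snoc (α := fun _ => ℕ × ℕ) p (k, j), ?_, ?_, ?_⟩
  · intro a b hab
    induction b using Fin.lastCases with
    | last =>
      induction a using Fin.lastCases with
      | last => exact absurd hab (lt_irrefl _)
      | cast a => simpa using (h3 a).2.1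
    | cast b =>
      induction a using Fin.lastCases with
      | last => exact absurd hab (not_lt.2 (Fin.le_last _))
      | cast a => simpa using h1 (Fin.castSucc_lt_castSucc_iff.1 hab)
  · intro a b hab
    induction b using Fin.lastCases with
    | last =>
      induction a using Fin.lastCases with
      | last => exact absurd hab (lt_irrefl _)
      | cast a => simpa using (h3 a).2.2.1
    | cast b =>
      induction a using Fin.lastCases with
      | last => exact absurd hab (not_lt.2 (Fin.le_last _))
      | cast a => simpa using h2 (Fin.castSucc_lt_castSucc_iff.1 hab)
  · intro a
    induction a using Fin.lastCases with
    | last => simpa using ⟨hi, hw⟩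
    | cast a =>
      have := h3 a
      simp only [Fin.snoc_castSucc]
      exact ⟨this.1, by omega, by omega, this.2.2.2⟩

/-- The three cases match the recursion `lpp_succ_succ`: the last cell of the chain misses the last
column, misses the top row, or is the corner. -/
theorem HasChain.cases_succ {w : ℕ → ℕ → Bool} {i k j len : ℕ}
    (h : HasChain w i (k + 1) (j + 1) (len + 1)) :
    HasChain w i k (j + 1) (len + 1) ∨ HasChain w i (k + 1) j (len + 1) ∨
      (w j k = true ∧ HasChain w i k j len) := by
  obtain ⟨p, h1, h2, h3⟩ := h
  have hl := h3 (Fin.last len)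
  have m1 : ∀ a, (p a).1 ≤ (p (Fin.last len)).1 := fun a => h1.monotone (Fin.le_last a)
  have m2 : ∀ a, (p a).2 ≤ (p (Fin.last len)).2 := fun a => h2.monotone (Fin.le_last a)
  by_cases c1 : (p (Fin.last len)).1 < k
  · exact Or.inl ⟨p, h1, h2, fun a => ⟨(h3 a).1, (m1 a).trans_lt c1, (h3 a).2.2⟩⟩
  by_cases c2 : (p (Fin.last len)).2 < j
  · exact Or.inr (Or.inl ⟨p, h1, h2, fun a => ⟨(h3 a).1, (h3 a).2.1, (m2 a).trans_lt c2,
      (h3 a).2.2.2⟩⟩)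
  have e1 : (p (Fin.last len)).1 = k := by omega
  have e2 : (p (Fin.last len)).2 = j := by omega
  refine Or.inr (Or.inr ⟨?_, fun a => p a.castSucc, ?_, ?_, fun a => ⟨(h3 _).1, ?_, ?_, (h3 _).2.2.2⟩⟩)
  · have := hl.2.2.2
    rwa [e1, e2] at this
  · exact fun a b hab => h1 (Fin.castSucc_lt_castSucc_iff.2 hab)
  · exact fun a b hab => h2 (Fin.castSucc_lt_castSucc_iff.2 hab)
  · rw [← e1]; exact h1 (Fin.castSucc_lt_last a)
  · rw [← e2]; exact h2 (Fin.castSucc_lt_last a)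

theorem HasChain.len_eq_zero {w : ℕ → ℕ → Bool} {i k j len : ℕ} (h : HasChain w i k j len)
    (h0 : k ≤ i ∨ j = 0) : len = 0 := by
  obtain ⟨p, -, -, h3⟩ := h
  cases len with
  | zero => rfl
  | succ len =>
    have := h3 0
    omega

/-- Last-passage values with sources only, in terms of the exit point from the axis. -/
theorem le_lpp_hor_iff (U : ℕ → Bool) (w : ℕ → ℕ → Bool) (k j l : ℕ) :
    l ≤ lpp U noPoints w k j ↔ ∃ i ≤ k, ∃ len, HasChain w i k j len ∧ l ≤ cnt U i + len := by
  induction j generalizing k l with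
  | zero =>
    rw [lpp_zero_right]
    constructor
    · exact fun h => ⟨k, le_rfl, 0, HasChain.zero _ _ _ _, h⟩
    · rintro ⟨i, hi, len, hc, hl⟩
      obtain rfl := hc.len_eq_zero (Or.inr rfl)
      exact hl.trans (cnt_mono U hi)
  | succ j ihj =>
    induction k generalizing l with
    | zero =>
      rw [lpp_zero_left, cnt_noPoints]
      constructor
      · exact fun h => ⟨0, le_rfl, 0, HasChain.zero _ _ _ _, h.trans (Nat.zero_le _)⟩
      · rintro ⟨i, hi, len, hc, hl⟩
        obtain rfl := hc.len_eq_zero (Or.inl (Nat.zero_le _))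
        obtain rfl : i = 0 := by omega
        simpa [cnt_zero] using hl
    | succ k ihk =>
      rw [lpp_succ_succ, le_max_iff, le_max_iff, ihk, ihj]
      constructor
      · rintro ((⟨i, hi, len, hc, hl⟩ | ⟨i, hi, len, hc, hl⟩) | h)
        · exact ⟨i, by omega, len, hc.mono le_rfl (by omega) le_rfl, hl⟩
        · exact ⟨i, by omega, len, hc.mono le_rfl le_rfl (by omega), hl⟩
        · by_cases hw : w j k = true
          · have h' : l - 1 ≤ lpp U noPoints w k j := by
              rw [hw] at h
              simp at h
              omega
            obtain ⟨i, hi, len, hc, hl⟩ := (ihj k _).1 h'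
            exact ⟨i, by omega, len + 1, hc.snoc hi hw, by omega⟩
          · have h' : l ≤ lpp U noPoints w k j := by
              simpa [Bool.eq_false_of_not_eq_true hw] using h
            obtain ⟨i, hi, len, hc, hl⟩ := (ihj k _).1 h'
            exact ⟨i, by omega, len, hc.mono le_rfl (by omega) (by omega), hl⟩
      · rintro ⟨i, hi, len, hc, hl⟩
        rcases hi.eq_or_lt with rfl | hi
        · obtain rfl := hc.len_eq_zero (Or.inl le_rfl)
          exact Or.inl (Or.inr ⟨k + 1, le_rfl, 0, HasChain.zero _ _ _ _, hl⟩)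
        cases len with
        | zero => exact Or.inl (Or.inr ⟨i, by omega, 0, HasChain.zero _ _ _ _, hl⟩)
        | succ len =>
          rcases hc.cases_succ with hc | hc | ⟨hw, hc⟩
          · exact Or.inl (Or.inl ⟨i, by omega, _, hc, hl⟩)
          · exact Or.inl (Or.inr ⟨i, by omega, _, hc, hl⟩)
          · refine Or.inr ?_
            have := (ihj k (l - 1)).2 ⟨i, by omega, len, hc, by omega⟩
            rw [hw]
            simp only [Bool.toNat_true]
            omega

theorem hasChain_iff (w : ℕ → ℕ → Bool) (k j len : ℕ) :
    HasChain w 0 k j len ↔ len ≤ lpp noPoints noPoints w k j := by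
  rw [le_lpp_hor_iff]
  constructor
  · exact fun h => ⟨0, Nat.zero_le _, len, h, by omega⟩
  · rintro ⟨i, hi, l, ⟨p, h1, h2, h3⟩, hl⟩
    rw [cnt_noPoints, zero_add] at hl
    refine ⟨fun a => p (Fin.castLE hl a), fun a b hab => h1 (by simpa using hab),
      fun a b hab => h2 (by simpa using hab), fun a => ⟨Nat.zero_le _, (h3 _).2⟩⟩

/-! ### Rotation and translation of the environment -/

/-- Reverse the first `n` terms and set the other ones to `d`. -/
def sreverse {A : Type*} (d : A) (n : ℕ) (η : ℕ → A) (i : ℕ) : A :=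
  if i < n then η (n - 1 - i) else d

/-- The environment in `[0, k) × [0, T)` rotated by a half turn. -/
def rotate (k T : ℕ) (w : ℕ → ℕ → Bool) : ℕ → ℕ → Bool :=
  sreverse noPoints T fun j => sreverse false k (w j)

/-- A half turn exchanges varying starting points on the bottom side with varying end points on the
top side. A chain leaving the axis at `i` thus becomes one counted by the value without boundary at
column `k - i`. -/
theorem HasChain.rotate {w : ℕ → ℕ → Bool} {i k T len : ℕ} (h : HasChain w i k T len) :
    HasChain (rotate k T w) 0 (k - i) T len := by
  obtain ⟨p, h1, h2, h3⟩ := h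
  refine ⟨fun a => (k - 1 - (p a.rev).1, T - 1 - (p a.rev).2), ?_, ?_, ?_⟩
  · intro a b hab
    have := h1 (Fin.rev_lt_rev.2 hab)
    have := h3 a.rev
    simp only at *
    omega
  · intro a b hab
    have := h2 (Fin.rev_lt_rev.2 hab)
    have := h3 a.rev
    simp only at *
    omega
  · intro a
    have := h3 a.rev
    refine ⟨Nat.zero_le _, by simp only; omega, by simp only; omega, ?_⟩
    simp only [_root_.rotate]
    rw [sreverse, if_pos (by omega), sreverse, if_pos (by omega)]
    rw [show T - 1 - (T - 1 - (p a.rev).2) = (p a.rev).2 by omega,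
      show k - 1 - (k - 1 - (p a.rev).1) = (p a.rev).1 by omega]
    exact this.2.2.2

theorem HasChain.translate {w : ℕ → ℕ → Bool} {i k T len : ℕ} (c : ℕ) (h : HasChain w i k T len)
    (hc : c ≤ i) : HasChain (fun j l => w j (c + l)) (i - c) (k - c) T len := by
  obtain ⟨p, h1, h2, h3⟩ := h
  refine ⟨fun a => ((p a).1 - c, (p a).2), ?_, h2, ?_⟩
  · intro a b hab
    have := h1 hab
    have := h3 a
    simp only at *
    omega
  · intro a
    have := h3 a
    refine ⟨by simp only; omega, by simp only; omega, this.2.2.1, ?_⟩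
    simp only
    rw [show c + ((p a).1 - c) = (p a).1 by omega]
    exact this.2.2.2

/-! ### Invariance of the law of the environment under rotation and translation. -/

theorem iidMean_succ_last {A : Type*} {e : (A → ℝ) → ℝ} (hc : MeanComm e e) (d : A) (n : ℕ)
    (F : (ℕ → A) → ℝ) :
    iidMean e d (n + 1) F = e fun a => iidMean e d n fun η => F (Function.update η n a) := by
  induction n generalizing F with
  | zero =>
    simp only [iidMean]
    congr 1; funext a
    congr 1; funext i
    cases i with
    | zero => simp [scons]
    | succ i => simp [scons]
  | succ n ih =>
    rw [iidMean]
    conv_lhs => simp only [ih]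
    rw [hc]
    congr 1; funext b
    refine Eq.trans ?_ (rfl : (e fun a => iidMean e d n fun η =>
      F (Function.update (scons a η) (n + 1) b)) = _)
    congr 1; funext a
    congr 1; funext η
    congr 1; funext i
    cases i with
    | zero => simp [scons]
    | succ i => simp [scons, Function.update_apply]

theorem iidMean_reverse {A : Type*} {e : (A → ℝ) → ℝ} (hc : MeanComm e e) (d : A) (n : ℕ)
    (F : (ℕ → A) → ℝ) :
    iidMean e d n (fun η => F (sreverse d n η)) = iidMean e d n F := by
  induction n generalizing F with
  | zero => rfl
  | succ n ih =>
    have : ∀ (a : A) (η : ℕ → A),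
        sreverse d (n + 1) (scons a η) = Function.update (sreverse d n η) n a := by
      intro a η
      funext i
      rw [Function.update_apply]
      unfold sreverse
      rcases lt_trichotomy i n with h | rfl | h
      · rw [if_pos (by omega), if_neg (by omega), if_pos h,
          show n + 1 - 1 - i = (n - 1 - i) + 1 by omega, scons_succ]
      · simp [scons]
      · rw [if_neg (by omega), if_neg (by omega), if_neg (by omega)]
    rw [iidMean_succ_last hc d n F]
    simp only [iidMean, this]
    congr 1; funext a
    exact ih fun η => F (Function.update η n a)

theorem iidMean_drop {A : Type*} {e : (A → ℝ) → ℝ} (he : IsMean e) (d : A) (c n : ℕ)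
    (F : (ℕ → A) → ℝ) :
    iidMean e d (c + n) (fun η => F fun i => η (c + i)) = iidMean e d n F := by
  induction c with
  | zero => simp
  | succ c ih =>
    have : ∀ (a : A) (η : ℕ → A), (fun i => scons a η (c + 1 + i)) = fun i => η (c + i) := by
      intro a η
      funext i
      rw [show c + 1 + i = c + i + 1 by omega, scons_succ]
    rw [show c + 1 + n = c + n + 1 by omega, iidMean]
    simp only [this, ih, he.map_const]

theorem iidMean_comp {A : Type*} {e e' : (A → ℝ) → ℝ} {g : A → A}
    (hg : ∀ F, e (fun a => F (g a)) = e' F) {d : A} (hd : g d = d) (n : ℕ) (F : (ℕ → A) → ℝ) :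
    iidMean e d n (fun η => F fun i => g (η i)) = iidMean e' d n F := by
  induction n generalizing F with
  | zero => simp only [iidMean, hd]
  | succ n ih =>
    have : ∀ (a : A) (η : ℕ → A), (fun i => g (scons a η i)) = scons (g a) fun i => g (η i) := by
      intro a η
      funext i
      cases i <;> rfl
    simp only [iidMean, this]
    rw [← hg]
    congr 1; funext a
    exact ih fun η => F (scons (g a) η)

/-- Expectation for the environment of independent coins in `[0, X) × [0, T)`. -/
noncomputable def envMean (q : ℝ) (X T : ℕ) : ((ℕ → ℕ → Bool) → ℝ) → ℝ :=
  iidMean (iidMean (coin q) false X) noPoints T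

section Env

variable {q : ℝ} (h0 : 0 ≤ q) (h1 : q ≤ 1)

include h0 h1

theorem isMean_iidCoin (X : ℕ) : IsMean (iidMean (coin q) false X) := (IsMean.coin h0 h1).iid _ _

theorem isMean_envMean (X T : ℕ) : IsMean (envMean q X T) := (isMean_iidCoin h0 h1 X).iid _ _

theorem envMean_rotate (X T : ℕ) (F : (ℕ → ℕ → Bool) → ℝ) :
    envMean q X T (fun w => F (rotate X T w)) = envMean q X T F := by
  have hX := isMean_iidCoin h0 h1 X
  have hc : MeanComm (iidMean (coin q) false X) (iidMean (coin q) false X) :=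
    (MeanComm.coin hX q).iid _ _
  have hd : sreverse false X noPoints = noPoints := by
    funext i
    simp [sreverse, noPoints]
  unfold envMean
  rw [← iidMean_reverse hc noPoints T F]
  exact iidMean_comp (g := sreverse false X)
    (fun G => iidMean_reverse (MeanComm.coin (IsMean.coin h0 h1) q) false X G) hd T
    fun w => F (sreverse noPoints T w)

theorem envMean_translate (c X T : ℕ) (F : (ℕ → ℕ → Bool) → ℝ) :
    envMean q (c + X) T (fun w => F fun j l => w j (c + l)) = envMean q X T F :=
  iidMean_comp (g := fun (U : ℕ → Bool) l => U (c + l))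
    (fun G => iidMean_drop (IsMean.coin h0 h1) false c X G) rfl T F

end Env

/-! ### Asymptotics of the generating function -/

/-- Third order suffices: the logarithm is later multiplied by terms of order at most `N ^ 3`, while
the remainder is of order `N ^ (-4)`. -/
theorem tendsto_cube_mul_log_remainder (κ : ℝ) :
    Tendsto (fun N : ℝ => N ^ 3 * (Real.log (1 + κ / N) -
      (κ / N - (κ / N) ^ 2 / 2 + (κ / N) ^ 3 / 3))) atTop (𝓝 0) := by
  have hlim : Tendsto (fun N : ℝ => 2 * κ ^ 4 / N) atTop (𝓝 0) :=
    tendsto_const_nhds.div_atTop tendsto_id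
  refine squeeze_zero_norm' ?_ hlim
  filter_upwards [eventually_ge_atTop (2 * |κ| + 1)] with N hN
  have hN0 : 0 < N := by linarith [abs_nonneg κ]
  set y := κ / N with hy
  have hyabs : |y| ≤ 1 / 2 := by
    rw [hy, abs_div, abs_of_pos hN0, div_le_iff₀ hN0]
    linarith
  have hy' : |(-y)| < 1 := by rw [abs_neg]; linarith
  have := Real.abs_log_sub_add_sum_range_le hy' 3
  simp only [Finset.sum_range_succ, Finset.sum_range_zero, sub_neg_eq_add, abs_neg] at this
  norm_num at this
  have h2 : |y| ^ 4 / (1 - |y|) ≤ 2 * y ^ 4 := by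
    rw [div_le_iff₀ (by linarith)]
    have : |y| ^ 4 = y ^ 4 := by rw [← abs_pow, abs_of_nonneg (by positivity)]
    rw [this]
    nlinarith [show 0 ≤ y ^ 4 by positivity]
  have h3 : |Real.log (1 + y) - (y - y ^ 2 / 2 + y ^ 3 / 3)| ≤ 2 * y ^ 4 := by
    refine le_trans (le_of_eq ?_) (this.trans h2)
    congr 1
    ring
  rw [Real.norm_eq_abs, abs_mul, abs_of_pos (by positivity : 0 < N ^ 3)]
  calc N ^ 3 * |Real.log (1 + y) - (y - y ^ 2 / 2 + y ^ 3 / 3)| ≤ N ^ 3 * (2 * y ^ 4) := by gcongr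
    _ = 2 * κ ^ 4 / N := by rw [hy]; field_simp

/-- The rate function of the tilted last-passage time in the cube-root scaling. -/
noncomputable def cubicRate (a σ κ : ℝ) : ℝ := κ ^ 3 / 3 + a * κ ^ 2 - σ * κ

/-- With `N = n^{1/3}`, all terms of positive order in `N` cancel; this is what the centring `2N³ +
2aN²` and the intensity near `1` achieve. The cubic collects the terms of order zero. -/
theorem tendsto_rate (a σ κ : ℝ) :
    Tendsto (fun N : ℝ => -(N ^ 3 / (1 + κ / N)) + (N ^ 3 + 2 * a * N ^ 2) * (1 + κ / N) -
      (2 * N ^ 3 + 2 * a * N ^ 2 + σ * N) * Real.log (1 + κ / N) - 2 * a * N ^ 2)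
      atTop (𝓝 (cubicRate a σ κ)) := by
  have hE := tendsto_cube_mul_log_remainder κ
  have hi : Tendsto (fun N : ℝ => N⁻¹) atTop (𝓝 0) := tendsto_inv_atTop_zero
  have h1 : Tendsto (fun N : ℝ => κ ^ 4 * N⁻¹ * (1 + κ * N⁻¹)⁻¹) atTop (𝓝 0) := by
    have : Tendsto (fun N : ℝ => κ ^ 4 * N⁻¹ * (1 + κ * N⁻¹)⁻¹) atTop
        (𝓝 (κ ^ 4 * 0 * (1 + κ * 0)⁻¹)) :=
      (hi.const_mul _).mul ((tendsto_const_nhds.add (hi.const_mul _)).inv₀ (by norm_num))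
    simpa using this
  have h2 : Tendsto (fun N : ℝ => (-(2 * a * κ ^ 3 / 3) + σ * κ ^ 2 / 2) * N⁻¹ -
      σ * κ ^ 3 / 3 * (N⁻¹ * N⁻¹)) atTop (𝓝 0) := by
    have := (hi.const_mul (-(2 * a * κ ^ 3 / 3) + σ * κ ^ 2 / 2)).sub
      ((hi.mul hi).const_mul (σ * κ ^ 3 / 3))
    simpa using this
  have h3 : Tendsto (fun N : ℝ => (2 + 2 * a * N⁻¹ + σ * (N⁻¹ * N⁻¹)) * (N ^ 3 *
      (Real.log (1 + κ / N) - (κ / N - (κ / N) ^ 2 / 2 + (κ / N) ^ 3 / 3)))) atTop (𝓝 0) := by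
    have := (((hi.const_mul (2 * a)).const_add 2).add ((hi.mul hi).const_mul σ)).mul hE
    simpa using this
  have := ((tendsto_const_nhds (x := cubicRate a σ κ)).sub h1 |>.add h2).sub h3
  simp only [sub_zero, add_zero] at this
  refine this.congr' ?_
  filter_upwards [eventually_ge_atTop (2 * |κ| + 1)] with N hN
  have hN0 : 0 < N := by linarith [abs_nonneg κ]
  have hN1 : 0 < 1 + κ / N := by
    have : -(1 / 2) ≤ κ / N := by
      rw [le_div_iff₀ hN0]
      linarith [neg_abs_le κ]
    linarith
  have hN2 : N + κ ≠ 0 := by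
    have : 1 + κ / N = (N + κ) / N := by field_simp
    rw [this] at hN1
    intro h
    rw [h] at hN1
    simp at hN1
  generalize Real.log (1 + κ / N) = l
  unfold cubicRate
  have e1 : 1 + κ / N = (N + κ) / N := by field_simp
  have e2 : 1 + κ * N⁻¹ = (N + κ) / N := by field_simp
  rw [e1, e2]
  field_simp
  ring

/-- The exponent in the Chernoff bound for sources of intensity `w`, sinks of intensity `1 / z`. -/
noncomputable def chernoffExponent (n x l w z : ℝ) : ℝ :=
  n * (1 / w - 1 / z) + x * (z - w) - l * Real.log (z / w)

/-- The intensity `1 + κ n^{-1/3}`. -/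
noncomputable def intensity (n : ℕ) (κ : ℝ) : ℝ := 1 + κ / (n : ℝ) ^ (1 / 3 : ℝ)

theorem tendsto_scale : Tendsto (fun n : ℕ => (n : ℝ) ^ (1 / 3 : ℝ)) atTop atTop :=
  (tendsto_rpow_atTop (by norm_num)).comp tendsto_natCast_atTop_atTop

theorem scale_sq (n : ℕ) : (n : ℝ) ^ (2 / 3 : ℝ) = ((n : ℝ) ^ (1 / 3 : ℝ)) ^ 2 := by
  rw [← Real.rpow_natCast, ← Real.rpow_mul (Nat.cast_nonneg n)]
  norm_num

theorem scale_cube (n : ℕ) : ((n : ℝ) ^ (1 / 3 : ℝ)) ^ 3 = n := by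
  rw [← Real.rpow_natCast, ← Real.rpow_mul (Nat.cast_nonneg n)]
  norm_num

theorem tendsto_intensity (κ : ℝ) : Tendsto (fun n => intensity n κ) atTop (𝓝 1) := by
  have : Tendsto (fun n : ℕ => κ / (n : ℝ) ^ (1 / 3 : ℝ)) atTop (𝓝 0) :=
    tendsto_const_nhds.div_atTop tendsto_scale
  simpa [intensity] using this.const_add 1

theorem eventually_intensity_pos (κ : ℝ) : ∀ᶠ n in atTop, 0 < intensity n κ :=
  (tendsto_intensity κ).eventually (lt_mem_nhds one_pos)

/-- Splitting `log (z / w)` makes the exponent a difference of the same function at `κ₂` and `κ₁`,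
so `tendsto_rate` applies twice. -/
theorem tendsto_chernoffExponent (a σ κ₁ κ₂ : ℝ) :
    Tendsto (fun n : ℕ => chernoffExponent n (n + 2 * a * (n : ℝ) ^ (2 / 3 : ℝ))
      (n + 2 * a * (n : ℝ) ^ (2 / 3 : ℝ) + n + σ * (n : ℝ) ^ (1 / 3 : ℝ))
      (intensity n κ₁) (intensity n κ₂)) atTop (𝓝 (cubicRate a σ κ₂ - cubicRate a σ κ₁)) := by
  have h := ((tendsto_rate a σ κ₂).comp tendsto_scale).sub ((tendsto_rate a σ κ₁).comp tendsto_scale)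
  refine h.congr' ?_
  filter_upwards [eventually_intensity_pos κ₁, eventually_intensity_pos κ₂] with n h1 h2
  simp only [Function.comp_apply, chernoffExponent]
  rw [Real.log_div h2.ne' h1.ne']
  simp only [scale_cube, scale_sq, intensity]
  ring

theorem tendsto_one_add_pow {b : ℕ → ℝ} {k : ℕ → ℕ} {L x : ℝ}
    (hb : Tendsto (fun m : ℕ => m * b m) atTop (𝓝 L))
    (hk : Tendsto (fun m : ℕ => (k m : ℝ) / m) atTop (𝓝 x)) (hpos : ∀ m, 0 < 1 + b m) :
    Tendsto (fun m => (1 + b m) ^ k m) atTop (𝓝 (Real.exp (x * L))) := by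
  have h1 := Real.tendsto_nat_mul_log_one_add_of_tendsto hb
  refine ((Real.continuous_exp.tendsto _).comp (hk.mul h1)).congr' ?_
  filter_upwards [eventually_gt_atTop 0] with m hm
  have hm' : (m : ℝ) ≠ 0 := by positivity
  simp only [Function.comp_apply]
  rw [div_mul_eq_mul_div, ← mul_assoc, mul_comm (k m : ℝ) m, mul_assoc, mul_div_assoc,
    mul_div_cancel₀ _ hm', ← Real.log_pow, Real.exp_log (pow_pos (hpos m) _)]

/-! ### The Bernoulli model with mesh `1 / m` -/

/-- Expectation for a pair of independent variables. -/
def prodMean {A B : Type*} (e : (A → ℝ) → ℝ) (f : (B → ℝ) → ℝ) (F : A × B → ℝ) : ℝ :=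
  e fun a => f fun b => F (a, b)

theorem IsMean.prod {A B : Type*} {e : (A → ℝ) → ℝ} {f : (B → ℝ) → ℝ} (he : IsMean e)
    (hf : IsMean f) : IsMean (prodMean e f) where
  map_add F G := by simp only [prodMean, hf.map_add, he.map_add]
  map_mul c F := by simp only [prodMean, hf.map_mul, he.map_mul]
  mono F G h := he.mono _ _ fun a => hf.mono _ _ fun b => h _
  map_const c := by simp only [prodMean, hf.map_const, he.map_const]

theorem meanProb_prod_fst {A B : Type*} {e : (A → ℝ) → ℝ} {f : (B → ℝ) → ℝ} (hf : IsMean f)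
    (S : A → Prop) : meanProb (prodMean e f) (fun x => S x.1) = meanProb e S := by
  simp only [meanProb, prodMean]
  congr 1; funext a
  exact hf.map_const (open Classical in if S a then 1 else 0)

theorem meanProb_prod_snd {A B : Type*} {e : (A → ℝ) → ℝ} {f : (B → ℝ) → ℝ} (he : IsMean e)
    (S : B → Prop) : meanProb (prodMean e f) (fun x => S x.2) = meanProb f S := by
  simp only [meanProb, prodMean]
  exact he.map_const (f fun b => open Classical in if S b then 1 else 0)

/-- Probability that a cell of side `1 / m` contains a Poisson point. -/
noncomputable def cellProb (m : ℕ) : ℝ := 1 - Real.exp (-(1 / (m : ℝ) ^ 2))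

/-- Source probability for the intensity `w`. -/
noncomputable def srcProb (m : ℕ) (w : ℝ) : ℝ := (w / m) / (1 + w / m)

/-- Sink probability for the intensity `1 / z`. -/
noncomputable def snkProb (m : ℕ) (z : ℝ) : ℝ := (cellProb m * m / z) / (1 + cellProb m * m / z)

/-- Expectation for the sources. -/
noncomputable def srcMean (m X : ℕ) (w : ℝ) : ((ℕ → Bool) → ℝ) → ℝ :=
  iidMean (coin (srcProb m w)) false X

/-- Expectation for the sinks. -/
noncomputable def snkMean (m T : ℕ) (z : ℝ) : ((ℕ → Bool) → ℝ) → ℝ :=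
  iidMean (coin (snkProb m z)) false T

/-- Expectation for sources, sinks and environment. -/
noncomputable def modelMean (m X T : ℕ) (w z : ℝ) :
    ((ℕ → Bool) × (ℕ → Bool) × (ℕ → ℕ → Bool) → ℝ) → ℝ :=
  prodMean (srcMean m X w) (prodMean (snkMean m T z) (envMean (cellProb m) X T))

theorem cellProb_nonneg (m : ℕ) : 0 ≤ cellProb m := by
  rw [cellProb, sub_nonneg, Real.exp_le_one_iff]
  simp only [one_div, Left.neg_nonpos_iff]
  positivity

theorem cellProb_le_one (m : ℕ) : cellProb m ≤ 1 := by
  rw [cellProb]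
  linarith [Real.exp_pos (-(1 / (m : ℝ) ^ 2))]

theorem srcProb_nonneg (m : ℕ) {w : ℝ} (hw : 0 < w) : 0 ≤ srcProb m w := by
  rw [srcProb]; positivity

theorem srcProb_le_one (m : ℕ) {w : ℝ} (hw : 0 < w) : srcProb m w ≤ 1 := by
  rw [srcProb, div_le_one (by positivity)]
  linarith

theorem snkProb_nonneg (m : ℕ) {z : ℝ} (hz : 0 < z) : 0 ≤ snkProb m z := by
  have := cellProb_nonneg m
  rw [snkProb]; positivity

theorem snkProb_le_one (m : ℕ) {z : ℝ} (hz : 0 < z) : snkProb m z ≤ 1 := by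
  have := cellProb_nonneg m
  rw [snkProb, div_le_one (by positivity)]
  linarith

theorem isMean_srcMean (m X : ℕ) {w : ℝ} (hw : 0 < w) : IsMean (srcMean m X w) :=
  isMean_iidCoin (srcProb_nonneg m hw) (srcProb_le_one m hw) X

theorem isMean_snkMean (m T : ℕ) {z : ℝ} (hz : 0 < z) : IsMean (snkMean m T z) :=
  isMean_iidCoin (snkProb_nonneg m hz) (snkProb_le_one m hz) T

theorem isMean_cellMean (m X T : ℕ) : IsMean (envMean (cellProb m) X T) :=
  isMean_envMean (cellProb_nonneg m) (cellProb_le_one m) X T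

theorem isMean_modelMean (m X T : ℕ) {w z : ℝ} (hw : 0 < w) (hz : 0 < z) :
    IsMean (modelMean m X T w z) :=
  (isMean_srcMean m X hw).prod ((isMean_snkMean m T hz).prod (isMean_cellMean m X T))

/-- The balance condition says that the odds of a source times the odds of a sink equal `cellProb
m`. The odds are `w / m` and `cellProb m * m / w`, which is why the probabilities are defined
through them. -/
theorem burke_equation {m : ℕ} (hm : 0 < m) {w : ℝ} (hw : 0 < w) :
    (1 - srcProb m w) * (1 - snkProb m w) * cellProb m = srcProb m w * snkProb m w := by
  have hq := cellProb_nonneg m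
  have hm' : (0 : ℝ) < m := by exact_mod_cast hm
  have h1 : 1 + w / (m : ℝ) ≠ 0 := by positivity
  have h2 : 1 + cellProb m * m / w ≠ 0 := by positivity
  have e1 : 1 - srcProb m w = 1 / (1 + w / m) := by rw [srcProb]; field_simp; ring
  have e2 : 1 - snkProb m w = 1 / (1 + cellProb m * m / w) := by rw [snkProb]; field_simp; ring
  rw [e1, e2, srcProb, snkProb]
  field_simp

theorem tendsto_sq_mul_cellProb : Tendsto (fun m : ℕ => (m : ℝ) ^ 2 * cellProb m) atTop (𝓝 1) := by
  have hi : Tendsto (fun m : ℕ => (1 : ℝ) / (m : ℝ) ^ 2) atTop (𝓝 0) := by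
    have := (tendsto_one_div_atTop_nhds_zero_nat (𝕜 := ℝ)).mul
      (tendsto_one_div_atTop_nhds_zero_nat (𝕜 := ℝ))
    simp only [mul_zero] at this
    refine this.congr fun m => ?_
    ring
  have hl : Tendsto (fun m : ℕ => (1 : ℝ) / (1 + 1 / (m : ℝ) ^ 2)) atTop (𝓝 1) := by
    have := (hi.const_add 1).inv₀ (by norm_num)
    simpa [one_div] using this
  refine tendsto_of_tendsto_of_tendsto_of_le_of_le' hl tendsto_const_nhds ?_ ?_
  · filter_upwards [eventually_gt_atTop 0] with m hm
    have hm' : (0 : ℝ) < m := by exact_mod_cast hm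
    have h1 : Real.exp (-(1 / (m : ℝ) ^ 2)) ≤ 1 / (1 + 1 / (m : ℝ) ^ 2) := by
      rw [Real.exp_neg, ← one_div]
      apply one_div_le_one_div_of_le (by positivity)
      linarith [Real.add_one_le_exp (1 / (m : ℝ) ^ 2)]
    calc (1 : ℝ) / (1 + 1 / (m : ℝ) ^ 2) = (m : ℝ) ^ 2 * (1 - 1 / (1 + 1 / (m : ℝ) ^ 2)) := by
          field_simp; ring
      _ ≤ _ := by rw [cellProb]; gcongr
  · filter_upwards [eventually_gt_atTop 0] with m hm
    have hm' : (0 : ℝ) < m := by exact_mod_cast hm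
    have h1 : cellProb m ≤ 1 / (m : ℝ) ^ 2 := by
      rw [cellProb]
      linarith [Real.add_one_le_exp (-(1 / (m : ℝ) ^ 2))]
    calc (m : ℝ) ^ 2 * cellProb m ≤ (m : ℝ) ^ 2 * (1 / (m : ℝ) ^ 2) := by gcongr
      _ = 1 := by field_simp

theorem tendsto_mul_snkOdds (z : ℝ) :
    Tendsto (fun m : ℕ => (m : ℝ) * (cellProb m * m / z)) atTop (𝓝 (1 / z)) := by
  refine (tendsto_sq_mul_cellProb.div_const z).congr fun m => ?_
  ring

/-- Markov's inequality for `(z / w) ^ lpp`. The sign of `log (z / w)` decides whether the event is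
an upper or a lower tail, so both are covered at once. -/
theorem meanProb_lpp_le {m : ℕ} (hm : 0 < m) {w z : ℝ} (hw : 0 < w) (hz : 0 < z) (l : ℝ)
    {X k : ℕ} (T : ℕ) (hk : k ≤ X) :
    meanProb (modelMean m X T w z) (fun ω =>
      0 ≤ ((lpp ω.1 ω.2.1 ω.2.2 k T : ℝ) - l) * Real.log (z / w)) ≤
      Real.exp (-(l * Real.log (z / w))) * (((1 + cellProb m * m / w) ^ T /
        (1 + cellProb m * m / z) ^ T) * ((1 + z / m) ^ k / (1 + w / m) ^ k)) := by
  have hM := isMean_modelMean m X T hw hz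
  have hq := cellProb_nonneg m
  have hm' : (0 : ℝ) < m := by exact_mod_cast hm
  have h1 : 1 + w / (m : ℝ) ≠ 0 := by positivity
  have h2 : 1 + cellProb m * m / w ≠ 0 := by positivity
  have h3 : 1 + cellProb m * m / z ≠ 0 := by positivity
  have key := mean_pow_lpp (θ := z / w) (ρ := w / z) (r' := snkProb m z)
    (c := (1 + cellProb m * m / w) / (1 + cellProb m * m / z)) (srcProb_nonneg m hw)
    (srcProb_le_one m hw) (snkProb_nonneg m hw) (snkProb_le_one m hw) hq (cellProb_le_one m)
    (burke_equation hm hw) (by rw [snkProb, snkProb]; field_simp)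
    (by rw [snkProb, snkProb]; field_simp; ring) (by field_simp) X T k hk
  have e1 : 1 + srcProb m w * (z / w - 1) = (1 + z / m) / (1 + w / m) := by
    rw [srcProb]; field_simp; ring
  rw [e1, div_pow, div_pow] at key
  rw [← key]
  change _ ≤ _ * modelMean m X T w z fun ω => (z / w) ^ lpp ω.1 ω.2.1 ω.2.2 k T
  rw [← hM.map_mul]
  have hzw : 0 < z / w := by positivity
  have e2 : ∀ k : ℕ, (z / w) ^ k = Real.exp (k * Real.log (z / w)) := fun k => by
    rw [← Real.log_pow, Real.exp_log (by positivity)]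
  refine hM.prob_le (fun ω => by positivity) fun ω hω => ?_
  rw [e2, ← Real.exp_add]
  apply Real.one_le_exp
  linarith

/-- Chernoff bound for the last-passage time with boundary, in the limit of small mesh. -/
theorem eventually_meanProb_lpp_le {w z : ℝ} (hw : 0 < w) (hz : 0 < z) (n : ℕ) (x l : ℝ)
    {k : ℕ → ℕ} (hk : Tendsto (fun m : ℕ => (k m : ℝ) / m) atTop (𝓝 x)) {B : ℝ}
    (hB : Real.exp (chernoffExponent n x l w z) < B) :
    ∀ᶠ m in atTop, ∀ X ≥ k m, meanProb (modelMean m X (n * m) w z) (fun ω =>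
      0 ≤ ((lpp ω.1 ω.2.1 ω.2.2 (k m) (n * m) : ℝ) - l) * Real.log (z / w)) ≤ B := by
  have hq := cellProb_nonneg
  have hT : Tendsto (fun m : ℕ => ((n * m : ℕ) : ℝ) / m) atTop (𝓝 n) := by
    refine tendsto_const_nhds.congr' ?_
    filter_upwards [eventually_gt_atTop 0] with m hm
    have hm' : (m : ℝ) ≠ 0 := by positivity
    push_cast
    field_simp
  have hb : ∀ z : ℝ, Tendsto (fun m : ℕ => (m : ℝ) * (z / m)) atTop (𝓝 z) := by
    intro z
    refine tendsto_const_nhds.congr' ?_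
    filter_upwards [eventually_gt_atTop 0] with m hm
    have hm' : (m : ℝ) ≠ 0 := by positivity
    field_simp
  have l1 := tendsto_one_add_pow (tendsto_mul_snkOdds w) hT fun m => by have := hq m; positivity
  have l2 := tendsto_one_add_pow (tendsto_mul_snkOdds z) hT fun m => by have := hq m; positivity
  have l3 := tendsto_one_add_pow (hb z) hk fun m => by positivity
  have l4 := tendsto_one_add_pow (hb w) hk fun m => by positivity
  have l5 := ((l1.div l2 (Real.exp_pos _).ne').mul (l3.div l4 (Real.exp_pos _).ne')).const_mul
    (Real.exp (-(l * Real.log (z / w))))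
  have e : Real.exp (-(l * Real.log (z / w))) * (Real.exp (n * (1 / w)) / Real.exp (n * (1 / z)) *
      (Real.exp (x * z) / Real.exp (x * w))) = Real.exp (chernoffExponent n x l w z) := by
    rw [← Real.exp_sub, ← Real.exp_sub, ← Real.exp_add, ← Real.exp_add, chernoffExponent]
    congr 1
    ring
  rw [e] at l5
  filter_upwards [l5.eventually (gt_mem_nhds hB), eventually_gt_atTop 0] with m hm hm0 X hX
  exact (meanProb_lpp_le hm0 hw hz l (n * m) hX).trans hm.le

/-! ### Tail bounds and exit points in the cube-root scaling -/

/-- The columns `k n m` (mesh `1 / m`) represent the abscissa `n + 2 a n^{2/3}`. -/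
def IsColumn (a : ℝ) (k : ℕ → ℕ → ℕ) : Prop :=
  ∀ᶠ n : ℕ in atTop, Tendsto (fun m : ℕ => (k n m : ℝ) / m) atTop
    (𝓝 (n + 2 * a * (n : ℝ) ^ (2 / 3 : ℝ)))

/-- The value `x + n + σ n^{1/3}` with `x = n + 2 a n^{2/3}`. -/
noncomputable def lppLevel (n : ℕ) (a σ : ℝ) : ℝ :=
  n + 2 * a * (n : ℝ) ^ (2 / 3 : ℝ) + n + σ * (n : ℝ) ^ (1 / 3 : ℝ)

/-- Expectation for sources and environment. -/
noncomputable def horMean (m X T : ℕ) (w : ℝ) : ((ℕ → Bool) × (ℕ → ℕ → Bool) → ℝ) → ℝ :=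
  prodMean (srcMean m X w) (envMean (cellProb m) X T)

/-- Expectation for sinks and environment. -/
noncomputable def verMean (m X T : ℕ) (z : ℝ) : ((ℕ → Bool) × (ℕ → ℕ → Bool) → ℝ) → ℝ :=
  prodMean (snkMean m T z) (envMean (cellProb m) X T)

theorem isMean_horMean (m X T : ℕ) {w : ℝ} (hw : 0 < w) : IsMean (horMean m X T w) :=
  (isMean_srcMean m X hw).prod (isMean_cellMean m X T)

theorem meanProb_modelMean_hor (m X T : ℕ) {w z : ℝ} (hz : 0 < z)
    (S : (ℕ → Bool) × (ℕ → ℕ → Bool) → Prop) :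
    meanProb (modelMean m X T w z) (fun ω => S (ω.1, ω.2.2)) = meanProb (horMean m X T w) S := by
  simp only [meanProb, modelMean, horMean, prodMean]
  congr 1; funext U
  exact (isMean_snkMean m T hz).map_const
    (envMean (cellProb m) X T fun w => open Classical in if S (U, w) then 1 else 0)

theorem meanProb_modelMean_ver (m X T : ℕ) {w z : ℝ} (hw : 0 < w)
    (S : (ℕ → Bool) × (ℕ → ℕ → Bool) → Prop) :
    meanProb (modelMean m X T w z) (fun ω => S ω.2) = meanProb (verMean m X T z) S :=
  meanProb_prod_snd (isMean_srcMean m X hw) S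

theorem meanProb_modelMean_env (m X T : ℕ) {w z : ℝ} (hw : 0 < w) (hz : 0 < z)
    (S : (ℕ → ℕ → Bool) → Prop) :
    meanProb (modelMean m X T w z) (fun ω => S ω.2.2) =
      meanProb (envMean (cellProb m) X T) S :=
  (meanProb_modelMean_ver m X T hw fun ω => S ω.2).trans
    (meanProb_prod_snd (isMean_snkMean m T hz) S)

theorem eventually_scale_pos : ∀ᶠ n : ℕ in atTop, 0 < (n : ℝ) ^ (1 / 3 : ℝ) :=
  tendsto_scale.eventually (eventually_gt_atTop 0)

theorem intensity_lt {n : ℕ} (hn : 0 < (n : ℝ) ^ (1 / 3 : ℝ)) {κ₁ κ₂ : ℝ} (h : κ₁ < κ₂) :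
    intensity n κ₁ < intensity n κ₂ := by
  unfold intensity
  gcongr

/-- The exponents occurring in the exit-point estimates are at most `-(r ^ 3 / 12) + |a| * r ^ 2`,
so this choice of `r` makes all of them small. -/
theorem exists_exp_cubic_lt (a : ℝ) {ε : ℝ} (hε : 0 < ε) :
    ∃ r > 0, Real.exp (-(r ^ 3 / 12) + |a| * r ^ 2) < ε := by
  have ha := abs_nonneg a
  have hi : 0 < 1 / ε := by positivity
  refine ⟨12 * (|a| + 1) + 1 / ε, by positivity, ?_⟩
  set r := 12 * (|a| + 1) + 1 / ε with hr
  have h1 : -(r ^ 3 / 12) + |a| * r ^ 2 ≤ -r := by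
    have h2 : 0 ≤ r ^ 2 * (r - 12 * (|a| + 1)) := by
      have : 0 ≤ r - 12 * (|a| + 1) := by rw [hr]; linarith
      positivity
    have h3 : r ≤ r ^ 2 := by
      have : 1 ≤ r := by rw [hr]; linarith
      nlinarith
    nlinarith
  calc Real.exp (-(r ^ 3 / 12) + |a| * r ^ 2) ≤ Real.exp (-r) := Real.exp_le_exp.2 h1
    _ ≤ 1 / (r + 1) := by
      rw [Real.exp_neg, ← one_div]
      exact one_div_le_one_div_of_le (by positivity) (Real.add_one_le_exp r)
    _ < ε := by
      rw [div_lt_iff₀ (by positivity)]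
      have : ε * (1 / ε) = 1 := by field_simp
      nlinarith

section Tails

variable {a : ℝ} {k : ℕ → ℕ → ℕ} (hk : IsColumn a k)

include hk

theorem eventually_full_tail (σ κ₁ κ₂ : ℝ) {B : ℝ}
    (hB : Real.exp (cubicRate a σ κ₂ - cubicRate a σ κ₁) < B) :
    ∀ᶠ n in atTop, ∀ᶠ m in atTop, ∀ X ≥ k n m,
      meanProb (modelMean m X (n * m) (intensity n κ₁) (intensity n κ₂)) (fun ω =>
        0 ≤ ((lpp ω.1 ω.2.1 ω.2.2 (k n m) (n * m) : ℝ) - lppLevel n a σ) *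
          Real.log (intensity n κ₂ / intensity n κ₁)) ≤ B := by
  have h := (Real.continuous_exp.tendsto _).comp (tendsto_chernoffExponent a σ κ₁ κ₂)
  filter_upwards [h.eventually (gt_mem_nhds hB), hk, eventually_intensity_pos κ₁,
    eventually_intensity_pos κ₂] with n h1 h2 h3 h4
  exact eventually_meanProb_lpp_le h3 h4 n _ _ h2 h1

theorem eventually_full_ge {σ κ₁ κ₂ : ℝ} (hκ : κ₁ < κ₂) {B : ℝ}
    (hB : Real.exp (cubicRate a σ κ₂ - cubicRate a σ κ₁) < B) :
    ∀ᶠ n in atTop, ∀ᶠ m in atTop, ∀ X ≥ k n m,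
      meanProb (modelMean m X (n * m) (intensity n κ₁) (intensity n κ₂)) (fun ω =>
        lppLevel n a σ ≤ lpp ω.1 ω.2.1 ω.2.2 (k n m) (n * m)) ≤ B := by
  filter_upwards [eventually_full_tail hk σ κ₁ κ₂ hB, eventually_intensity_pos κ₁,
    eventually_intensity_pos κ₂, eventually_scale_pos] with n h1 h3 h4 h5
  filter_upwards [h1] with m hm X hX
  refine ((isMean_modelMean m X _ h3 h4).prob_mono fun ω hω => ?_).trans (hm X hX)
  refine mul_nonneg (sub_nonneg.2 hω) (Real.log_nonneg ?_)
  rw [one_le_div h3]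
  exact (intensity_lt h5 hκ).le

theorem eventually_full_le {σ κ₁ κ₂ : ℝ} (hκ : κ₂ < κ₁) {B : ℝ}
    (hB : Real.exp (cubicRate a σ κ₂ - cubicRate a σ κ₁) < B) :
    ∀ᶠ n in atTop, ∀ᶠ m in atTop, ∀ X ≥ k n m,
      meanProb (modelMean m X (n * m) (intensity n κ₁) (intensity n κ₂)) (fun ω =>
        (lpp ω.1 ω.2.1 ω.2.2 (k n m) (n * m) : ℝ) ≤ lppLevel n a σ) ≤ B := by
  filter_upwards [eventually_full_tail hk σ κ₁ κ₂ hB, eventually_intensity_pos κ₁,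
    eventually_intensity_pos κ₂, eventually_scale_pos] with n h1 h3 h4 h5
  filter_upwards [h1] with m hm X hX
  refine ((isMean_modelMean m X _ h3 h4).prob_mono fun ω hω => ?_).trans (hm X hX)
  refine mul_nonneg_of_nonpos_of_nonpos (sub_nonpos.2 hω) (Real.log_nonpos (by positivity) ?_)
  rw [div_le_one h3]
  exact (intensity_lt h5 hκ).le

theorem eventually_ver_ge {σ κ₁ κ₂ : ℝ} (hκ : κ₁ < κ₂) {B : ℝ}
    (hB : Real.exp (cubicRate a σ κ₂ - cubicRate a σ κ₁) < B) :
    ∀ᶠ n in atTop, ∀ᶠ m in atTop, ∀ X ≥ k n m,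
      meanProb (verMean m X (n * m) (intensity n κ₂)) (fun ω =>
        lppLevel n a σ ≤ lpp noPoints ω.1 ω.2 (k n m) (n * m)) ≤ B := by
  filter_upwards [eventually_full_ge hk hκ hB, eventually_intensity_pos κ₁,
    eventually_intensity_pos κ₂] with n h1 h3 h4
  filter_upwards [h1] with m hm X hX
  rw [← meanProb_modelMean_ver m X _ h3]
  refine ((isMean_modelMean m X _ h3 h4).prob_mono fun ω hω => ?_).trans (hm X hX)
  refine hω.trans (Nat.cast_le.2 ?_)
  rw [lpp_eq_max ω.1]
  exact le_max_right _ _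

theorem eventually_hor_ge {σ κ₁ κ₂ : ℝ} (hκ : κ₁ < κ₂) {B : ℝ}
    (hB : Real.exp (cubicRate a σ κ₂ - cubicRate a σ κ₁) < B) :
    ∀ᶠ n in atTop, ∀ᶠ m in atTop, ∀ X ≥ k n m,
      meanProb (horMean m X (n * m) (intensity n κ₁)) (fun ω =>
        lppLevel n a σ ≤ lpp ω.1 noPoints ω.2 (k n m) (n * m)) ≤ B := by
  filter_upwards [eventually_full_ge hk hκ hB, eventually_intensity_pos κ₁,
    eventually_intensity_pos κ₂] with n h1 h3 h4
  filter_upwards [h1] with m hm X hX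
  rw [← meanProb_modelMean_hor m X _ h4]
  refine ((isMean_modelMean m X _ h3 h4).prob_mono fun ω hω => ?_).trans (hm X hX)
  refine hω.trans (Nat.cast_le.2 ?_)
  rw [lpp_eq_max ω.1 ω.2.1]
  exact le_max_left _ _

/-- The full value is rarely low and is the larger of the source-only and sink-only values. The
sink-only value is rarely high: it does not see the sources, so its tail may be estimated with any
other source parameter `κ₀`. -/
theorem eventually_hor_lt {σ κ₀ κ₁ κ₂ : ℝ} (h0 : κ₀ < κ₂) (hκ : κ₂ < κ₁) {B B' : ℝ}
    (hB : Real.exp (cubicRate a σ κ₂ - cubicRate a σ κ₁) < B)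
    (hB' : Real.exp (cubicRate a σ κ₂ - cubicRate a σ κ₀) < B') :
    ∀ᶠ n in atTop, ∀ᶠ m in atTop, ∀ X ≥ k n m,
      meanProb (horMean m X (n * m) (intensity n κ₁)) (fun ω =>
        (lpp ω.1 noPoints ω.2 (k n m) (n * m) : ℝ) < lppLevel n a σ) ≤ B + B' := by
  filter_upwards [eventually_full_le hk hκ hB, eventually_ver_ge hk h0 hB',
    eventually_intensity_pos κ₁, eventually_intensity_pos κ₂] with n h1 h2 h3 h4
  filter_upwards [h1, h2] with m hm hm' X hX
  have hM := isMean_modelMean m X (n * m) h3 h4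
  have e1 := hm X hX
  have e2 := hm' X hX
  rw [← meanProb_modelMean_ver m X _ h3] at e2
  rw [← meanProb_modelMean_hor m X _ h4]
  refine (hM.prob_mono fun ω hω => ?_).trans (hM.prob_or.trans (add_le_add e1 e2))
  simp only at hω ⊢
  rw [lpp_eq_max ω.1]
  push_cast
  rcases le_or_gt (lppLevel n a σ) (lpp noPoints ω.2.1 ω.2.2 (k n m) (n * m) : ℝ) with h | h
  · exact Or.inr h
  · exact Or.inl (max_le hω.le h.le)

theorem eventually_ver_lt {σ κ₀ κ₁ κ₂ : ℝ} (h0 : κ₁ < κ₀) (hκ : κ₂ < κ₁) {B B' : ℝ}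
    (hB : Real.exp (cubicRate a σ κ₂ - cubicRate a σ κ₁) < B)
    (hB' : Real.exp (cubicRate a σ κ₀ - cubicRate a σ κ₁) < B') :
    ∀ᶠ n in atTop, ∀ᶠ m in atTop, ∀ X ≥ k n m,
      meanProb (verMean m X (n * m) (intensity n κ₂)) (fun ω =>
        (lpp noPoints ω.1 ω.2 (k n m) (n * m) : ℝ) < lppLevel n a σ) ≤ B + B' := by
  filter_upwards [eventually_full_le hk hκ hB, eventually_hor_ge hk h0 hB',
    eventually_intensity_pos κ₁, eventually_intensity_pos κ₂] with n h1 h2 h3 h4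
  filter_upwards [h1, h2] with m hm hm' X hX
  have hM := isMean_modelMean m X (n * m) h3 h4
  have e1 := hm X hX
  have e2 := hm' X hX
  rw [← meanProb_modelMean_hor m X _ h4] at e2
  rw [← meanProb_modelMean_ver m X _ h3]
  refine (hM.prob_mono fun ω hω => ?_).trans (hM.prob_or.trans (add_le_add e1 e2))
  simp only at hω ⊢
  rw [lpp_eq_max ω.1]
  push_cast
  rcases le_or_gt (lppLevel n a σ) (lpp ω.1 noPoints ω.2.2 (k n m) (n * m) : ℝ) with h | h
  · exact Or.inr h
  · exact Or.inl (max_le h.le hω.le)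

/-- The level `5 / 12 * r ^ 2` separates sources from sinks. Comparing `κ = r / 2` with `r` for the
sources needs a coefficient below `7 / 12`, and comparing `r` with `0` for the sinks needs one above
`1 / 3`; the value `5 / 12` makes the cubic term `-(r ^ 3 / 12)` in both. -/
theorem exists_hor_lt {ε : ℝ} (hε : 0 < ε) :
    ∃ r > 0, (∀ᶠ n in atTop, ∀ᶠ m in atTop, ∀ X ≥ k n m,
      meanProb (horMean m X (n * m) (intensity n r)) (fun ω =>
        (lpp ω.1 noPoints ω.2 (k n m) (n * m) : ℝ) < lppLevel n a (5 / 12 * r ^ 2)) ≤ ε) ∧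
      ∀ᶠ n in atTop, ∀ᶠ m in atTop, ∀ X ≥ k n m,
      meanProb (verMean m X (n * m) (intensity n r)) (fun ω =>
        lppLevel n a (5 / 12 * r ^ 2) ≤ (lpp noPoints ω.1 ω.2 (k n m) (n * m) : ℝ)) ≤ ε := by
  obtain ⟨r, hr, hlt⟩ := exists_exp_cubic_lt a (half_pos hε)
  have h1 := neg_abs_le a
  have h2 := le_abs_self a
  have hr2 : 0 < r ^ 2 := by positivity
  have hr3 : 0 < r ^ 3 := by positivity
  refine ⟨r, hr, ?_, ?_⟩
  · have := eventually_hor_lt hk (σ := 5 / 12 * r ^ 2) (κ₀ := 0) (κ₁ := r) (κ₂ := r / 2)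
      (B := ε / 2) (B' := ε / 2) (by linarith) (by linarith)
      (lt_of_le_of_lt (Real.exp_le_exp.2 (by unfold cubicRate; nlinarith)) hlt)
      (lt_of_le_of_lt (Real.exp_le_exp.2 (by unfold cubicRate; nlinarith)) hlt)
    simpa using this
  · exact eventually_ver_ge hk (κ₁ := 0) hr
      ((lt_of_le_of_lt (Real.exp_le_exp.2 (by unfold cubicRate; nlinarith)) hlt).trans
        (half_lt_self hε))

theorem exists_exit_hor {ε : ℝ} (hε : 0 < ε) :
    ∃ r > 0, ∀ᶠ n in atTop, ∀ᶠ m in atTop, ∀ X ≥ k n m,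
      meanProb (modelMean m X (n * m) (intensity n r) (intensity n r)) (fun ω =>
        lpp ω.1 noPoints ω.2.2 (k n m) (n * m) < lpp noPoints ω.2.1 ω.2.2 (k n m) (n * m)) ≤ ε := by
  obtain ⟨r, hr, h1, h2⟩ := exists_hor_lt hk (half_pos hε)
  refine ⟨r, hr, ?_⟩
  filter_upwards [h1, h2, eventually_intensity_pos r] with n h1 h2 h3
  filter_upwards [h1, h2] with m h1 h2 X hX
  have hM := isMean_modelMean m X (n * m) h3 h3
  have e1 := h1 X hX
  have e2 := h2 X hX
  rw [← meanProb_modelMean_hor m X _ h3] at e1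
  rw [← meanProb_modelMean_ver m X _ h3] at e2
  refine (hM.prob_mono fun ω hω => ?_).trans
    (hM.prob_or.trans ((add_le_add e1 e2).trans (add_halves ε).le))
  simp only at hω ⊢
  by_contra! hcon
  have : (lpp ω.1 noPoints ω.2.2 (k n m) (n * m) : ℝ) <
    lpp noPoints ω.2.1 ω.2.2 (k n m) (n * m) := Nat.cast_lt.2 hω
  linarith [hcon.1, hcon.2]

/-- The cubic terms are those of `exists_hor_lt` with `κ` replaced by `-κ` and the roles of sources
and sinks exchanged. -/
theorem exists_exit_ver {ε : ℝ} (hε : 0 < ε) :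
    ∃ r > 0, ∀ᶠ n in atTop, ∀ᶠ m in atTop, ∀ X ≥ k n m,
      meanProb (modelMean m X (n * m) (intensity n (-r)) (intensity n (-r))) (fun ω =>
        lpp noPoints ω.2.1 ω.2.2 (k n m) (n * m) < lpp ω.1 noPoints ω.2.2 (k n m) (n * m)) ≤ ε := by
  obtain ⟨r, hr, hlt⟩ := exists_exp_cubic_lt a (show 0 < ε / 3 by positivity)
  have h1 := neg_abs_le a
  have h2 := le_abs_self a
  have hr2 : 0 < r ^ 2 := by positivity
  have hr3 : 0 < r ^ 3 := by positivity
  have t1 := eventually_ver_lt hk (σ := 5 / 12 * r ^ 2) (κ₀ := 0) (κ₁ := -(r / 2)) (κ₂ := -r)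
      (B := ε / 3) (B' := ε / 3) (by linarith) (by linarith)
      (lt_of_le_of_lt (Real.exp_le_exp.2 (by unfold cubicRate; nlinarith)) hlt)
      (lt_of_le_of_lt (Real.exp_le_exp.2 (by unfold cubicRate; nlinarith)) hlt)
  have t2 := eventually_hor_ge hk (σ := 5 / 12 * r ^ 2) (κ₁ := -r) (κ₂ := 0) (B := ε / 3)
    (by linarith) (lt_of_le_of_lt (Real.exp_le_exp.2 (by unfold cubicRate; nlinarith)) hlt)
  refine ⟨r, hr, ?_⟩
  filter_upwards [t1, t2, eventually_intensity_pos (-r)] with n h1 h2 h3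
  filter_upwards [h1, h2] with m h1 h2 X hX
  have hM := isMean_modelMean m X (n * m) h3 h3
  have e1 := h1 X hX
  have e2 := h2 X hX
  rw [← meanProb_modelMean_ver m X _ h3] at e1
  rw [← meanProb_modelMean_hor m X _ h3] at e2
  refine (hM.prob_mono fun ω hω => ?_).trans
    (hM.prob_or.trans ((add_le_add e1 e2).trans (by linarith)))
  simp only at hω ⊢
  by_contra! hcon
  have : (lpp noPoints ω.2.1 ω.2.2 (k n m) (n * m) : ℝ) <
    lpp ω.1 noPoints ω.2.2 (k n m) (n * m) := Nat.cast_lt.2 hω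
  linarith [hcon.1, hcon.2]

end Tails

/-! ### Fluctuations of sources in a window -/

theorem meanProb_drop {A : Type*} {e : (A → ℝ) → ℝ} (he : IsMean e) (d : A) (c n : ℕ)
    (S : (ℕ → A) → Prop) :
    meanProb (iidMean e d (c + n)) (fun η => S fun i => η (c + i)) = meanProb (iidMean e d n) S :=
  iidMean_drop he d c n fun η => open Classical in if S η then 1 else 0

/-- The first term is the exponent of a Poisson step of mean `w / m` with drift `1 / m` removed. The
term `(w / m) ^ 2` bounds the gap between the odds `w / m` and the probability; summed over order
`m` columns it vanishes with the mesh. -/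
theorem coin_srcProb_exp_le (m : ℕ) {w : ℝ} (hw : 0 < w) (θ : ℝ) :
    coin (srcProb m w) (fun b => Real.exp (θ * ((b.toNat : ℝ) - 1 / m))) ≤
      Real.exp (|w * (Real.exp θ - 1) - θ| / m + (w / m) ^ 2) := by
  set α := w / (m : ℝ) with hα
  have hα0 : 0 ≤ α := by positivity
  have hp0 := srcProb_nonneg m hw
  set p := srcProb m w with hp
  have h1 : α - p ≤ α ^ 2 := by
    have : α - p = α ^ 2 / (1 + α) := by rw [hp, srcProb, ← hα]; field_simp; ring
    rw [this]
    exact div_le_self (by positivity) (by linarith)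
  have h1' : 0 ≤ α - p := by
    have : α - p = α ^ 2 / (1 + α) := by rw [hp, srcProb, ← hα]; field_simp; ring
    rw [this]; positivity
  have e1 : coin p (fun b => Real.exp (θ * ((b.toNat : ℝ) - 1 / m))) =
      Real.exp (-(θ / m)) * (1 + p * (Real.exp θ - 1)) := by
    simp only [coin, Bool.toNat_true, Bool.toNat_false, Nat.cast_one, Nat.cast_zero]
    rw [show θ * (1 - 1 / (m : ℝ)) = -(θ / m) + θ by ring,
      show θ * (0 - 1 / (m : ℝ)) = -(θ / m) by ring, Real.exp_add]
    ring
  have h2 : p * (Real.exp θ - 1) ≤ α * (Real.exp θ - 1) + α ^ 2 := by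
    nlinarith [Real.exp_pos θ]
  calc _ = Real.exp (-(θ / m)) * (1 + p * (Real.exp θ - 1)) := e1
    _ ≤ Real.exp (-(θ / m)) * Real.exp (p * (Real.exp θ - 1)) := by
      gcongr
      linarith [Real.add_one_le_exp (p * (Real.exp θ - 1))]
    _ = Real.exp (-(θ / m) + p * (Real.exp θ - 1)) := (Real.exp_add _ _).symm
    _ ≤ _ := by
      apply Real.exp_le_exp.2
      have h3 : (w * (Real.exp θ - 1) - θ) / m ≤ |w * (Real.exp θ - 1) - θ| / m := by
        gcongr
        exact le_abs_self _
      have h4 : (w * (Real.exp θ - 1) - θ) / m = -(θ / m) + α * (Real.exp θ - 1) := by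
        rw [hα]; ring
      linarith

theorem cnt_window (U : ℕ → Bool) (θ : ℝ) (m c k : ℕ) :
    θ * ((cnt U (c + k) : ℝ) - cnt U c - k / m) =
      ∑ i ∈ Finset.range k, θ * (((U (c + i)).toNat : ℝ) - 1 / m) := by
  rw [cnt_add, ← Finset.mul_sum, Finset.sum_sub_distrib]
  simp only [cnt, Finset.sum_const, Finset.card_range, nsmul_eq_mul]
  push_cast
  ring

theorem meanProb_window_le (m : ℕ) {w : ℝ} (hw : 0 < w) (θ s : ℝ) {c K X : ℕ} (hX : c + K ≤ X) :
    meanProb (srcMean m X w) (fun U => ∃ k ≤ K, s ≤ θ * ((cnt U (c + k) : ℝ) - cnt U c - k / m)) ≤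
      Real.exp ((|w * (Real.exp θ - 1) - θ| / m + (w / m) ^ 2) * K - s) := by
  obtain ⟨d, rfl⟩ := Nat.exists_eq_add_of_le hX
  have hm := IsMean.coin (srcProb_nonneg m hw) (srcProb_le_one m hw)
  have h := meanProb_exists_sum_ge (srcProb_nonneg m hw) (srcProb_le_one m hw)
    (fun b => θ * ((b.toNat : ℝ) - 1 / m)) (coin_srcProb_exp_le m hw θ)
    (Real.one_le_exp (by positivity)) K (K + d) (by omega) s
  rw [← Real.exp_nat_mul, ← Real.exp_add] at h
  simp only [cnt_window]
  rw [show c + K + d = c + (K + d) by omega]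
  refine le_trans (le_of_eq ?_) (h.trans (le_of_eq ?_))
  · exact meanProb_drop hm false c (K + d) fun V =>
      ∃ k ≤ K, s ≤ ∑ i ∈ Finset.range k, θ * (((V i).toNat : ℝ) - 1 / m)
  · congr 1
    ring

theorem tendsto_window_rate (κ τ : ℝ) {δ : ℝ} (hδ : 0 < δ) :
    ∀ᶠ n : ℕ in atTop, ((n : ℝ) ^ (1 / 3 : ℝ)) ^ 2 *
      |intensity n κ * (Real.exp (τ / (n : ℝ) ^ (1 / 3 : ℝ)) - 1) - τ / (n : ℝ) ^ (1 / 3 : ℝ)| ≤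
        |κ * τ| + τ ^ 2 + δ := by
  have h1 : Tendsto (fun n : ℕ => |κ| * τ ^ 2 / (n : ℝ) ^ (1 / 3 : ℝ)) atTop (𝓝 0) :=
    tendsto_const_nhds.div_atTop tendsto_scale
  filter_upwards [h1.eventually (gt_mem_nhds hδ),
    tendsto_scale.eventually (eventually_ge_atTop (|τ| + 1))] with n hn hN
  rw [intensity]
  generalize (n : ℝ) ^ (1 / 3 : ℝ) = N at hn hN
  have hN0 : 0 < N := by linarith [abs_nonneg τ]
  have hθ : |τ / N| ≤ 1 := by
    rw [abs_div, abs_of_pos hN0, div_le_one hN0]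
    linarith
  set θ := τ / N with hθd
  have hτ : N * θ = τ := by rw [hθd]; field_simp
  have h2 := Real.abs_exp_sub_one_sub_id_le hθ
  have h3 : |Real.exp θ - 1| ≤ |θ| + θ ^ 2 := by
    calc |Real.exp θ - 1| = |θ + (Real.exp θ - 1 - θ)| := by congr 1; ring
      _ ≤ |θ| + |Real.exp θ - 1 - θ| := abs_add_le _ _
      _ ≤ _ := by gcongr
  calc N ^ 2 * |(1 + κ / N) * (Real.exp θ - 1) - θ|
      = N ^ 2 * |(Real.exp θ - 1 - θ) + κ / N * (Real.exp θ - 1)| := by congr 2; ring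
    _ ≤ N ^ 2 * (θ ^ 2 + |κ| / N * (|θ| + θ ^ 2)) := by
      gcongr
      refine (abs_add_le _ _).trans (add_le_add h2 ?_)
      rw [abs_mul, abs_div, abs_of_pos hN0]
      gcongr
    _ = (N * θ) ^ 2 + |κ| * |N * θ| + |κ| * (N * θ) ^ 2 / N := by
      rw [abs_mul, abs_of_pos hN0]; field_simp; ring
    _ ≤ _ := by rw [hτ, abs_mul]; linarith

/-- Fluctuations of the sources in windows of length of order `n^{2/3}`. -/
theorem eventually_window_le (κ τ : ℝ) {Y s B : ℝ} (hY : 0 ≤ Y)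
    (hB : Real.exp (Y * (|κ * τ| + τ ^ 2) - s) < B) :
    ∀ᶠ n : ℕ in atTop, ∀ᶠ m : ℕ in atTop, ∀ c K X : ℕ, c + K ≤ X →
      (K : ℝ) ≤ Y * (n : ℝ) ^ (2 / 3 : ℝ) * m + 1 →
      meanProb (srcMean m X (intensity n κ)) (fun U => ∃ k ≤ K,
        s ≤ τ / (n : ℝ) ^ (1 / 3 : ℝ) * ((cnt U (c + k) : ℝ) - cnt U c - k / m)) ≤ B := by
  have hcont : Tendsto (fun δ : ℝ => Real.exp (Y * (|κ * τ| + τ ^ 2 + δ) - s)) (𝓝[>] 0)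
      (𝓝 (Real.exp (Y * (|κ * τ| + τ ^ 2 + 0) - s))) :=
    (Continuous.tendsto (by fun_prop) 0).mono_left nhdsWithin_le_nhds
  rw [add_zero] at hcont
  obtain ⟨δ, hδB, hδ⟩ := ((hcont.eventually (gt_mem_nhds hB)).and self_mem_nhdsWithin).exists
  filter_upwards [tendsto_window_rate κ τ hδ, eventually_intensity_pos κ] with n hn hw
  set N := (n : ℝ) ^ (1 / 3 : ℝ) with hN
  set w := intensity n κ
  set A := |w * (Real.exp (τ / N) - 1) - τ / N| with hA
  have hA0 : 0 ≤ A := abs_nonneg _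
  have hi : Tendsto (fun m : ℕ => (1 : ℝ) / m) atTop (𝓝 0) := tendsto_one_div_atTop_nhds_zero_nat
  have hlim : Tendsto (fun m : ℕ => Real.exp (Y * (|κ * τ| + τ ^ 2 + δ) - s +
      ((A + w ^ 2 * (Y * N ^ 2)) * (1 / m) + w ^ 2 * ((1 / m) * (1 / m))))) atTop
      (𝓝 (Real.exp (Y * (|κ * τ| + τ ^ 2 + δ) - s))) := by
    refine (Real.continuous_exp.tendsto _).comp ?_
    have := ((hi.const_mul (A + w ^ 2 * (Y * N ^ 2))).add ((hi.mul hi).const_mul (w ^ 2))).const_add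
      (Y * (|κ * τ| + τ ^ 2 + δ) - s)
    simpa using this
  filter_upwards [hlim.eventually (gt_mem_nhds hδB), eventually_gt_atTop 0] with m hm hm0 c K X hX hK
  refine (meanProb_window_le m hw (τ / N) s hX).trans ((Real.exp_le_exp.2 ?_).trans hm.le)
  have hm' : (0 : ℝ) < m := by exact_mod_cast hm0
  rw [scale_sq] at hK
  calc (A / m + (w / m) ^ 2) * K - s ≤ (A / m + (w / m) ^ 2) * (Y * N ^ 2 * m + 1) - s := by gcongr
    _ = Y * (N ^ 2 * A) - s +
      ((A + w ^ 2 * (Y * N ^ 2)) * (1 / m) + w ^ 2 * ((1 / m) * (1 / m))) := by field_simp; ring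
    _ ≤ _ := by gcongr

/-! ### Modulus of continuity of the last-passage profile -/

/-- The column of mesh `1 / m` at the abscissa `n + 2 a n^{2/3}`. -/
noncomputable def column (a : ℝ) (n m : ℕ) : ℕ := ⌈(n + 2 * a * (n : ℝ) ^ (2 / 3 : ℝ)) * m⌉₊

/-- The number of columns of mesh `1 / m` in a window of length `Y n^{2/3}`. -/
noncomputable def window (Y : ℝ) (n m : ℕ) : ℕ := ⌈Y * (n : ℝ) ^ (2 / 3 : ℝ) * m⌉₊

/-- The increments of `f` over at most `K` steps in `[k₀, k₁]`, compared with the slope `1 / m`,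
exceed `h`. -/
def Oscillates (f : ℕ → ℕ) (k₀ k₁ K m : ℕ) (h : ℝ) : Prop :=
  ∃ k k', k₀ ≤ k ∧ k ≤ k' ∧ k' ≤ k₁ ∧ k' ≤ k + K ∧ h < |(f k' : ℝ) - f k - ((k' : ℝ) - k) / m|

theorem eventually_abscissa_nonneg (a : ℝ) :
    ∀ᶠ n : ℕ in atTop, 0 ≤ (n : ℝ) + 2 * a * (n : ℝ) ^ (2 / 3 : ℝ) := by
  filter_upwards [tendsto_scale.eventually (eventually_ge_atTop (2 * |a|))] with n hn
  have h := scale_cube n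
  have h0 : 0 ≤ (n : ℝ) ^ (1 / 3 : ℝ) := by positivity
  rw [scale_sq]
  generalize (n : ℝ) ^ (1 / 3 : ℝ) = N at *
  rw [← h]
  have : 0 ≤ N ^ 2 * (N + 2 * a) := by
    have : 0 ≤ N + 2 * a := by linarith [neg_abs_le a]
    positivity
  linarith

theorem tendsto_ceil_div {x : ℝ} (hx : 0 ≤ x) :
    Tendsto (fun m : ℕ => (⌈x * m⌉₊ : ℝ) / m) atTop (𝓝 x) :=
  (tendsto_nat_ceil_mul_div_atTop hx).comp tendsto_natCast_atTop_atTop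

theorem isColumn_column (a : ℝ) : IsColumn a (column a) := by
  filter_upwards [eventually_abscissa_nonneg a] with n hn
  exact tendsto_ceil_div hn

theorem meanProb_level {m : ℕ} (hm : 0 < m) (X T : ℕ) {w : ℝ} (hw : 0 < w)
    (S : (ℕ → Bool) → Prop) :
    meanProb (modelMean m X T w w) (fun ω => S (level ω.1 ω.2.1 ω.2.2 T)) =
      meanProb (srcMean m X w) S :=
  burke_prob (srcProb_nonneg m hw) (srcProb_le_one m hw) (snkProb_nonneg m hw)
    (snkProb_le_one m hw) (burke_equation hm hw) X T S

/-- Two columns at distance at most `K` lie in the same or in adjacent blocks. The factor `3` counts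
the deviations up to `k`, over the whole first block, and up to `k'`. -/
theorem not_oscillates_of_blocks {f : ℕ → ℕ} {k₀ k₁ K B m : ℕ} {h : ℝ}
    (hk : k₁ < k₀ + B * K)
    (hb : ∀ i < B, ∀ k ≤ K, |(f (k₀ + i * K + k) : ℝ) - f (k₀ + i * K) - k / m| ≤ h) :
    ¬ Oscillates f k₀ k₁ K m (3 * h) := by
  rintro ⟨k, k', h1, h2, h3, h4, h5⟩
  have hK : 0 < K := by
    by_contra hK
    have : K = 0 := by omega
    subst this
    omega
  obtain ⟨i, ρ, hρ, rfl⟩ : ∃ i ρ, ρ < K ∧ k = k₀ + i * K + ρ := by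
    refine ⟨(k - k₀) / K, (k - k₀) % K, Nat.mod_lt _ hK, ?_⟩
    have := Nat.div_add_mod' (k - k₀) K
    omega
  have hi : i < B := by
    by_contra hi
    have : B * K ≤ i * K := Nat.mul_le_mul_right K (not_lt.1 hi)
    omega
  have b1 := abs_le.1 (hb i hi ρ hρ.le)
  have hh : 0 ≤ h := (abs_nonneg _).trans (hb i hi ρ hρ.le)
  refine absurd h5 (not_lt.2 ?_)
  rcases le_or_gt k' (k₀ + i * K + K) with hc | hc
  · obtain ⟨ρ', rfl⟩ : ∃ ρ', k' = k₀ + i * K + ρ' := ⟨k' - (k₀ + i * K), by omega⟩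
    have b2 := abs_le.1 (hb i hi ρ' (by omega))
    push_cast
    rw [show ((k₀ : ℝ) + i * K + ρ' - (k₀ + i * K + ρ)) / m = ρ' / m - ρ / m by ring, abs_le]
    constructor <;> linarith
  · have e : (i + 1) * K = i * K + K := by ring
    have hi' : i + 1 < B := by
      by_contra hi'
      have : B * K ≤ (i + 1) * K := Nat.mul_le_mul_right K (not_lt.1 hi')
      omega
    obtain ⟨ρ', rfl⟩ : ∃ ρ', k' = k₀ + (i + 1) * K + ρ' := ⟨k' - (k₀ + (i + 1) * K), by omega⟩
    have b2 := abs_le.1 (hb (i + 1) hi' ρ' (by omega))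
    have b3 := abs_le.1 (hb i hi K le_rfl)
    rw [show k₀ + i * K + K = k₀ + (i + 1) * K by omega] at b3
    push_cast
    rw [show ((k₀ : ℝ) + (i + 1) * K + ρ' - (k₀ + i * K + ρ)) / m = K / m + ρ' / m - ρ / m by ring,
      abs_le]
    constructor <;> linarith

/-- With blocks of length `n^{2/3} / y²` and tilts `±y`, the number of blocks grows like `D y²`
while each failure probability decays like `exp (-η y)`. -/
theorem exists_block_rate (κ D : ℝ) {η ε : ℝ} (hη : 0 < η) (hε : 0 < ε) :
    ∃ y ≥ 1, 2 * (D * y ^ 2 + 3) * (2 * Real.exp (|κ| + 1 - η * y)) ≤ ε := by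
  have h0 := (Real.tendsto_pow_mul_exp_neg_atTop_nhds_zero 0).comp
    (tendsto_id.const_mul_atTop hη)
  have h2 := (Real.tendsto_pow_mul_exp_neg_atTop_nhds_zero 2).comp
    (tendsto_id.const_mul_atTop hη)
  have h := (((h2.const_mul (D / η ^ 2)).add (h0.const_mul 3)).const_mul (4 * Real.exp (|κ| + 1)))
  simp only [mul_zero, add_zero] at h
  obtain ⟨y, hy, hy1⟩ := ((h.eventually (gt_mem_nhds hε)).and (eventually_ge_atTop 1)).exists
  refine ⟨y, hy1, le_trans (le_of_eq ?_) hy.le⟩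
  simp only [Function.comp_apply, id, pow_zero, one_mul]
  rw [show |κ| + 1 - η * y = (|κ| + 1) + -(η * y) by ring, Real.exp_add]
  field_simp
  ring

theorem exists_src_oscillates_le (κ : ℝ) {D η ε : ℝ} (hD : 0 ≤ D) (hη : 0 < η) (hε : 0 < ε) :
    ∃ Y > 0, ∀ᶠ n : ℕ in atTop, ∀ᶠ m : ℕ in atTop, ∃ X₀ : ℕ → ℕ, ∀ k₀ k₁ X : ℕ, X₀ k₀ ≤ X →
      (k₁ : ℝ) ≤ k₀ + D * (n : ℝ) ^ (2 / 3 : ℝ) * m + 1 →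
      meanProb (srcMean m X (intensity n κ)) (fun U =>
        Oscillates (cnt U) k₀ k₁ (window Y n m) m (3 * (η * (n : ℝ) ^ (1 / 3 : ℝ)))) ≤ ε := by
  obtain ⟨y, hy1, hy⟩ := exists_block_rate κ D hη hε
  have hy0 : 0 < y := by linarith
  have hY : 0 < 1 / y ^ 2 := by positivity
  have hexp : ∀ τ : ℝ, |τ| = y → Real.exp (1 / y ^ 2 * (|κ * τ| + τ ^ 2) - y * η) <
      2 * Real.exp (|κ| + 1 - η * y) := by
    intro τ hτ
    have h1 : 1 / y ^ 2 * (|κ * τ| + τ ^ 2) = |κ| / y + 1 := by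
      rw [abs_mul, hτ, ← sq_abs τ, hτ]; field_simp
    have h2 : |κ| / y ≤ |κ| := div_le_self (abs_nonneg _) hy1
    have h3 : Real.exp (1 / y ^ 2 * (|κ * τ| + τ ^ 2) - y * η) ≤ Real.exp (|κ| + 1 - η * y) := by
      rw [h1]
      apply Real.exp_le_exp.2
      linarith
    linarith [Real.exp_pos (|κ| + 1 - η * y)]
  refine ⟨1 / y ^ 2, hY, ?_⟩
  -- The two extra blocks have total length more than one column, which absorbs the rounding `+ 1`
  -- in the bound on `k₁`.
  set B : ℕ := ⌈D * y ^ 2⌉₊ + 2 with hB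
  have hBle : (B : ℝ) ≤ D * y ^ 2 + 3 := by
    rw [hB]
    push_cast
    have := Nat.ceil_lt_add_one (show 0 ≤ D * y ^ 2 by positivity)
    linarith
  have hBge : D * y ^ 2 + 2 ≤ B := by
    rw [hB]
    push_cast
    have := Nat.le_ceil (D * y ^ 2)
    linarith
  filter_upwards [eventually_window_le κ y hY.le (hexp y (abs_of_pos hy0)),
    eventually_window_le κ (-y) hY.le (hexp (-y) (by rw [abs_neg, abs_of_pos hy0])),
    eventually_scale_pos, eventually_intensity_pos κ] with n h1 h2 hN hw
  have hlim : Tendsto (fun m : ℕ => 2 * (1 / y ^ 2 * (n : ℝ) ^ (2 / 3 : ℝ)) * m) atTop atTop := by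
    apply Tendsto.const_mul_atTop _ tendsto_natCast_atTop_atTop
    rw [scale_sq]
    positivity
  filter_upwards [h1, h2, hlim.eventually (eventually_gt_atTop 1)] with m h1 h2 hm1
  set K := window (1 / y ^ 2) n m with hK
  -- The blocks may extend beyond `k₁`, and the array must contain all of them, since there are no
  -- sources past column `X`.
  refine ⟨fun k₀ => k₀ + B * K, fun k₀ k₁ X hX hk₁ => ?_⟩
  replace hX : k₀ + B * K ≤ X := hX
  have hS := isMean_srcMean m X hw
  have hKge : 1 / y ^ 2 * (n : ℝ) ^ (2 / 3 : ℝ) * m ≤ K := Nat.le_ceil _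
  have hKle : (K : ℝ) ≤ 1 / y ^ 2 * (n : ℝ) ^ (2 / 3 : ℝ) * m + 1 :=
    (Nat.ceil_lt_add_one (by positivity)).le
  have hlt : k₁ < k₀ + B * K := by
    have : (k₁ : ℝ) < (k₀ + B * K : ℕ) := by
      push_cast
      have : (D * y ^ 2 + 2) * (1 / y ^ 2 * (n : ℝ) ^ (2 / 3 : ℝ) * m) ≤ B * K := by gcongr
      have e : (D * y ^ 2 + 2) * (1 / y ^ 2 * (n : ℝ) ^ (2 / 3 : ℝ) * m) =
        D * (n : ℝ) ^ (2 / 3 : ℝ) * m + 2 * (1 / y ^ 2 * (n : ℝ) ^ (2 / 3 : ℝ)) * m := by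
        field_simp
      linarith
    exact_mod_cast this
  set N := (n : ℝ) ^ (1 / 3 : ℝ) with hNdef
  have hblock : ∀ i < B, meanProb (srcMean m X (intensity n κ)) (fun U =>
      (∃ k ≤ K, y * η ≤ y / N * ((cnt U (k₀ + i * K + k) : ℝ) - cnt U (k₀ + i * K) - k / m)) ∨
      (∃ k ≤ K, y * η ≤ -y / N * ((cnt U (k₀ + i * K + k) : ℝ) - cnt U (k₀ + i * K) - k / m))) ≤
      2 * (2 * Real.exp (|κ| + 1 - η * y)) := by
    intro i hi
    have hle : k₀ + i * K + K ≤ X := by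
      have : (i + 1) * K ≤ B * K := Nat.mul_le_mul_right K hi
      have e : (i + 1) * K = i * K + K := by ring
      omega
    refine hS.prob_or.trans ?_
    rw [two_mul]
    exact add_le_add (h1 _ K X hle hKle) (h2 _ K X hle hKle)
  refine (hS.prob_mono fun U hU => ?_).trans ((hS.prob_exists_lt B hblock).trans ?_)
  · by_contra! hcon
    refine not_oscillates_of_blocks hlt (fun i hi k hk => ?_) hU
    have c1 := (hcon i hi).1 k hk
    have c2 := (hcon i hi).2 k hk
    rw [div_mul_eq_mul_div, div_lt_iff₀ hN] at c1 c2
    rw [abs_le]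
    constructor
    · nlinarith
    · nlinarith
  · refine le_trans ?_ hy
    have := Real.exp_pos (|κ| + 1 - η * y)
    nlinarith

theorem column_le (a b : ℝ) (hab : a ≤ b) (n m : ℕ) :
    (column b n m : ℝ) ≤ column a n m + 2 * (b - a) * (n : ℝ) ^ (2 / 3 : ℝ) * m + 1 := by
  have h1 := Nat.le_ceil ((n + 2 * a * (n : ℝ) ^ (2 / 3 : ℝ)) * m)
  have h0 : (0 : ℝ) ≤ column a n m := Nat.cast_nonneg _
  have hd : 0 ≤ b - a := by linarith
  have hp : 0 ≤ 2 * (b - a) * (n : ℝ) ^ (2 / 3 : ℝ) * m := by positivity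
  rcases le_or_gt 0 ((n + 2 * b * (n : ℝ) ^ (2 / 3 : ℝ)) * (m : ℝ)) with h | h
  · have h2 := (Nat.ceil_lt_add_one h).le
    simp only [column] at *
    linarith
  · have : column b n m = 0 := Nat.ceil_eq_zero.2 h.le
    rw [this, Nat.cast_zero]
    linarith

theorem window_mono {Y Y' : ℝ} (h : Y ≤ Y') (n m : ℕ) : window Y n m ≤ window Y' n m := by
  unfold window
  gcongr

/-- Large increments are excluded by the stationary model of intensity above `1`, with sources
winning at column `a`; small ones by that of intensity below `1`, with sinks winning at column `b`.
The two models need not be coupled, since each one-sided event depends on the environment only. Each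
costs an exit-point error and an oscillation error, hence `ε / 4`. -/
theorem exists_bulk_oscillates_le {a b : ℝ} (hab : a ≤ b) {η ε : ℝ} (hη : 0 < η) (hε : 0 < ε) :
    ∃ Y > 0, ∀ᶠ n : ℕ in atTop, ∀ᶠ m : ℕ in atTop, ∃ X ≥ column b n m,
      meanProb (envMean (cellProb m) X (n * m)) (fun w =>
        Oscillates (fun k => lpp noPoints noPoints w k (n * m)) (column a n m) (column b n m)
          (window Y n m) m (3 * (η * (n : ℝ) ^ (1 / 3 : ℝ)))) ≤ ε := by
  have h4 : 0 < ε / 4 := by positivity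
  obtain ⟨r, hr, e1⟩ := exists_exit_hor (isColumn_column a) h4
  obtain ⟨r', hr', e2⟩ := exists_exit_ver (isColumn_column b) h4
  have hD : 0 ≤ 2 * (b - a) := by linarith
  obtain ⟨Y, hY, o1⟩ := exists_src_oscillates_le r hD hη h4
  obtain ⟨Y', hY', o2⟩ := exists_src_oscillates_le (-r') hD hη h4
  refine ⟨min Y Y', lt_min hY hY', ?_⟩
  filter_upwards [e1, e2, o1, o2, eventually_intensity_pos r, eventually_intensity_pos (-r')]
    with n e1 e2 o1 o2 i1 i2
  filter_upwards [e1, e2, o1, o2, eventually_gt_atTop 0] with m e1 e2 o1 o2 hm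
  obtain ⟨X₁, o1⟩ := o1
  obtain ⟨X₂, o2⟩ := o2
  set k₀ := column a n m
  set k₁ := column b n m
  set h := 3 * (η * (n : ℝ) ^ (1 / 3 : ℝ))
  set X := max (max k₀ k₁) (max (X₁ k₀) (X₂ k₀)) with hX
  have x1 : k₀ ≤ X := by omega
  have x2 : k₁ ≤ X := by omega
  refine ⟨X, x2, ?_⟩
  have hE := isMean_cellMean m X (n * m)
  have hM1 := isMean_modelMean m X (n * m) i1 i1
  have hM2 := isMean_modelMean m X (n * m) i2 i2
  have p1 := e1 X x1
  have p2 := e2 X x2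
  have q1 := o1 k₀ k₁ X (by omega) (column_le a b hab n m)
  have q2 := o2 k₀ k₁ X (by omega) (column_le a b hab n m)
  rw [← meanProb_level hm X (n * m) i1] at q1
  rw [← meanProb_level hm X (n * m) i2] at q2
  set f : (ℕ → ℕ → Bool) → ℕ → ℕ := fun w k => lpp noPoints noPoints w k (n * m) with hf
  set K := window (min Y Y') n m with hK
  have up : meanProb (envMean (cellProb m) X (n * m)) (fun w => ∃ k k', k₀ ≤ k ∧ k ≤ k' ∧ k' ≤ k₁ ∧
      k' ≤ k + K ∧ h < (f w k' : ℝ) - f w k - ((k' : ℝ) - k) / m) ≤ ε / 4 + ε / 4 := by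
    rw [← meanProb_modelMean_env m X (n * m) i1 i1]
    refine (hM1.prob_mono fun ω hω => ?_).trans (hM1.prob_or.trans (add_le_add p1 q1))
    obtain ⟨k, k', c1, c2, c3, c4, c5⟩ := hω
    by_cases hex : lpp ω.1 noPoints ω.2.2 k₀ (n * m) < lpp noPoints ω.2.1 ω.2.2 k₀ (n * m)
    · exact Or.inl hex
    refine Or.inr ⟨k, k', c1, c2, c3, c4.trans (by
      have := window_mono (min_le_left Y Y') n m; omega), ?_⟩
    have := increment_le_of_hor (not_lt.1 hex) c1 c2
    have : (f ω.2.2 k' : ℝ) + cnt (level ω.1 ω.2.1 ω.2.2 (n * m)) k ≤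
      cnt (level ω.1 ω.2.1 ω.2.2 (n * m)) k' + f ω.2.2 k := by exact_mod_cast this
    refine lt_of_lt_of_le ?_ (le_abs_self _)
    linarith
  have low : meanProb (envMean (cellProb m) X (n * m)) (fun w => ∃ k k', k₀ ≤ k ∧ k ≤ k' ∧
      k' ≤ k₁ ∧ k' ≤ k + K ∧ h < -((f w k' : ℝ) - f w k - ((k' : ℝ) - k) / m)) ≤
        ε / 4 + ε / 4 := by
    rw [← meanProb_modelMean_env m X (n * m) i2 i2]
    refine (hM2.prob_mono fun ω hω => ?_).trans (hM2.prob_or.trans (add_le_add p2 q2))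
    obtain ⟨k, k', c1, c2, c3, c4, c5⟩ := hω
    by_cases hex : lpp noPoints ω.2.1 ω.2.2 k₁ (n * m) < lpp ω.1 noPoints ω.2.2 k₁ (n * m)
    · exact Or.inl hex
    refine Or.inr ⟨k, k', c1, c2, c3, c4.trans (by
      have := window_mono (min_le_right Y Y') n m; omega), ?_⟩
    have := le_increment_of_ver (not_lt.1 hex) c2 c3
    have : (cnt (level ω.1 ω.2.1 ω.2.2 (n * m)) k' : ℝ) + f ω.2.2 k ≤
      f ω.2.2 k' + cnt (level ω.1 ω.2.1 ω.2.2 (n * m)) k := by exact_mod_cast this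
    refine lt_of_lt_of_le ?_ (neg_le_abs _)
    linarith
  refine (hE.prob_mono fun w hw => ?_).trans
    (hE.prob_or.trans ((add_le_add up low).trans (by linarith)))
  obtain ⟨k, k', c1, c2, c3, c4, c5⟩ := hw
  rcases lt_abs.1 c5 with c5 | c5
  · exact Or.inl ⟨k, k', c1, c2, c3, c4, c5⟩
  · exact Or.inr ⟨k, k', c1, c2, c3, c4, c5⟩

theorem exists_bulk_ge_le (a : ℝ) {ε : ℝ} (hε : 0 < ε) :
    ∃ M : ℝ, ∀ᶠ n : ℕ in atTop, ∀ᶠ m : ℕ in atTop, ∀ X ≥ column a n m,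
      meanProb (envMean (cellProb m) X (n * m)) (fun w =>
        lppLevel n a M ≤ lpp noPoints noPoints w (column a n m) (n * m)) ≤ ε := by
  -- For the parameters `0` and `1` the limiting exponent is `1 / 3 + a - σ`, which this `σ` makes
  -- equal to `log ε - 1`. Adding boundary points only increases the value.
  refine ⟨1 / 3 + a - Real.log ε + 1, ?_⟩
  filter_upwards [eventually_full_ge (isColumn_column a) (κ₁ := 0) (κ₂ := 1)
    (σ := 1 / 3 + a - Real.log ε + 1) one_pos (B := ε) (by
      rw [← Real.lt_log_iff_exp_lt hε]
      unfold cubicRate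
      linarith), eventually_intensity_pos 0, eventually_intensity_pos 1] with n h h3 h4
  filter_upwards [h] with m h X hX
  rw [← meanProb_modelMean_env m X (n * m) h3 h4]
  refine ((isMean_modelMean m X _ h3 h4).prob_mono fun ω hω => ?_).trans (h X hX)
  refine hω.trans (Nat.cast_le.2 ?_)
  rw [lpp_eq_max ω.1 ω.2.1, lpp_eq_max ω.1 noPoints]
  have := lpp_eq_max noPoints ω.2.1 ω.2.2 (column a n m) (n * m)
  omega

/-! ### Lower tail of the last-passage time -/

theorem meanProb_env_rotate (m X T : ℕ) (S : (ℕ → ℕ → Bool) → Prop) :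
    meanProb (envMean (cellProb m) X T) (fun w => S (rotate X T w)) =
      meanProb (envMean (cellProb m) X T) S :=
  envMean_rotate (cellProb_nonneg m) (cellProb_le_one m) X T fun w =>
    open Classical in if S w then 1 else 0

theorem meanProb_modelMean_rotate (m X T : ℕ) (w z : ℝ)
    (S : (ℕ → Bool) → (ℕ → Bool) → (ℕ → ℕ → Bool) → Prop) :
    meanProb (modelMean m X T w z) (fun ω => S ω.1 ω.2.1 (rotate X T ω.2.2)) =
      meanProb (modelMean m X T w z) (fun ω => S ω.1 ω.2.1 ω.2.2) := by
  simp only [meanProb, modelMean, prodMean]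
  congr 1; funext U
  congr 1; funext V
  exact envMean_rotate (cellProb_nonneg m) (cellProb_le_one m) X T fun w =>
    open Classical in if S U V w then 1 else 0

theorem meanProb_hor_translate (m c X T : ℕ) {w : ℝ} (hw : 0 < w)
    (S : (ℕ → Bool) × (ℕ → ℕ → Bool) → Prop) :
    meanProb (horMean m (c + X) T w) (fun ω =>
      S (fun i => ω.1 (c + i), fun j i => ω.2 j (c + i))) = meanProb (horMean m X T w) S := by
  simp only [meanProb, horMean, prodMean]
  refine Eq.trans ?_ (iidMean_drop (IsMean.coin (srcProb_nonneg m hw) (srcProb_le_one m hw)) false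
    c X fun U => envMean (cellProb m) X T fun w => open Classical in if S (U, w) then 1 else 0)
  unfold srcMean
  congr 1; funext U
  exact envMean_translate (cellProb_nonneg m) (cellProb_le_one m) c X T fun w =>
    open Classical in if S (fun i => U (c + i), w) then 1 else 0

/-- By `h2` and `h3`, paths leaving the axis at or after `c` are too short to attain `l`, so an
optimal exit point `i` is below `c`. After rotation, the chain from `i` bounds from below the value
without boundary at column `k - i`. The increment from there to `k` is at least a stationary one.
The drifts `i / m` cancel, and one error `h` from the sources plus two from the increment give `3 *
h`. -/
theorem lpp_lower_bound {U U' V' : ℕ → Bool} {w : ℕ → ℕ → Bool} {k T c m : ℕ}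
    {l l' h M : ℝ} (hck : c ≤ k)
    (h1 : l ≤ lpp U noPoints w k T)
    (h2 : (cnt U c : ℝ) < l - l')
    (h3 : (lpp (fun i => U (c + i)) noPoints (fun j i => w j (c + i)) (k - c) T : ℝ) < l')
    (h4 : ∀ i ≤ c, (cnt U i : ℝ) - i / m < h)
    (h5 : lpp U' noPoints (rotate k T w) k T ≤ lpp noPoints V' (rotate k T w) k T)
    (h6 : ∀ j ≤ c, |(cnt (level U' V' (rotate k T w) T) (k - c + j) : ℝ) -
      cnt (level U' V' (rotate k T w) T) (k - c) - j / m| < h) (hM : 3 * h ≤ M) :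
    l - M ≤ lpp noPoints noPoints (rotate k T w) k T := by
  obtain ⟨i, hi, len, hc, hl⟩ := (le_lpp_hor_iff U w k T _).1 le_rfl
  have hl' : l ≤ cnt U i + len := h1.trans (by exact_mod_cast hl)
  rcases le_or_gt c i with hci | hci
  · exfalso
    have hlen : cnt (fun i => U (c + i)) (i - c) + len ≤
        lpp (fun i => U (c + i)) noPoints (fun j i => w j (c + i)) (k - c) T :=
      (le_lpp_hor_iff _ _ _ _ _).2 ⟨i - c, by omega, len, hc.translate c hci, le_rfl⟩
    have e := cnt_add U c (i - c)
    rw [show c + (i - c) = i by omega] at e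
    have : (cnt U i : ℝ) + len ≤ cnt U c +
        lpp (fun i => U (c + i)) noPoints (fun j i => w j (c + i)) (k - c) T := by
      exact_mod_cast (by omega)
    linarith
  · have hlen : len ≤ lpp noPoints noPoints (rotate k T w) (k - i) T :=
      (hasChain_iff _ _ _ _).1 hc.rotate
    have hinc := le_increment_of_ver h5 (Nat.sub_le k i) le_rfl
    have hinc' : (cnt (level U' V' (rotate k T w) T) k : ℝ) + len ≤
        lpp noPoints noPoints (rotate k T w) k T + cnt (level U' V' (rotate k T w) T) (k - i) := by
      exact_mod_cast (by omega)
    have a1 := abs_lt.1 (h6 c le_rfl)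
    have a2 := abs_lt.1 (h6 (c - i) (by omega))
    rw [show k - c + c = k by omega] at a1
    rw [show k - c + (c - i) = k - i by omega, Nat.cast_sub hci.le, sub_div] at a2
    have a3 := h4 i hci.le
    linarith

theorem exists_bulk_lt_le (a : ℝ) {ε : ℝ} (hε : 0 < ε) :
    ∃ M : ℝ, ∀ᶠ n : ℕ in atTop, ∀ᶠ m : ℕ in atTop,
      meanProb (envMean (cellProb m) (column a n m) (n * m)) (fun w =>
        (lpp noPoints noPoints w (column a n m) (n * m) : ℝ) < lppLevel n a (-M)) ≤ ε := by
  have h7 : 0 < ε / 7 := by positivity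
  obtain ⟨r, hr, e1, -⟩ := exists_hor_lt (isColumn_column a) h7
  obtain ⟨r', hr', e4⟩ := exists_exit_ver (isColumn_column a) h7
  obtain ⟨C, hC, hC1, hC2⟩ : ∃ C > 0, r ^ 2 + r + 1 / 3 + a * (2 * r + 1) - C / 4 < Real.log (ε / 7) ∧
      1 - C / 64 < Real.log (ε / 7) := by
    refine ⟨max 1 (max (4 * (r ^ 2 + r + 1 / 3 + a * (2 * r + 1) - Real.log (ε / 7) + 1))
      (64 * (1 - Real.log (ε / 7) + 1))), by positivity, ?_, ?_⟩
    · have := (le_max_left (4 * (r ^ 2 + r + 1 / 3 + a * (2 * r + 1) - Real.log (ε / 7) + 1))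
        (64 * (1 - Real.log (ε / 7) + 1))).trans (le_max_right 1 _)
      linarith
    · have := (le_max_right (4 * (r ^ 2 + r + 1 / 3 + a * (2 * r + 1) - Real.log (ε / 7) + 1))
        (64 * (1 - Real.log (ε / 7) + 1))).trans (le_max_right 1 _)
      linarith
  -- In units of `n^{1/3}`, the first `C n^{2/3}` of the axis carries an excess of sources of about
  -- `r C`, while passage after leaving the axis beyond it loses about `r C + C / 2` up to bounded
  -- terms. `S` lies between the two, so both exponents decrease linearly in `C`.
  set S := r * C + C / 4 with hS
  -- The tilt `1 / 8` with threshold `S / 8 - 1` bounds the excess by `(S - 8) n^{1/3}`; the spare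
  -- `8 n^{1/3}` absorbs the rounding of the window.
  have e2a := eventually_window_le r (1 / 8) (Y := C) (s := S / 8 - 1) (B := ε / 7) hC.le (by
    rw [← Real.lt_log_iff_exp_lt h7]
    refine lt_of_le_of_lt (le_of_eq ?_) hC2
    rw [abs_of_pos (by positivity), hS]
    ring)
  have hcol : IsColumn (a - C / 2) fun n m => column a n m - window C n m := by
    filter_upwards [eventually_abscissa_nonneg a, eventually_abscissa_nonneg (a - C / 2)]
      with n hn hn'
    have h0 : 0 ≤ C * (n : ℝ) ^ (2 / 3 : ℝ) := by positivity
    have := (tendsto_ceil_div hn).sub (tendsto_ceil_div h0)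
    rw [show (n : ℝ) + 2 * a * (n : ℝ) ^ (2 / 3 : ℝ) - C * (n : ℝ) ^ (2 / 3 : ℝ) =
      n + 2 * (a - C / 2) * (n : ℝ) ^ (2 / 3 : ℝ) by ring] at this
    refine this.congr fun m => ?_
    rw [← sub_div, Nat.cast_sub]
    · rfl
    · unfold column window
      gcongr
      linarith
  have e2b := eventually_hor_ge hcol (σ := -S) (κ₁ := r) (κ₂ := r + 1) (B := ε / 7) (by linarith) (by
    rw [← Real.lt_log_iff_exp_lt h7]
    refine lt_of_le_of_lt (le_of_eq ?_) hC1
    unfold cubicRate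
    rw [hS]
    ring)
  set s := max (C * (r + 1)) (C * (r' + 1)) - Real.log (ε / 7) + 1 with hs
  have e3 := eventually_window_le r 1 (Y := C) (s := s) (B := ε / 7) hC.le (by
    rw [← Real.lt_log_iff_exp_lt h7, mul_one, abs_of_pos hr, one_pow]
    linarith [le_max_left (C * (r + 1)) (C * (r' + 1))])
  have e5 := eventually_window_le (-r') 1 (Y := C) (s := s) (B := ε / 7) hC.le (by
    rw [← Real.lt_log_iff_exp_lt h7, mul_one, abs_neg, abs_of_pos hr', one_pow]
    linarith [le_max_right (C * (r + 1)) (C * (r' + 1))])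
  have e6 := eventually_window_le (-r') (-1) (Y := C) (s := s) (B := ε / 7) hC.le (by
    rw [← Real.lt_log_iff_exp_lt h7, neg_mul_neg, mul_one, abs_of_pos hr']
    linarith [le_max_right (C * (r + 1)) (C * (r' + 1))])
  refine ⟨3 * s, ?_⟩
  filter_upwards [e1, e4, e2a, e2b, e3, e5, e6, eventually_intensity_pos r,
    eventually_intensity_pos (-r'), eventually_abscissa_nonneg (a - C / 2),
    eventually_scale_pos] with n e1 e4 e2a e2b e3 e5 e6 i1 i2 hab hN
  have hNm : Tendsto (fun m : ℕ => (n : ℝ) ^ (1 / 3 : ℝ) * m) atTop atTop :=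
    tendsto_natCast_atTop_atTop.const_mul_atTop hN
  filter_upwards [e1, e4, e2a, e2b, e3, e5, e6, eventually_gt_atTop 0,
    hNm.eventually (eventually_ge_atTop 1)] with m e1 e4 e2a e2b e3 e5 e6 hm hm1
  set N := (n : ℝ) ^ (1 / 3 : ℝ) with hNd
  have hm' : (0 : ℝ) < m := by exact_mod_cast hm
  set k := column a n m with hk
  set c := window C n m with hc
  set T := n * m
  have hck : c ≤ k := by
    rw [hc, hk]
    unfold column window
    gcongr
    linarith
  have hcle : (c : ℝ) ≤ C * (n : ℝ) ^ (2 / 3 : ℝ) * m + 1 :=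
    (Nat.ceil_lt_add_one (by positivity)).le
  have p1 := e1 k le_rfl
  have p2a := e2a 0 c k (by omega) hcle
  have p2b := e2b (k - c) le_rfl
  have p3 := e3 0 c k (by omega) hcle
  have p4 := e4 k le_rfl
  have p5 := e5 (k - c) c k (by omega) hcle
  have p6 := e6 (k - c) c k (by omega) hcle
  rw [← meanProb_hor_translate m c (k - c) T i1, show c + (k - c) = k by omega] at p2b
  rw [← meanProb_level hm k T i2] at p5 p6
  rw [← meanProb_modelMean_rotate m k T _ _ fun U V w => lpp noPoints V w k T < lpp U noPoints w k T]
    at p4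
  rw [← meanProb_modelMean_rotate m k T _ _ fun U V w => ∃ j ≤ c, s ≤ 1 / N *
    ((cnt (level U V w T) (k - c + j) : ℝ) - cnt (level U V w T) (k - c) - j / m)] at p5
  rw [← meanProb_modelMean_rotate m k T _ _ fun U V w => ∃ j ≤ c, s ≤ -1 / N *
    ((cnt (level U V w T) (k - c + j) : ℝ) - cnt (level U V w T) (k - c) - j / m)] at p6
  -- One space for all seven bad events: sources of intensity above `1`, an independent boundary of
  -- intensity below `1`, and a common environment, seen directly by the former and after a half
  -- turn by the latter.
  have hQ := (isMean_srcMean m k i1).prod (isMean_modelMean m k T i2 i2)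
  have hS1 := isMean_srcMean m k i1
  have hS2 := isMean_srcMean m k i2
  have hS3 := isMean_snkMean m T i2
  have hM := isMean_modelMean m k T i2 i2
  have hH := isMean_horMean m k T i1
  have b1 := hH.prob_or.trans (add_le_add p1 p2b)
  have b2 := hS1.prob_or.trans (add_le_add p2a p3)
  have b3 := hM.prob_or.trans (add_le_add p4 (hM.prob_or.trans (add_le_add p5 p6)))
  have g1 : ∀ A : (ℕ → Bool) × (ℕ → ℕ → Bool) → Prop,
      meanProb (prodMean (srcMean m k (intensity n r))
        (modelMean m k T (intensity n (-r')) (intensity n (-r')))) (fun x => A (x.1, x.2.2.2)) =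
      meanProb (horMean m k T (intensity n r)) A := by
    intro A
    simp only [meanProb, prodMean, horMean, modelMean]
    congr 1; funext U
    refine (congrArg _ (funext fun U' => hS3.map_const
      (envMean (cellProb m) k T fun w => open Classical in if A (U, w) then 1 else 0))).trans
      (hS2.map_const _)
  rw [← g1] at b1
  rw [← meanProb_prod_fst hM] at b2
  rw [← meanProb_prod_snd hS1] at b3
  rw [← meanProb_env_rotate, ← meanProb_modelMean_env m k T i2 i2,
    ← meanProb_prod_snd hS1]
  refine (hQ.prob_mono fun x hx => ?_).trans ((hQ.prob_or.trans (add_le_add b1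
    (hQ.prob_or.trans (add_le_add b2 b3)))).trans (le_of_eq (by ring)))
  by_contra! hcon
  obtain ⟨⟨c1, c2⟩, ⟨c3, c4⟩, c5, c6, c7⟩ := hcon
  refine absurd hx (not_lt.2 ?_)
  have hlev : lppLevel n a (-(3 * s)) = lppLevel n a 0 - 3 * s * N := by
    unfold lppLevel
    rw [← hNd]
    ring
  rw [hlev]
  have hwin : ∀ (f : ℕ → ℝ), (∀ j ≤ c, 1 / N * f j < s) → ∀ j ≤ c, f j < s * N := by
    intro f hf j hj
    have := hf j hj
    rwa [one_div, inv_mul_lt_iff₀ hN, mul_comm] at this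
  refine lpp_lower_bound (l' := lppLevel n (a - C / 2) (-S)) (h := s * N) (m := m) hck
    (le_trans ?_ c1) ?_ c2 ?_ c5 ?_ (by linarith)
  · unfold lppLevel
    rw [← hNd, zero_mul]
    have : 0 ≤ 5 / 12 * r ^ 2 * N := by positivity
    linarith
  · have hU := c3 c le_rfl
    rw [zero_add, cnt_zero, Nat.cast_zero, sub_zero, div_mul_eq_mul_div, div_lt_iff₀ hN] at hU
    have hcm : (c : ℝ) / m ≤ C * (n : ℝ) ^ (2 / 3 : ℝ) + 1 / m := by
      rw [div_le_iff₀ hm']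
      refine hcle.trans (le_of_eq ?_)
      field_simp
    have h1m : 1 / (m : ℝ) ≤ N := by
      rw [div_le_iff₀ hm']
      exact hm1
    have : lppLevel n a 0 - lppLevel n (a - C / 2) (-S) = C * (n : ℝ) ^ (2 / 3 : ℝ) + S * N := by
      unfold lppLevel
      rw [← hNd]
      ring
    rw [this]
    linarith
  · intro i hi
    have := hwin (fun k => (cnt x.1 (0 + k) : ℝ) - cnt x.1 0 - k / m) c4 i hi
    simpa [cnt_zero] using this
  · intro j hj
    have a1 := hwin _ c6 j hj
    have a2 := hwin (fun j => -((cnt (level x.2.1 x.2.2.1 (rotate k T x.2.2.2) T) (k - c + j) : ℝ) -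
      cnt (level x.2.1 x.2.2.1 (rotate k T x.2.2.2) T) (k - c) - j / m))
      (fun j hj => by have := c7 j hj; rwa [neg_div, neg_mul, ← mul_neg] at this) j hj
    rw [abs_lt]
    constructor <;> linarith

/-! ### Discretization of point configurations -/

/-- The cell of side `1 / m` in column `i` and row `j`. -/
def gridCell (m i j : ℕ) : Set (ℝ × ℝ) :=
  Ioc ((i : ℝ) / m) ((i + 1 : ℝ) / m) ×ˢ Ioc ((j : ℝ) / m) ((j + 1 : ℝ) / m)

/-- The cells of side `1 / m` that contain points (row index first). -/
noncomputable def PointConfig.occupied (S : PointConfig) (m j i : ℕ) : Bool :=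
  decide (0 < S.count (gridCell m i j))

theorem isBounded_gridCell (m i j : ℕ) : Bornology.IsBounded (gridCell m i j) :=
  (Metric.isBounded_Ioc _ _).prod (Metric.isBounded_Ioc _ _)

theorem measurableSet_gridCell (m i j : ℕ) : MeasurableSet (gridCell m i j) :=
  measurableSet_Ioc.prod measurableSet_Ioc

theorem PointConfig.occupied_iff (S : PointConfig) (m i j : ℕ) :
    S.occupied m j i = true ↔ (S.points ∩ gridCell m i j).Nonempty := by
  rw [PointConfig.occupied, decide_eq_true_iff, PointConfig.count,
    Set.ncard_pos (S.finite_inter _ (isBounded_gridCell m i j))]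

theorem lt_of_mem_gridIoc {m i i' : ℕ} {x x' : ℝ} (hx : x ≤ (i + 1 : ℝ) / m)
    (hx' : (i' : ℝ) / m < x') (h : i < i') : x < x' := by
  refine lt_of_le_of_lt (hx.trans ?_) hx'
  gcongr
  exact_mod_cast h

theorem mem_gridIoc_iff {m : ℕ} (hm : 0 < m) {x : ℝ} (hx : 0 < x) :
    x ∈ Ioc (((⌈x * m⌉₊ - 1 : ℕ) : ℝ) / m) (((⌈x * m⌉₊ - 1 : ℕ) + 1 : ℝ) / m) := by
  have hm' : (0 : ℝ) < m := by exact_mod_cast hm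
  have h0 : 0 < ⌈x * m⌉₊ := Nat.ceil_pos.2 (by positivity)
  have e : ((⌈x * m⌉₊ - 1 : ℕ) : ℝ) = ⌈x * m⌉₊ - 1 := by
    rw [Nat.cast_sub h0, Nat.cast_one]
  rw [e]
  constructor
  · rw [div_lt_iff₀ hm']
    linarith [Nat.ceil_lt_add_one (show 0 ≤ x * m by positivity)]
  · rw [le_div_iff₀ hm', sub_add_cancel]
    exact Nat.le_ceil _

theorem hasIncreasingPath_of_hasChain (S : PointConfig) {m : ℕ} (hm : 0 < m) {n k len : ℕ}
    (h : HasChain (S.occupied m) 0 k (n * m) len) :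
    S.HasIncreasingPath 0 0 ((k : ℝ) / m) n len := by
  have hm' : (0 : ℝ) < m := by exact_mod_cast hm
  obtain ⟨p, h1, h2, h3⟩ := h
  have : ∀ a, ∃ z, z ∈ S.points ∩ gridCell m (p a).1 (p a).2 := fun a =>
    (S.occupied_iff m _ _).1 (h3 a).2.2.2
  choose z hz using this
  refine ⟨z, fun a b hab => lt_of_mem_gridIoc (hz a).2.1.2 (hz b).2.1.1 (h1 hab),
    fun a b hab => lt_of_mem_gridIoc (hz a).2.2.2 (hz b).2.2.1 (h2 hab), fun a => ⟨(hz a).1, ?_, ?_⟩⟩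
  · refine ⟨lt_of_le_of_lt (by positivity) (hz a).2.1.1, (hz a).2.1.2.trans ?_⟩
    gcongr
    exact_mod_cast (h3 a).2.1
  · refine ⟨lt_of_le_of_lt (by positivity) (hz a).2.2.1, (hz a).2.2.2.trans ?_⟩
    rw [div_le_iff₀ hm']
    exact_mod_cast (h3 a).2.2.1

theorem ceil_lt_ceil_of_add_le {m : ℕ} (hm : 0 < m) {x y : ℝ} (hx : 0 < x)
    (h : 1 / (m : ℝ) ≤ y - x) : ⌈x * m⌉₊ < ⌈y * m⌉₊ := by
  have hm' : (0 : ℝ) < m := by exact_mod_cast hm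
  rw [div_le_iff₀ hm'] at h
  have h1 := Nat.ceil_lt_add_one (show 0 ≤ x * m by positivity)
  have h2 := Nat.le_ceil (y * m)
  have : (⌈x * m⌉₊ : ℝ) < ⌈y * m⌉₊ := by linarith
  exact_mod_cast this

/-- The rectangle contains finitely many points, so for large `m` any two different coordinates
differ by at least `1 / m`. The points of a path then lie in strictly increasing rows and columns of
cells. The converse holds for every `m`. -/
theorem eventually_path_iff_chain (S : PointConfig) (Y : ℝ) (n : ℕ) :
    ∀ᶠ m : ℕ in atTop, ∀ k : ℕ, (k : ℝ) / m ≤ Y → ∀ len,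
      S.HasIncreasingPath 0 0 ((k : ℝ) / m) n len ↔ HasChain (S.occupied m) 0 k (n * m) len := by
  have hfin := S.finite_rect 0 0 Y n
  have hsep : ∀ f : ℝ × ℝ → ℝ, ∀ᶠ m : ℕ in atTop, ∀ z ∈ S.points ∩ Ioc 0 Y ×ˢ Ioc 0 (n : ℝ),
      ∀ z' ∈ S.points ∩ Ioc 0 Y ×ˢ Ioc 0 (n : ℝ), f z < f z' → 1 / (m : ℝ) ≤ f z' - f z := by
    intro f
    rw [eventually_all_finite hfin]
    intro z hz
    rw [eventually_all_finite hfin]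
    intro z' hz'
    by_cases h : f z < f z'
    · filter_upwards [(tendsto_one_div_atTop_nhds_zero_nat (𝕜 := ℝ)).eventually
        (gt_mem_nhds (sub_pos.2 h))] with m hm _ using hm.le
    · exact Eventually.of_forall fun m h' => absurd h' h
  filter_upwards [hsep Prod.fst, hsep Prod.snd, eventually_gt_atTop 0] with m s1 s2 hm k hk len
  refine ⟨?_, hasIncreasingPath_of_hasChain S hm⟩
  rintro ⟨p, h1, h2, h3⟩
  have hm' : (0 : ℝ) < m := by exact_mod_cast hm
  have hR : ∀ a, p a ∈ S.points ∩ Ioc 0 Y ×ˢ Ioc 0 (n : ℝ) := fun a =>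
    ⟨(h3 a).1, ⟨(h3 a).2.1.1, (h3 a).2.1.2.trans hk⟩, (h3 a).2.2⟩
  have pos1 : ∀ a, 0 < ⌈(p a).1 * m⌉₊ := fun a =>
    Nat.ceil_pos.2 (mul_pos (h3 a).2.1.1 hm')
  have pos2 : ∀ a, 0 < ⌈(p a).2 * m⌉₊ := fun a =>
    Nat.ceil_pos.2 (mul_pos (h3 a).2.2.1 hm')
  refine ⟨fun a => (⌈(p a).1 * m⌉₊ - 1, ⌈(p a).2 * m⌉₊ - 1), ?_, ?_, ?_⟩
  · intro a b hab
    have := ceil_lt_ceil_of_add_le hm (h3 a).2.1.1 (s1 _ (hR a) _ (hR b) (h1 hab))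
    have := pos1 a
    simp only
    omega
  · intro a b hab
    have := ceil_lt_ceil_of_add_le hm (h3 a).2.2.1 (s2 _ (hR a) _ (hR b) (h2 hab))
    have := pos2 a
    simp only
    omega
  · intro a
    have q1 : ⌈(p a).1 * m⌉₊ ≤ k := by
      rw [Nat.ceil_le]
      have := (h3 a).2.1.2
      rwa [le_div_iff₀ hm'] at this
    have q2 : ⌈(p a).2 * m⌉₊ ≤ n * m := by
      rw [Nat.ceil_le]
      push_cast
      exact mul_le_mul_of_nonneg_right (h3 a).2.2.2 hm'.le
    have := pos1 a
    have := pos2 a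
    refine ⟨Nat.zero_le _, by simp only; omega, by simp only; omega, ?_⟩
    rw [S.occupied_iff]
    exact ⟨p a, (h3 a).1, mem_gridIoc_iff hm (h3 a).2.1.1, mem_gridIoc_iff hm (h3 a).2.2.1⟩

/-- The discretized last-passage time. -/
noncomputable def PointConfig.gridPassage (S : PointConfig) (n m k : ℕ) : ℕ :=
  lpp noPoints noPoints (S.occupied m) k (n * m)

theorem eventually_lastPassage_eq (S : PointConfig) (Y : ℝ) (n : ℕ) :
    ∀ᶠ m : ℕ in atTop, ∀ k : ℕ, (k : ℝ) / m ≤ Y →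
      S.lastPassage 0 0 ((k : ℝ) / m) n = S.gridPassage n m k := by
  filter_upwards [eventually_path_iff_chain S Y n] with m hm k hk
  unfold PointConfig.lastPassage PointConfig.gridPassage
  simp only [hm k hk, hasChain_iff]
  exact csSup_Iic

/-- Rounding up matters: the grid abscissae approach `y` from the right, where the last-passage time
is continuous. -/
theorem tendsto_gridPassage (S : PointConfig) {y : ℝ} (hy : 0 ≤ y) (n : ℕ) :
    Tendsto (fun m : ℕ => (S.gridPassage n m ⌈y * m⌉₊ : ℝ)) atTop (𝓝 (S.lastPassage 0 0 y n)) := by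
  have hc := tendsto_ceil_div hy
  have hc' : Tendsto (fun m : ℕ => (⌈y * m⌉₊ : ℝ) / m) atTop (𝓝[≥] y) := by
    refine tendsto_nhdsWithin_iff.2 ⟨hc, ?_⟩
    filter_upwards [eventually_gt_atTop 0] with m hm
    have hm' : (0 : ℝ) < m := by exact_mod_cast hm
    rw [mem_Ici, le_div_iff₀ hm']
    exact Nat.le_ceil _
  have h := Tendsto.comp (S.lastPassage_right_cont 0 0 n y) hc'
  refine h.congr' ?_
  filter_upwards [eventually_lastPassage_eq S (y + 1) n,
    hc.eventually (gt_mem_nhds (lt_add_one y))] with m h1 h2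
  rw [Function.comp_apply, h1 _ h2.le]

/-! ### Measurability -/

theorem measurable_level (j k : ℕ) : Measurable fun w : ℕ → ℕ → Bool =>
    level noPoints noPoints w j k := by
  induction j generalizing k with
  | zero => exact measurable_const
  | succ j ih =>
    have hw : ∀ k, Measurable fun w : ℕ → ℕ → Bool => w j k := fun k =>
      (measurable_pi_apply k).comp (measurable_pi_apply j)
    have hv : ∀ k, Measurable fun w : ℕ → ℕ → Bool =>
        vert (level noPoints noPoints w j) (noPoints j) (w j) k := by
      intro k
      induction k with
      | zero => exact measurable_const
      | succ k ihk =>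
        exact (Measurable.of_discrete (f := fun x : Bool × Bool × Bool => !x.1 && (x.2.1 || x.2.2))).comp
          ((ih k).prodMk (ihk.prodMk (hw k)))
    exact (Measurable.of_discrete (f := fun x : Bool × Bool × Bool => !x.1 && (x.2.1 || x.2.2))).comp
      ((hv k).prodMk ((ih k).prodMk (hw k)))

section Poisson

variable {Ω : Type*} [MeasurableSpace Ω] {P : Measure Ω} {N : Ω → PointConfig}
  (hN : IsPoissonPointProcess P N volume)

include hN

theorem measurable_occupied (m : ℕ) : Measurable fun ω => (N ω).occupied m := by
  refine measurable_pi_lambda _ fun j => measurable_pi_lambda _ fun i => ?_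
  exact (Measurable.of_discrete (f := fun c : ℕ => decide (0 < c))).comp
    (hN.measurable_count _ (measurableSet_gridCell m i j) (isBounded_gridCell m i j))

theorem measurable_gridPassage (n m k : ℕ) : Measurable fun ω => (N ω).gridPassage n m k := by
  have h : Measurable fun w : ℕ → ℕ → Bool => lpp noPoints noPoints w k (n * m) := by
    simp only [lpp_noPoints, cnt]
    exact Finset.measurable_fun_sum _ fun i _ =>
      (Measurable.of_discrete (f := Bool.toNat)).comp (measurable_level _ _)
  exact h.comp (measurable_occupied hN m)

theorem measurable_lastPassage (y : ℝ) (n : ℕ) :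
    Measurable fun ω => ((N ω).lastPassage 0 0 y n : ℝ) := by
  have key : ∀ y : ℝ, 0 ≤ y → Measurable fun ω => ((N ω).lastPassage 0 0 y n : ℝ) := by
    intro y hy
    refine measurable_of_tendsto_metrizable (f := fun (m : ℕ) ω =>
      ((N ω).gridPassage n m ⌈y * m⌉₊ : ℝ)) (fun m => ?_) (tendsto_pi_nhds.2 fun ω =>
        tendsto_gridPassage (N ω) hy n)
    exact (Measurable.of_discrete (f := fun c : ℕ => (c : ℝ))).comp (measurable_gridPassage hN n m _)
  rcases le_or_gt 0 y with hy | hy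
  · exact key y hy
  · have : ∀ S : PointConfig, S.lastPassage 0 0 y n = S.lastPassage 0 0 0 n := by
      intro S
      unfold PointConfig.lastPassage PointConfig.HasIncreasingPath
      rw [Ioc_eq_empty (not_lt.2 hy.le), Ioc_eq_empty (lt_irrefl 0)]
    simp only [this]
    exact key 0 le_rfl

end Poisson

/-! ### The law of the discretized configuration -/

/-- Extension of a finite sequence by `d`. -/
def extendSeq {A B : Type*} (g : B → A) (d : A) {n : ℕ} (η : Fin n → B) (i : ℕ) : A :=
  if h : i < n then g (η ⟨i, h⟩) else d

theorem extendSeq_cons {A B : Type*} (g : B → A) (d : A) {n : ℕ} (b : B) (η : Fin n → B) :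
    extendSeq g d (Fin.cons b η : Fin (n + 1) → B) = scons (g b) (extendSeq g d η) := by
  funext i
  cases i with
  | zero => simp [extendSeq, scons]
  | succ i =>
    simp only [extendSeq, scons, Nat.add_lt_add_iff_right]
    split_ifs with h
    · congr 1
    · rfl

theorem iidMean_eq_sum {A B : Type*} [Fintype B] {e : (A → ℝ) → ℝ} {wt : B → ℝ} {g : B → A}
    (he : ∀ F, e F = ∑ b, wt b * F (g b)) (d : A) (n : ℕ) (F : (ℕ → A) → ℝ) :
    iidMean e d n F = ∑ η : Fin n → B, (∏ i, wt (η i)) * F (extendSeq g d η) := by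
  induction n generalizing F with
  | zero =>
    simp only [iidMean, Finset.univ_unique, Finset.sum_singleton, Finset.univ_eq_empty,
      Finset.prod_empty, one_mul]
    congr 1
  | succ n ih =>
    rw [iidMean, he, ← (Fin.consEquiv fun _ => B).sum_comp, Fintype.sum_prod_type]
    refine Finset.sum_congr rfl fun b _ => ?_
    rw [ih, Finset.mul_sum]
    refine Finset.sum_congr rfl fun η _ => ?_
    change _ = (∏ i, wt ((Fin.cons b η : Fin (n + 1) → B) i)) *
      F (extendSeq g d (Fin.cons b η : Fin (n + 1) → B))
    rw [extendSeq_cons, Fin.prod_univ_succ]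
    simp only [Fin.cons_zero, Fin.cons_succ]
    ring

/-- Weight of a coin. -/
def coinWeight (q : ℝ) (b : Bool) : ℝ := if b then q else 1 - q

/-- Environment with the given values in `[0, X) × [0, T)` and no points elsewhere. -/
def extendEnv {X T : ℕ} (η : Fin T → Fin X → Bool) : ℕ → ℕ → Bool :=
  extendSeq (extendSeq id false) noPoints η

theorem envMean_eq_sum (q : ℝ) (X T : ℕ) (F : (ℕ → ℕ → Bool) → ℝ) :
    envMean q X T F = ∑ η : Fin T → Fin X → Bool,
      (∏ j, ∏ i, coinWeight q (η j i)) * F (extendEnv η) :=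
  iidMean_eq_sum (iidMean_eq_sum (fun F => by simp [coin, coinWeight]) false X) noPoints T F

theorem hasChain_extendEnv {w : ℕ → ℕ → Bool} {X T k : ℕ} (hk : k ≤ X) (len : ℕ) :
    HasChain (extendEnv fun (j : Fin T) (i : Fin X) => w j i) 0 k T len ↔ HasChain w 0 k T len := by
  have : ∀ i j, i < k → j < T → extendEnv (fun (j : Fin T) (i : Fin X) => w j i) j i = w j i := by
    intro i j hi hj
    rw [extendEnv, extendSeq, dif_pos hj, extendSeq, dif_pos (by omega)]
    rfl
  constructor
  · rintro ⟨p, h1, h2, h3⟩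
    refine ⟨p, h1, h2, fun a => ⟨(h3 a).1, (h3 a).2.1, (h3 a).2.2.1, ?_⟩⟩
    rw [← this _ _ (h3 a).2.1 (h3 a).2.2.1]
    exact (h3 a).2.2.2
  · rintro ⟨p, h1, h2, h3⟩
    refine ⟨p, h1, h2, fun a => ⟨(h3 a).1, (h3 a).2.1, (h3 a).2.2.1, ?_⟩⟩
    rw [this _ _ (h3 a).2.1 (h3 a).2.2.1]
    exact (h3 a).2.2.2

theorem lpp_extendEnv (w : ℕ → ℕ → Bool) {X T k : ℕ} (hk : k ≤ X) :
    lpp noPoints noPoints (extendEnv fun (j : Fin T) (i : Fin X) => w j i) k T =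
      lpp noPoints noPoints w k T :=
  eq_of_forall_le_iff fun len => by
    rw [← hasChain_iff, ← hasChain_iff, hasChain_extendEnv hk]

theorem volume_gridCell {m : ℕ} (hm : 0 < m) (i j : ℕ) :
    ((volume (gridCell m i j)).toNNReal : ℝ) = 1 / (m : ℝ) ^ 2 := by
  have hm' : (0 : ℝ) < m := by exact_mod_cast hm
  have : ∀ i : ℕ, ((i : ℝ) + 1) / m - i / m = 1 / m := fun i => by ring
  rw [gridCell, Measure.volume_eq_prod, Measure.prod_prod, Real.volume_Ioc, Real.volume_Ioc,
    this, this, ← ENNReal.ofReal_mul (by positivity)]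
  change ((ENNReal.ofReal _).toReal) = _
  rw [ENNReal.toReal_ofReal (by positivity)]
  field_simp

theorem disjoint_gridCell {m i j i' j' : ℕ} (h : (j, i) ≠ (j', i')) :
    Disjoint (gridCell m i j) (gridCell m i' j') := by
  rw [Set.disjoint_left]
  intro z hz hz'
  apply h
  have h1 : ∀ {i i' : ℕ} {x : ℝ}, x ≤ (i + 1 : ℝ) / m → (i' : ℝ) / m < x → i' ≤ i := by
    intro i i' x a1 a2
    by_contra hlt
    exact lt_irrefl x (lt_of_mem_gridIoc a1 a2 (not_le.1 hlt))
  rw [Prod.mk.injEq]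
  exact ⟨le_antisymm (h1 hz'.2.2 hz.2.1) (h1 hz.2.2 hz'.2.1),
    le_antisymm (h1 hz'.1.2 hz.1.1) (h1 hz.1.2 hz'.1.1)⟩

section PoissonLaw

variable {Ω : Type*} [MeasurableSpace Ω] {P : Measure Ω} [IsProbabilityMeasure P]
  {N : Ω → PointConfig} (hN : IsPoissonPointProcess P N volume)

include hN

theorem prob_occupied {m : ℕ} (hm : 0 < m) (i j : ℕ) (b : Bool) :
    P.real ((fun ω => (N ω).count (gridCell m i j)) ⁻¹' {c | decide (0 < c) = b}) =
      coinWeight (cellProb m) b := by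
  have hmeas := hN.measurable_count _ (measurableSet_gridCell m i j) (isBounded_gridCell m i j)
  have h0 : P.real ((fun ω => (N ω).count (gridCell m i j)) ⁻¹' {0}) =
      Real.exp (-(1 / (m : ℝ) ^ 2)) := by
    rw [← map_measureReal_apply hmeas (measurableSet_singleton 0),
      hN.map_count _ (measurableSet_gridCell m i j) (isBounded_gridCell m i j),
      poissonMeasure_real_singleton, volume_gridCell hm]
    simp
  cases b with
  | false =>
    have : {c : ℕ | decide (0 < c) = false} = {0} := by
      ext c; simp
    rw [this, h0, coinWeight, cellProb]
    simp
  | true =>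
    have : {c : ℕ | decide (0 < c) = true} = {0}ᶜ := by
      ext c; simp [Nat.pos_iff_ne_zero]
    rw [this, preimage_compl, probReal_compl_eq_one_sub (hmeas (measurableSet_singleton 0)), h0,
      coinWeight, cellProb]
    simp

theorem prob_occupied_eq {m : ℕ} (hm : 0 < m) {X T : ℕ} (η : Fin T → Fin X → Bool) :
    P.real ((fun ω (j : Fin T) (i : Fin X) => (N ω).occupied m j i) ⁻¹' {η}) =
      ∏ j, ∏ i, coinWeight (cellProb m) (η j i) := by
  let e : Fin T × Fin X ≃ Fin (T * X) := finProdFinEquiv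
  let B : Fin (T * X) → Set (ℝ × ℝ) := fun a => gridCell m (e.symm a).2 (e.symm a).1
  have hind := hN.iIndepFun_count (T * X) B (fun a => measurableSet_gridCell _ _ _)
    (fun a => isBounded_gridCell _ _ _) (by
      intro a b hab
      refine disjoint_gridCell fun h => hab (e.symm.injective ?_)
      rw [Prod.mk.injEq] at h
      exact Prod.ext (Fin.ext h.1) (Fin.ext h.2))
  have hprod := hind.measure_inter_preimage_eq_mul Finset.univ
    (sets := fun a => {c : ℕ | decide (0 < c) = η (e.symm a).1 (e.symm a).2})
    (fun a _ => MeasurableSet.of_discrete)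
  have hset : (fun ω (j : Fin T) (i : Fin X) => (N ω).occupied m j i) ⁻¹' {η} =
      ⋂ a ∈ (Finset.univ : Finset (Fin (T * X))), (fun ω => (N ω).count (B a)) ⁻¹'
        {c : ℕ | decide (0 < c) = η (e.symm a).1 (e.symm a).2} := by
    ext ω
    simp only [mem_preimage, mem_singleton_iff, funext_iff, Finset.mem_univ, iInter_true, mem_iInter,
      Set.mem_ofPred_eq]
    constructor
    · intro h a
      exact h _ _
    · intro h j i
      have := h (e (j, i))
      simp only [B, Equiv.symm_apply_apply] at this
      exact this
  rw [measureReal_def, hset, hprod, ENNReal.toReal_prod]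
  have : ∀ a, (P ((fun ω => (N ω).count (B a)) ⁻¹'
      {c : ℕ | decide (0 < c) = η (e.symm a).1 (e.symm a).2})).toReal =
        coinWeight (cellProb m) (η (e.symm a).1 (e.symm a).2) := fun a =>
    prob_occupied hN hm _ _ _
  simp only [this]
  rw [e.symm.prod_comp fun x : Fin T × Fin X => coinWeight (cellProb m) (η x.1 x.2),
    Fintype.prod_prod_type]

theorem prob_extendEnv {m : ℕ} (hm : 0 < m) (X T : ℕ) (D : (ℕ → ℕ → Bool) → Prop) :
    P.real {ω | D (extendEnv fun (j : Fin T) (i : Fin X) => (N ω).occupied m j i)} =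
      meanProb (envMean (cellProb m) X T) D := by
  classical
  have hmeas : Measurable fun ω (j : Fin T) (i : Fin X) => (N ω).occupied m j i :=
    measurable_pi_lambda _ fun j => measurable_pi_lambda _ fun i =>
      (measurable_pi_apply (i : ℕ)).comp ((measurable_pi_apply (j : ℕ)).comp
        (measurable_occupied hN m))
  have h := sum_measureReal_preimage_singleton (μ := P)
    (f := fun ω (j : Fin T) (i : Fin X) => (N ω).occupied m j i)
    (Finset.univ.filter fun η : Fin T → Fin X → Bool => D (extendEnv η))
    (fun η _ => hmeas (measurableSet_singleton η))
  have hset : {ω | D (extendEnv fun (j : Fin T) (i : Fin X) => (N ω).occupied m j i)} =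
      (fun ω (j : Fin T) (i : Fin X) => (N ω).occupied m j i) ⁻¹'
        ↑(Finset.univ.filter fun η : Fin T → Fin X → Bool => D (extendEnv η)) := by
    ext ω
    simp
  rw [hset, ← h, meanProb, envMean_eq_sum, Finset.sum_filter]
  refine Finset.sum_congr rfl fun η _ => ?_
  rw [prob_occupied_eq hN hm]
  by_cases hD : D (extendEnv η) <;> simp [hD]

end PoissonLaw

/-! ### Estimates for the profiles -/

/-- Fatou's lemma for events, free of measurability assumptions, so it applies to oscillation events
that range over uncountably many pairs of times. -/
theorem measure_le_of_eventually_mem {Ω : Type*} [MeasurableSpace Ω] {P : Measure Ω} {E : Set Ω}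
    {F : ℕ → Set Ω} {c : ENNReal} (h : ∀ ω ∈ E, ∀ᶠ m in atTop, ω ∈ F m)
    (hc : ∀ᶠ m in atTop, P (F m) ≤ c) : P E ≤ c := by
  have hsub : E ⊆ ⋃ M, ⋂ m ≥ M, F m := by
    intro ω hω
    obtain ⟨M, hM⟩ := eventually_atTop.1 (h ω hω)
    exact mem_iUnion.2 ⟨M, mem_iInter₂.2 hM⟩
  have hmono : Monotone fun M => ⋂ m ≥ M, F m := fun M M' hMM' =>
    biInter_subset_biInter_left fun m hm => le_trans hMM' hm
  refine (measure_mono hsub).trans ?_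
  rw [hmono.measure_iUnion]
  obtain ⟨M₀, hM₀⟩ := eventually_atTop.1 hc
  refine iSup_le fun M => (measure_mono ?_).trans (hM₀ (max M M₀) (le_max_right _ _))
  exact biInter_subset_of_mem (le_max_left M M₀)

/-- The abscissa `n + 2 u n^{2/3}` of the profile at `u`. -/
noncomputable def abscissa (n : ℕ) (u : ℝ) : ℝ := n + 2 * u * (n : ℝ) ^ (2 / 3 : ℝ)

theorem abscissa_mono (n : ℕ) : Monotone (abscissa n) := fun u v h => by
  unfold abscissa
  gcongr

theorem profile_eq (S : PointConfig) {n : ℕ} (hn : 0 < (n : ℝ) ^ (1 / 3 : ℝ)) (u : ℝ) :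
    S.profile n u =
      (S.lastPassage 0 0 (abscissa n u) n - abscissa n u - n) / (n : ℝ) ^ (1 / 3 : ℝ) + u ^ 2 := by
  unfold PointConfig.profile abscissa
  field_simp
  ring

section Profile

variable {Ω : Type*} [MeasurableSpace Ω] {P : Measure Ω} [IsProbabilityMeasure P]
  {N : Ω → PointConfig} (hN : IsPoissonPointProcess P N volume)

include hN

theorem measure_gridPassage_le {n m X : ℕ} (hm : 0 < m) {ε : ℝ} {D : (ℕ → ℕ) → Prop}
    (hD : ∀ f g : ℕ → ℕ, (∀ k ≤ X, f k = g k) → D f → D g)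
    (h : meanProb (envMean (cellProb m) X (n * m))
      (fun w => D fun k => lpp noPoints noPoints w k (n * m)) ≤ ε) :
    P {ω | D ((N ω).gridPassage n m)} ≤ ENNReal.ofReal ε := by
  rw [← prob_extendEnv hN hm] at h
  refine le_trans (measure_mono ?_) ((ofReal_measureReal (μ := P)).symm.le.trans
    (ENNReal.ofReal_le_ofReal h))
  exact fun ω hω => hD _ _ (fun k hk => (lpp_extendEnv _ hk).symm) hω

theorem exists_profile_oscillation_le {a b : ℝ} (hab : a ≤ b) {η ε : ℝ} (hη : 0 < η)
    (hε : 0 < ε) : ∃ δ > 0, ∀ᶠ n : ℕ in atTop,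
      P {ω | ∃ s ∈ Icc a b, ∃ t ∈ Icc a b, |s - t| < δ ∧
        η < |(N ω).profile n s - (N ω).profile n t|} ≤ ENNReal.ofReal ε := by
  obtain ⟨Y, hY, hosc⟩ := exists_bulk_oscillates_le hab (show 0 < η / 6 by positivity) hε
  -- Times at distance `Y / 2` have abscissae at distance `Y n^{2/3}`; the second bound keeps the
  -- variation of the parabola `u ^ 2` below `η / 2`.
  refine ⟨min (Y / 2) (η / (4 * (|a| + |b| + 1))), by positivity, ?_⟩
  filter_upwards [hosc, eventually_abscissa_nonneg a, eventually_scale_pos] with n hn hpos hsc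
  have hsub : ∀ ω ∈ {ω | ∃ s ∈ Icc a b, ∃ t ∈ Icc a b,
      |s - t| < min (Y / 2) (η / (4 * (|a| + |b| + 1))) ∧
        η < |(N ω).profile n s - (N ω).profile n t|}, ∀ᶠ m : ℕ in atTop,
      ω ∈ {ω | Oscillates ((N ω).gridPassage n m) (column a n m) (column b n m) (window Y n m) m
        (3 * (η / 6 * (n : ℝ) ^ (1 / 3 : ℝ)))} := by
    rintro ω ⟨s, hs, t, ht, hst, hd⟩
    wlog hle : s ≤ t generalizing s t
    · exact this t ht s hs (by rwa [abs_sub_comm]) (by rwa [abs_sub_comm]) (le_of_not_ge hle)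
    have hs0 : 0 ≤ abscissa n s := hpos.trans (abscissa_mono n hs.1)
    have ht0 : 0 ≤ abscissa n t := hpos.trans (abscissa_mono n ht.1)
    have hlim := (((tendsto_gridPassage (N ω) ht0 n).sub (tendsto_gridPassage (N ω) hs0 n)).sub
      ((tendsto_ceil_div ht0).sub (tendsto_ceil_div hs0))).abs
    obtain ⟨h1, h2⟩ := lt_min_iff.1 hst
    have hsq : |s ^ 2 - t ^ 2| ≤ η / 2 := by
      have e : s ^ 2 - t ^ 2 = (s - t) * (s + t) := by ring
      have hb : |s + t| ≤ 2 * (|a| + |b| + 1) := by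
        rw [abs_le]
        constructor <;>
          linarith [hs.1, hs.2, ht.1, ht.2, neg_abs_le a, le_abs_self b, abs_nonneg a, abs_nonneg b]
      rw [lt_div_iff₀ (by positivity)] at h2
      rw [e, abs_mul]
      calc |s - t| * |s + t| ≤ |s - t| * (2 * (|a| + |b| + 1)) := by gcongr
        _ ≤ η / 2 := by linarith
    have hlow : 3 * (η / 6 * (n : ℝ) ^ (1 / 3 : ℝ)) <
        |((N ω).lastPassage 0 0 (abscissa n t) n : ℝ) - (N ω).lastPassage 0 0 (abscissa n s) n -
          (abscissa n t - abscissa n s)| := by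
      rw [profile_eq _ hsc, profile_eq _ hsc] at hd
      set A : ℝ := ((N ω).lastPassage 0 0 (abscissa n t) n : ℝ) -
        (N ω).lastPassage 0 0 (abscissa n s) n - (abscissa n t - abscissa n s)
      have e : ∀ x y : ℝ, x = -A / (n : ℝ) ^ (1 / 3 : ℝ) + y → |y| ≤ η / 2 → η < |x| →
          η / 2 < |A| / (n : ℝ) ^ (1 / 3 : ℝ) := by
        intro x y hx hy hlt
        rw [hx] at hlt
        have := abs_add_le (-A / (n : ℝ) ^ (1 / 3 : ℝ)) y
        rw [abs_div, abs_neg, abs_of_pos hsc] at this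
        linarith
      have := e _ _ (by ring) hsq hd
      rw [lt_div_iff₀ hsc] at this
      linarith
    filter_upwards [hlim.eventually_const_lt hlow] with m hm
    refine ⟨⌈abscissa n s * m⌉₊, ⌈abscissa n t * m⌉₊, ?_, ?_, ?_, ?_, ?_⟩
    · exact Nat.ceil_mono (mul_le_mul_of_nonneg_right (abscissa_mono n hs.1) m.cast_nonneg)
    · exact Nat.ceil_mono (mul_le_mul_of_nonneg_right (abscissa_mono n hle) m.cast_nonneg)
    · exact Nat.ceil_mono (mul_le_mul_of_nonneg_right (abscissa_mono n ht.2) m.cast_nonneg)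
    · refine le_trans (Nat.ceil_mono ?_) (Nat.ceil_add_le _ _)
      have : abscissa n t ≤ abscissa n s + Y * (n : ℝ) ^ (2 / 3 : ℝ) := by
        have h3 : 2 * (t - s) ≤ Y := by
          rw [abs_sub_comm] at h1
          linarith [le_abs_self (t - s)]
        have := mul_le_mul_of_nonneg_right h3 (show (0 : ℝ) ≤ (n : ℝ) ^ (2 / 3 : ℝ) by positivity)
        unfold abscissa
        linarith
      calc abscissa n t * m ≤ (abscissa n s + Y * (n : ℝ) ^ (2 / 3 : ℝ)) * m := by gcongr
        _ = _ := by ring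
    · rwa [sub_div]
  refine measure_le_of_eventually_mem hsub ?_
  filter_upwards [hn, eventually_gt_atTop 0] with m hm hm0
  obtain ⟨X, hX, hle⟩ := hm
  refine measure_gridPassage_le hN hm0 (X := X)
    (D := fun f => Oscillates f (column a n m) (column b n m) (window Y n m) m
        (3 * (η / 6 * (n : ℝ) ^ (1 / 3 : ℝ)))) ?_ hle
  rintro f g hfg ⟨k, k', h1, h2, h3, h4, h5⟩
  refine ⟨k, k', h1, h2, h3, h4, ?_⟩
  rwa [← hfg k (by omega), ← hfg k' (by omega)]

theorem exists_profile_abs_gt_le (a : ℝ) {ε : ℝ} (hε : 0 < ε) :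
    ∃ M, ∀ᶠ n : ℕ in atTop, P {ω | M < |(N ω).profile n a|} ≤ ENNReal.ofReal ε := by
  obtain ⟨M₁, h₁⟩ := exists_bulk_lt_le a (half_pos hε)
  obtain ⟨M₂, h₂⟩ := exists_bulk_ge_le a (half_pos hε)
  refine ⟨max M₁ M₂ + a ^ 2, ?_⟩
  filter_upwards [h₁, h₂, eventually_abscissa_nonneg a, eventually_scale_pos] with n h₁ h₂ hpos hsc
  refine measure_le_of_eventually_mem (F := fun m =>
    {ω | ((N ω).gridPassage n m (column a n m) : ℝ) < lppLevel n a (-M₁)} ∪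
      {ω | lppLevel n a M₂ ≤ (N ω).gridPassage n m (column a n m)}) ?_ ?_
  · intro ω hω
    have hlim := tendsto_gridPassage (N ω) hpos n
    have hω : max M₁ M₂ + a ^ 2 < |(N ω).profile n a| := hω
    rw [profile_eq _ hsc] at hω
    have h3 := abs_add_le (((N ω).lastPassage 0 0 (abscissa n a) n - abscissa n a - n) /
      (n : ℝ) ^ (1 / 3 : ℝ)) (a ^ 2)
    rw [abs_of_nonneg (sq_nonneg a)] at h3
    have h4 : max M₁ M₂ < |((N ω).lastPassage 0 0 (abscissa n a) n - abscissa n a - n) /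
      (n : ℝ) ^ (1 / 3 : ℝ)| := by linarith
    rw [lt_abs] at h4
    rcases h4 with h4 | h4
    · have h5 := (le_max_right M₁ M₂).trans_lt h4
      rw [lt_div_iff₀ hsc] at h5
      have h6 : lppLevel n a M₂ < (N ω).lastPassage 0 0 (abscissa n a) n := by
        unfold lppLevel
        unfold abscissa at h5 ⊢
        linarith
      filter_upwards [hlim.eventually_const_lt h6] with m hm
      exact Or.inr hm.le
    · have h5 := (le_max_left M₁ M₂).trans_lt h4
      rw [← neg_div, lt_div_iff₀ hsc] at h5
      have h6 : ((N ω).lastPassage 0 0 (abscissa n a) n : ℝ) < lppLevel n a (-M₁) := by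
        unfold lppLevel
        unfold abscissa at h5 ⊢
        linarith
      filter_upwards [hlim.eventually_lt_const h6] with m hm
      exact Or.inl hm
  · filter_upwards [h₁, h₂, eventually_gt_atTop 0] with m h₁ h₂ hm0
    rw [← add_halves ε, ENNReal.ofReal_add (half_pos hε).le (half_pos hε).le]
    refine (measure_union_le _ _).trans (add_le_add ?_ ?_)
    · refine measure_gridPassage_le hN hm0 (X := column a n m)
        (D := fun f => (f (column a n m) : ℝ) < lppLevel n a (-M₁)) ?_ h₁
      intro f g hfg h
      rwa [← hfg _ le_rfl]
    · refine measure_gridPassage_le hN hm0 (X := column a n m)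
        (D := fun f => lppLevel n a M₂ ≤ (f (column a n m) : ℝ)) ?_ (h₂ _ le_rfl)
      intro f g hfg h
      rwa [← hfg _ le_rfl]

end Profile

/-! ### Compact sets in the Skorokhod space -/

namespace Cadlag

variable {a b : ℝ}

theorem edist_le_of_timeChange {f g : Cadlag a b} (l : Icc a b ≃o Icc a b) {η : ℝ}
    (hl : ∀ u, dist (l u) u ≤ η) (hfg : ∀ u, dist (f u) (g (l u)) ≤ η) :
    edist f g ≤ ENNReal.ofReal η := by
  refine (iInf_le _ l).trans (max_le (iSup_le fun u => ?_) (iSup_le fun u => ?_))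
  · rw [edist_dist]
    exact ENNReal.ofReal_le_ofReal (hl u)
  · rw [edist_dist]
    exact ENNReal.ofReal_le_ofReal (hfg u)

theorem edist_le_of_forall_dist_le {f g : Cadlag a b} {η : ℝ} (hη : 0 ≤ η)
    (h : ∀ u, dist (f u) (g u) ≤ η) : edist f g ≤ ENNReal.ofReal η :=
  edist_le_of_timeChange (OrderIso.refl _) (fun u => by simpa using hη) h

theorem exists_timeChange_of_edist_lt {f g : Cadlag a b} {ε : ℝ}
    (h : edist f g < ENNReal.ofReal ε) :
    ∃ l : Icc a b ≃o Icc a b, (∀ u, dist (l u) u < ε) ∧ ∀ u, dist (f u) (g (l u)) < ε := by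
  obtain ⟨l, hl⟩ := iInf_lt_iff.1 (show (⨅ l, cost f g l) < ENNReal.ofReal ε from h)
  obtain ⟨h1, h2⟩ := max_lt_iff.1 hl
  refine ⟨l, fun u => ?_, fun u => ?_⟩
  · exact edist_lt_ofReal.1 ((le_iSup (fun t => edist (l t) t) u).trans_lt h1)
  · exact edist_lt_ofReal.1 ((le_iSup (fun t => edist (f t) (g (l t))) u).trans_lt h2)

/-- The functions that vary by at most `η` between points at distance less than `δ`. -/
def modulusSet (a b δ η : ℝ) : Set (Cadlag a b) :=
  {f | ∀ s t : Icc a b, dist s t < δ → dist (f s) (f t) ≤ η}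

theorem isClosed_modulusSet (δ η : ℝ) : IsClosed (modulusSet a b δ η) := by
  rw [← isOpen_compl_iff, EMetric.isOpen_iff]
  intro f hf
  simp only [modulusSet, mem_compl_iff, Set.mem_ofPred_eq, not_forall, not_le] at hf
  obtain ⟨s, t, hst, hd⟩ := hf
  have hε : 0 < min ((δ - dist s t) / 2) ((dist (f s) (f t) - η) / 2) :=
    lt_min (by linarith) (by linarith)
  refine ⟨ENNReal.ofReal _, ENNReal.ofReal_pos.2 hε, fun g hg hgU => ?_⟩
  rw [Metric.mem_eball, edist_comm] at hg
  obtain ⟨l, h1, h2⟩ := exists_timeChange_of_edist_lt hg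
  have h3 : dist (l s) (l t) < δ := by
    have := dist_triangle4 (l s) s t (l t)
    have e1 := (h1 s).trans_le (min_le_left _ _)
    have e2 := (h1 t).trans_le (min_le_left _ _)
    rw [dist_comm t] at this
    linarith
  have h4 := hgU _ _ h3
  have := dist_triangle4 (f s) (g (l s)) (g (l t)) (f t)
  have e1 := (h2 s).trans_le (min_le_right _ _)
  have e2 := (h2 t).trans_le (min_le_right _ _)
  rw [dist_comm (g (l t)) (f t)] at this
  linarith

/-- The functions bounded by `M`. -/
def boundedSet (a b M : ℝ) : Set (Cadlag a b) := {f | ∀ t : Icc a b, |f t| ≤ M}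

theorem isClosed_boundedSet (M : ℝ) : IsClosed (boundedSet a b M) := by
  rw [← isOpen_compl_iff, EMetric.isOpen_iff]
  intro f hf
  simp only [boundedSet, mem_compl_iff, Set.mem_ofPred_eq, not_forall, not_le] at hf
  obtain ⟨t, hd⟩ := hf
  refine ⟨ENNReal.ofReal (|f t| - M), ENNReal.ofReal_pos.2 (by linarith), fun g hg hgU => ?_⟩
  rw [Metric.mem_eball, edist_comm] at hg
  obtain ⟨l, -, h2⟩ := exists_timeChange_of_edist_lt hg
  have h3 := h2 t
  have h4 := hgU (l t)
  rw [Real.dist_eq] at h3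
  have := abs_sub_abs_le_abs_sub (f t) (g (l t))
  linarith

theorem dist_left_le_of_mem_modulusSet {f : Cadlag a b} {δ η : ℝ} (hδ : 0 < δ)
    (hf : f ∈ modulusSet a b δ η) (h : a ∈ Icc a b) (j : ℕ) (u : Icc a b)
    (hu : (u : ℝ) - a ≤ j * (δ / 2)) : dist (f u) (f ⟨a, h⟩) ≤ j * η := by
  induction j generalizing u with
  | zero =>
    have : u = ⟨a, h⟩ := Subtype.ext (le_antisymm (by simpa using hu) u.2.1)
    simp [this]
  | succ j ih =>
    let v : Icc a b := ⟨max a (u - δ / 2), le_max_left _ _,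
      max_le h.2 (by linarith [u.2.2])⟩
    have h1 : dist u v < δ := by
      rw [Subtype.dist_eq, Real.dist_eq, abs_lt]
      have e1 := le_max_right a (u - δ / 2 : ℝ)
      have e2 : max a (u - δ / 2 : ℝ) ≤ u := max_le u.2.1 (by linarith)
      constructor <;> simp only [v] <;> linarith
    have h2 : (v : ℝ) - a ≤ j * (δ / 2) := by
      rw [sub_le_iff_le_add]
      push_cast at hu
      refine max_le ?_ (by linarith)
      have : 0 ≤ (j : ℝ) * (δ / 2) := by positivity
      linarith
    have := dist_triangle (f u) (f v) (f ⟨a, h⟩)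
    push_cast
    linarith [hf u v h1, ih v h2]

theorem continuous_of_forall_modulus {g : Icc a b → ℝ} (h : ∀ η > 0, ∃ δ > 0, ∀ s t : Icc a b,
    dist s t < δ → dist (g s) (g t) ≤ η) : Continuous g := by
  refine Metric.continuous_iff.2 fun t ε hε => ?_
  obtain ⟨δ, hδ, hg⟩ := h (ε / 2) (half_pos hε)
  exact ⟨δ, hδ, fun s hs => (hg s t hs).trans_lt (half_lt_self hε)⟩

/-- A continuous function as an element of `D[a, b]`. -/
def ofContinuous (g : Icc a b → ℝ) (hg : Continuous g) : Cadlag a b where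
  toFun := g
  right_cont _ := hg.continuousWithinAt
  left_lim t := ⟨g t, hg.continuousWithinAt⟩

/-- An analogue of the Arzelà–Ascoli theorem: closed sets of functions that are asymptotically
equicontinuous, up to compact sets, are compact. -/
theorem isCompact_of_modulus {M δ η : ℕ → ℝ} (hδ : ∀ k, 0 < δ k) (hη0 : ∀ k, 0 < η k)
    (hη : Tendsto η atTop (𝓝 0)) {G : ℕ → Set (Cadlag a b)} (hG : ∀ k, IsCompact (G k))
    {K : Set (Cadlag a b)} (hK : IsClosed K)
    (hKG : ∀ k, K ⊆ boundedSet a b (M k) ∩ modulusSet a b (δ k) (η k) ∪ G k) : IsCompact K := by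
  refine isCompact_iff_ultrafilter_le_nhds.2 fun F hF => ?_
  have hFK : K ∈ F := le_principal_iff.1 hF
  suffices h : ∃ x, (F : Filter (Cadlag a b)) ≤ 𝓝 x by
    obtain ⟨x, hx⟩ := h
    exact ⟨x, hK.mem_of_tendsto hx hFK, hx⟩
  -- An ultrafilter containing no `G k` contains every bounded modulus set. Pointwise limits along
  -- it then exist and inherit all the moduli, so the limit is continuous.
  by_cases hex : ∃ k, G k ∈ F
  · obtain ⟨k, hk⟩ := hex
    obtain ⟨x, -, hx⟩ := isCompact_iff_ultrafilter_le_nhds.1 (hG k) F (le_principal_iff.2 hk)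
    exact ⟨x, hx⟩
  have hF' : ∀ k, boundedSet a b (M k) ∩ modulusSet a b (δ k) (η k) ∈ F := fun k =>
    (Ultrafilter.union_mem_iff.1 (mem_of_superset hFK (hKG k))).resolve_right
      fun h => hex ⟨k, h⟩
  have hlim : ∀ t : Icc a b, ∃ y, Tendsto (fun f : Cadlag a b => f t) F (𝓝 y) := by
    intro t
    have hmem : (F.map fun f : Cadlag a b => f t : Filter ℝ) ≤ 𝓟 (Icc (-M 0) (M 0)) := by
      refine le_principal_iff.2 (Ultrafilter.mem_map.2 (mem_of_superset (hF' 0) fun f hf => ?_))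
      exact abs_le.1 (hf.1 t)
    obtain ⟨y, -, hy⟩ := isCompact_iff_ultrafilter_le_nhds.1 isCompact_Icc
      (F.map fun f : Cadlag a b => f t) hmem
    exact ⟨y, hy⟩
  choose g hg using hlim
  have hmod : ∀ k, ∀ s t : Icc a b, dist s t < δ k → dist (g s) (g t) ≤ η k := fun k s t hst =>
    le_of_tendsto ((hg s).dist (hg t)) (mem_of_superset (hF' k) fun f hf => hf.2 s t hst)
  have hsmall : ∀ ε > 0, ∃ k, η k < ε := fun ε hε => (hη.eventually_lt_const hε).exists
  have hcont : Continuous g := continuous_of_forall_modulus fun ε hε => by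
    obtain ⟨k, hk⟩ := hsmall ε hε
    exact ⟨δ k, hδ k, fun s t hst => (hmod k s t hst).trans hk.le⟩
  refine ⟨ofContinuous g hcont, ?_⟩
  refine Metric.nhds_basis_eball.ge_iff.2 fun ε hε => ?_
  obtain ⟨ε', hε', hlt⟩ : ∃ ε' : ℝ, 0 < ε' ∧ ENNReal.ofReal ε' < ε := by
    obtain ⟨c, hc, hcε⟩ := ENNReal.lt_iff_exists_nnreal_btwn.1 hε
    exact ⟨c, by exact_mod_cast hc, by simpa using hcε⟩
  obtain ⟨k, hk⟩ := hsmall (ε' / 3) (by positivity)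
  -- Convergence on a finite net and the common modulus give uniform closeness, which bounds the
  -- Skorokhod distance with the trivial time change.
  obtain ⟨T, -, hT, hcov⟩ := finite_cover_balls_of_compact (isCompact_univ (X := Icc a b)) (hδ k)
  have hnet : ∀ᶠ f : Cadlag a b in F, ∀ t ∈ T, dist (f t) (g t) ≤ η k :=
    (eventually_all_finite hT).2 fun t _ =>
      ((tendsto_iff_dist_tendsto_zero.1 (hg t)).eventually_lt_const (hη0 k)).mono fun _ h => h.le
  filter_upwards [hnet, hF' k] with f hfT hf
  refine (edist_le_of_forall_dist_le hε'.le fun u => ?_).trans_lt hlt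
  obtain ⟨t, ht, hut⟩ := mem_iUnion₂.1 (hcov (mem_univ u))
  have hut : dist u t < δ k := hut
  have e1 := hf.2 u t hut
  have e2 := hmod k t u (by rwa [dist_comm])
  have := dist_triangle4 (f u) (f t) (g t) (g u)
  have e3 := hfT t ht
  change dist (f u) (g u) ≤ ε'
  linarith

end Cadlag

/-! ### Functions with finitely many jumps -/

/-- The indices of the points `t i` to the left of `u`. -/
noncomputable def passed {r : ℕ} (t : Fin r → ℝ) (u : ℝ) : Finset (Fin r) :=
  Finset.univ.filter fun i => t i ≤ u

theorem mem_passed {r : ℕ} {t : Fin r → ℝ} {u : ℝ} {i : Fin r} : i ∈ passed t u ↔ t i ≤ u := by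
  simp [passed]

theorem passed_eq_iff {r : ℕ} {s t : Fin r → ℝ} {u v : ℝ} :
    passed s u = passed t v ↔ ∀ i, s i ≤ u ↔ t i ≤ v := by
  simp only [Finset.ext_iff, mem_passed]

/-- The points `t i` of `(a, b]` are at distance at least `γ` from each other, from `a`, and, unless
they are equal to it, from `b`. -/
def JumpsApart (a b γ : ℝ) {r : ℕ} (t : Fin r → ℝ) : Prop :=
  (∀ i j, i ≠ j → γ ≤ |t i - t j|) ∧ ∀ i, a + γ ≤ t i ∧ (t i ≤ b - γ ∨ t i = b)

theorem isCompact_jumpsApart {a b γ : ℝ} (hγ : 0 < γ) (r : ℕ) :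
    IsCompact {t : Fin r → ℝ | JumpsApart a b γ t} := by
  refine (isCompact_univ_pi fun _ : Fin r => isCompact_Icc (a := a) (b := b)).of_isClosed_subset
    ?_ ?_
  · simp only [JumpsApart, Set.ofPred_and, Set.ofPred_or, Set.ofPred_forall]
    refine IsClosed.inter (isClosed_iInter fun i => isClosed_iInter fun j => isClosed_iInter
      fun _ => isClosed_le (by fun_prop) (by fun_prop)) (isClosed_iInter fun i => ?_)
    exact (isClosed_le (by fun_prop) (by fun_prop)).inter
      ((isClosed_le (by fun_prop) (by fun_prop)).union (isClosed_eq (by fun_prop) (by fun_prop)))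
  · intro t ht i _
    obtain ⟨h1, h2⟩ := ht.2 i
    exact ⟨by linarith, by rcases h2 with h2 | h2 <;> linarith⟩

theorem exists_jumpsApart {a b : ℝ} {r : ℕ} {t : Fin r → ℝ} (ht : Function.Injective t)
    (hmem : ∀ i, t i ∈ Ioc a b) : ∀ᶠ q : ℕ in atTop, JumpsApart a b (1 / ((q : ℝ) + 1)) t := by
  have hlim : ∀ c : ℝ, 0 < c → ∀ᶠ q : ℕ in atTop, 1 / ((q : ℝ) + 1) ≤ c := fun c hc =>
    (tendsto_one_div_add_atTop_nhds_zero_nat.eventually_lt_const hc).mono fun _ h => h.le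
  refine Eventually.and (eventually_all.2 fun i => eventually_all.2 fun j => ?_)
    (eventually_all.2 fun i => ?_)
  · by_cases hij : i = j
    · exact Eventually.of_forall fun q h => absurd hij h
    · exact (hlim _ (abs_pos.2 (sub_ne_zero.2 (ht.ne hij)))).mono fun q h _ => h
  · refine ((hlim (t i - a) (by linarith [(hmem i).1])).mono fun q h => by linarith).and ?_
    rcases (hmem i).2.lt_or_eq with h | h
    · exact (hlim (b - t i) (by linarith)).mono fun q h => Or.inl (by linarith)
    · exact Eventually.of_forall fun q => Or.inr h

/-- The time change adds to the identity a tent of half-width `γ` and height `s i - t i` at each `t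
i`. Separation keeps the other `t j` off the tent. The perturbation has Lipschitz constant less than
one, so strict monotonicity survives. The endpoint `b` stays fixed because a jump located there is
not moved. -/
theorem exists_timeChange {a b γ : ℝ} (hab : a ≤ b) (hγ : 0 < γ) {r : ℕ} {t s : Fin r → ℝ}
    (ht : JumpsApart a b γ t) (hs : ∀ i, t i = b → s i = b) (hsum : ∑ i, |s i - t i| < γ) :
    ∃ l : Icc a b ≃o Icc a b, (∀ i (u : Icc a b), s i ≤ l u ↔ t i ≤ u) ∧
      ∀ u, dist (l u) u ≤ ∑ i, |s i - t i| := by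
  set tent : Fin r → ℝ → ℝ := fun i u => max (1 - |u - t i| / γ) 0 with htent
  set Λ : ℝ → ℝ := fun u => u + ∑ i, (s i - t i) * tent i u with hΛ
  have htent0 : ∀ i u, 0 ≤ tent i u := fun i u => le_max_right _ _
  have htent1 : ∀ i u, tent i u ≤ 1 := fun i u => by
    have : 0 ≤ |u - t i| / γ := by positivity
    exact max_le (by linarith) zero_le_one
  have htent_zero : ∀ i u, γ ≤ |u - t i| → tent i u = 0 := fun i u h =>
    max_eq_right (by linarith [(one_le_div hγ).2 h])
  have htent_self : ∀ i, tent i (t i) = 1 := fun i => by simp [tent]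
  have hlip : ∀ i u v, |tent i u - tent i v| ≤ |u - v| / γ := by
    intro i u v
    refine (abs_max_sub_max_le_abs _ _ _).trans ?_
    have e : 1 - |u - t i| / γ - (1 - |v - t i| / γ) = (|v - t i| - |u - t i|) / γ := by ring
    rw [e, abs_div, abs_of_pos hγ]
    refine div_le_div_of_nonneg_right ?_ hγ.le
    refine (abs_abs_sub_abs_le (v - t i) (u - t i)).trans ?_
    rw [sub_sub_sub_cancel_right, abs_sub_comm]
  have hmono : StrictMono Λ := by
    intro v u hvu
    have h1 : |∑ i, (s i - t i) * (tent i v - tent i u)| ≤ (∑ i, |s i - t i|) * ((u - v) / γ) := by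
      rw [Finset.sum_mul]
      refine (Finset.abs_sum_le_sum_abs _ _).trans (Finset.sum_le_sum fun i _ => ?_)
      rw [abs_mul]
      gcongr
      refine (hlip i v u).trans ?_
      rw [abs_sub_comm, abs_of_pos (by linarith)]
    have h2 : (∑ i, |s i - t i|) * ((u - v) / γ) < u - v := by
      rw [mul_div_assoc', div_lt_iff₀ hγ, mul_comm (u - v)]
      exact mul_lt_mul_of_pos_right hsum (by linarith)
    have h3 : Λ v - Λ u = (v - u) + ∑ i, (s i - t i) * (tent i v - tent i u) := by
      simp only [hΛ, mul_sub, Finset.sum_sub_distrib]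
      ring
    linarith [le_abs_self (∑ i, (s i - t i) * (tent i v - tent i u))]
  have ha : Λ a = a := by
    simp only [hΛ]
    rw [Finset.sum_eq_zero, add_zero]
    intro i _
    rw [htent_zero i a, mul_zero]
    rw [abs_sub_comm]
    exact (by linarith [(ht.2 i).1] : γ ≤ t i - a).trans (le_abs_self _)
  have hb : Λ b = b := by
    simp only [hΛ]
    rw [Finset.sum_eq_zero, add_zero]
    intro i _
    rcases (ht.2 i).2 with h | h
    · rw [htent_zero i b ((by linarith : γ ≤ b - t i).trans (le_abs_self _)), mul_zero]
    · rw [hs i h, h, sub_self, zero_mul]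
  have hΛt : ∀ i, Λ (t i) = s i := by
    intro i
    simp only [hΛ]
    rw [Finset.sum_eq_single i, htent_self]
    · ring
    · intro j _ hji
      rw [htent_zero j _ (ht.1 i j hji.symm), mul_zero]
    · simp
  have hcont : Continuous Λ := by
    simp only [hΛ, htent]
    fun_prop
  let l₀ : Icc a b → Icc a b := fun u => ⟨Λ u, ha.symm.le.trans (hmono.monotone u.2.1),
    (hmono.monotone u.2.2).trans hb.le⟩
  have hl₀ : StrictMono l₀ := fun u v huv => hmono huv
  have hsurj : Function.Surjective l₀ := by
    intro v
    have hv : (v : ℝ) ∈ Icc (Λ a) (Λ b) := by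
      rw [ha, hb]
      exact v.2
    obtain ⟨u, hu, huv⟩ := intermediate_value_Icc hab hcont.continuousOn hv
    exact ⟨⟨u, hu⟩, Subtype.ext huv⟩
  refine ⟨hl₀.orderIsoOfSurjective l₀ hsurj, fun i u => ?_, fun u => ?_⟩
  · rw [← hΛt i]
    exact hmono.le_iff_le
  · change dist (Λ u) u ≤ _
    rw [Real.dist_eq, hΛ]
    simp only [add_sub_cancel_left]
    refine (Finset.abs_sum_le_sum_abs _ _).trans (Finset.sum_le_sum fun i _ => ?_)
    rw [abs_mul, abs_of_nonneg (htent0 i u)]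
    exact mul_le_of_le_one_right (abs_nonneg _) (htent1 i u)

theorem exists_uniform_modulus {a b : ℝ} {h : ℝ → ℝ} (hh : Continuous h) {ε : ℝ} (hε : 0 < ε) :
    ∃ ρ > 0, ∀ u v : Icc a b, dist u v < ρ → dist (h u) (h v) ≤ ε := by
  obtain ⟨ρ, hρ, H⟩ := Metric.uniformContinuous_iff.1
    (CompactSpace.uniformContinuous_of_continuous (hh.comp continuous_subtype_val)
      (α := Icc a b)) ε hε
  exact ⟨ρ, hρ, fun u v huv => (H huv).le⟩

namespace Cadlag

variable {a b : ℝ}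

/-- The sum of the continuous function `h` and a function that changes only at the points `t i`. -/
noncomputable def jumpFun (a b : ℝ) {h : ℝ → ℝ} (hh : Continuous h) {r : ℕ} (t : Fin r → ℝ)
    (c : Finset (Fin r) → ℝ) : Cadlag a b where
  toFun u := h u + c (passed t u)
  right_cont u := by
    refine (hh.comp continuous_subtype_val).continuousWithinAt.add
      (tendsto_const_nhds.congr' (f₁ := fun _ => c (passed t u)) ?_)
    have : ∀ᶠ v : Icc a b in 𝓝[≥] u, ∀ i, t i ≤ u ↔ t i ≤ v := by
      refine eventually_all.2 fun i => ?_
      rcases le_or_gt (t i) u with hi | hi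
      · filter_upwards [self_mem_nhdsWithin] with v hv
        exact iff_of_true hi (hi.trans hv)
      · filter_upwards [nhdsWithin_le_nhds
          ((continuous_subtype_val.tendsto u).eventually_lt_const hi)] with v hv
        exact iff_of_false hi.not_ge (not_le.2 hv)
    filter_upwards [this] with v hv
    rw [passed_eq_iff.2 hv]
  left_lim u := by
    classical
    refine ⟨h u + c (Finset.univ.filter fun i => t i < u),
      (hh.comp continuous_subtype_val).continuousWithinAt.tendsto.add
      (tendsto_const_nhds.congr' ?_)⟩
    have : ∀ᶠ v : Icc a b in 𝓝[<] u, ∀ i, t i < u ↔ t i ≤ v := by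
      refine eventually_all.2 fun i => ?_
      rcases lt_or_ge (t i) u with hi | hi
      · filter_upwards [nhdsWithin_le_nhds
          ((continuous_subtype_val.tendsto u).eventually_const_lt hi)] with v hv
        exact iff_of_true hi (le_of_lt hv)
      · filter_upwards [self_mem_nhdsWithin] with v hv
        exact iff_of_false hi.not_gt (not_le.2 (lt_of_lt_of_le (show (v : ℝ) < u from hv) hi))
    filter_upwards [this] with v hv
    congr 1
    ext i
    simp [mem_passed, hv i]

theorem edist_jumpFun_left {h : ℝ → ℝ} (hh : Continuous h) {r : ℕ} (t : Fin r → ℝ)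
    (c c' : Finset (Fin r) → ℝ) :
    edist (jumpFun a b hh t c) (jumpFun a b hh t c') ≤ edist c c' := by
  rw [edist_dist c]
  refine edist_le_of_forall_dist_le dist_nonneg fun u => ?_
  change dist (h u + c (passed t u)) (h u + c' (passed t u)) ≤ _
  rw [dist_add_left]
  exact dist_le_pi_dist c c' _

/-- A small shift of the jump times is undone by a time change, at the price of the modulus of `h`;
a change of the values costs its sup norm. -/
theorem continuousOn_jumpFun (hab : a ≤ b) {h : ℝ → ℝ} (hh : Continuous h) {γ : ℝ} (hγ : 0 < γ)
    (r : ℕ) : ContinuousOn (fun p : (Fin r → ℝ) × (Finset (Fin r) → ℝ) => jumpFun a b hh p.1 p.2)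
      ({t | JumpsApart a b γ t} ×ˢ univ) := by
  intro p hp
  refine EMetric.tendsto_nhds.2 fun ε hε => ?_
  obtain ⟨ε', hε', hlt⟩ : ∃ ε' : ℝ, 0 < ε' ∧ ENNReal.ofReal ε' < ε := by
    obtain ⟨c, hc, hcε⟩ := ENNReal.lt_iff_exists_nnreal_btwn.1 hε
    exact ⟨c, by exact_mod_cast hc, by simpa using hcε⟩
  obtain ⟨ρ, hρ, hmod⟩ := exists_uniform_modulus (a := a) (b := b) hh (half_pos hε')
  have h1 : ∀ᶠ q : (Fin r → ℝ) × (Finset (Fin r) → ℝ) in 𝓝 p,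
      ∑ i, |q.1 i - p.1 i| < min γ (min ρ (ε' / 2)) := by
    have : Continuous fun q : (Fin r → ℝ) × (Finset (Fin r) → ℝ) => ∑ i, |q.1 i - p.1 i| := by
      fun_prop
    refine (this.tendsto p).eventually_lt_const ?_
    simpa using ⟨hγ, hρ, hε'⟩
  have h2 : ∀ᶠ q : (Fin r → ℝ) × (Finset (Fin r) → ℝ) in 𝓝 p, dist q.2 p.2 < ε' / 2 := by
    have : Continuous fun q : (Fin r → ℝ) × (Finset (Fin r) → ℝ) => dist q.2 p.2 := by fun_prop
    refine (this.tendsto p).eventually_lt_const ?_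
    simpa using hε'
  filter_upwards [nhdsWithin_le_nhds h1, nhdsWithin_le_nhds h2, self_mem_nhdsWithin]
    with q hq1 hq2 hq
  obtain ⟨e1, e2⟩ := lt_min_iff.1 hq1
  obtain ⟨e2, e3⟩ := lt_min_iff.1 e2
  -- A jump of the nearby function that corresponds to a jump at `b` is closer than `γ` to `b`, so
  -- the separation condition forces it to be at `b`.
  obtain ⟨l, hl1, hl2⟩ := exists_timeChange hab hγ hp.1 (s := q.1) (fun i hi => by
    refine ((hq.1.2 i).2.resolve_left fun hle => ?_)
    have := (Finset.single_le_sum (f := fun i => |q.1 i - p.1 i|) (fun i _ => abs_nonneg _)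
      (Finset.mem_univ i)).trans_lt e1
    rw [hi, abs_lt] at this
    linarith) e1
  have f1 : edist (jumpFun a b hh q.1 q.2) (jumpFun a b hh q.1 p.2) ≤ ENNReal.ofReal (ε' / 2) := by
    refine (edist_jumpFun_left hh _ _ _).trans ?_
    rw [edist_dist]
    exact ENNReal.ofReal_le_ofReal hq2.le
  have f2 : edist (jumpFun a b hh p.1 p.2) (jumpFun a b hh q.1 p.2) ≤ ENNReal.ofReal (ε' / 2) := by
    refine edist_le_of_timeChange l (fun u => (hl2 u).trans e3.le) fun u => ?_
    change dist (h u + p.2 (passed p.1 u)) (h (l u) + p.2 (passed q.1 (l u))) ≤ _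
    rw [passed_eq_iff.2 fun i => hl1 i u, dist_add_right, dist_comm]
    exact hmod _ _ ((hl2 u).trans_lt e2)
  refine lt_of_le_of_lt ((edist_triangle _ (jumpFun a b hh q.1 p.2) _).trans ?_) hlt
  rw [edist_comm (jumpFun a b hh q.1 p.2), ← add_halves ε',
    ENNReal.ofReal_add (by positivity) (by positivity)]
  exact add_le_add f1 f2

/-- The functions with `r` jumps, at distance at least `γ`, and sums of jumps bounded by `R`. -/
def jumpSet (a b : ℝ) {h : ℝ → ℝ} (hh : Continuous h) (r : ℕ) (γ R : ℝ) : Set (Cadlag a b) :=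
  (fun p : (Fin r → ℝ) × (Finset (Fin r) → ℝ) => jumpFun a b hh p.1 p.2) ''
    ({t | JumpsApart a b γ t} ×ˢ univ.pi fun _ => Icc (-R) R)

theorem isCompact_jumpSet (hab : a ≤ b) {h : ℝ → ℝ} (hh : Continuous h) (r : ℕ) {γ : ℝ}
    (hγ : 0 < γ) (R : ℝ) : IsCompact (jumpSet a b hh r γ R) :=
  ((isCompact_jumpsApart hγ r).prod (isCompact_univ_pi fun _ => isCompact_Icc)).image_of_continuousOn
    ((continuousOn_jumpFun hab hh hγ r).mono (prod_mono_right (subset_univ _)))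

end Cadlag

/-- Tightness of a single law without completeness of the space: the values lie in a countable union
of compact sets. Closures are taken because compact sets need not be closed in a pseudometric space.
-/
theorem exists_isCompact_measure_le {Ω X : Type*} [MeasurableSpace Ω] {P : Measure Ω}
    [IsFiniteMeasure P] [TopologicalSpace X] [R1Space X] [MeasurableSpace X]
    [OpensMeasurableSpace X] {A : Ω → X} (hA : Measurable A) {K : ℕ → Set X}
    (hK : ∀ q, IsCompact (K q)) (hcov : ∀ ω, ∃ q, A ω ∈ K q) {ε : ENNReal} (hε : 0 < ε) :
    ∃ G, IsCompact G ∧ IsClosed G ∧ P {ω | A ω ∉ G} ≤ ε := by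
  have hcomp : ∀ q, IsCompact (⋃ p ≤ q, closure (K p)) := fun q =>
    (finite_le_nat q).isCompact_biUnion fun p _ => (hK p).closure
  have hclosed : ∀ q, IsClosed (⋃ p ≤ q, closure (K p)) := fun q =>
    (finite_le_nat q).isClosed_biUnion fun p _ => isClosed_closure
  have hanti : Antitone fun q => {ω | A ω ∉ ⋃ p ≤ q, closure (K p)} := by
    intro q q' hqq' ω hω h
    exact hω (biUnion_subset_biUnion_left (fun p hp => le_trans hp hqq') h)
  have hlim := tendsto_measure_iInter_atTop (μ := P)
    (fun q => (hA (hclosed q).measurableSet.compl).nullMeasurableSet) hanti ⟨0, measure_ne_top _ _⟩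
  have hempty : ⋂ q, {ω | A ω ∉ ⋃ p ≤ q, closure (K p)} = ∅ := by
    refine eq_empty_of_forall_notMem fun ω hω => ?_
    obtain ⟨q, hq⟩ := hcov ω
    exact mem_iInter.1 hω q (mem_iUnion₂.2 ⟨q, le_rfl, subset_closure hq⟩)
  change Tendsto _ _ (𝓝 (P (⋂ q, {ω | A ω ∉ ⋃ p ≤ q, closure (K p)}))) at hlim
  rw [hempty, measure_empty] at hlim
  obtain ⟨q, hq⟩ := (hlim.eventually_lt_const hε).exists
  exact ⟨_, hcomp q, hclosed q, hq.le⟩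

/-! ### The jumps of the profiles -/

theorem PointConfig.exists_jumps (S : PointConfig) {n : ℕ} (hn : 1 ≤ n) (a b : ℝ) :
    ∃ r, ∃ t : Fin r → ℝ, Function.Injective t ∧ (∀ i, t i ∈ Ioc a b) ∧
      ∀ u ∈ Icc a b, ∀ v ∈ Icc a b, (∀ i, t i ≤ u ↔ t i ≤ v) →
        S.lastPassage 0 0 (abscissa n u) n = S.lastPassage 0 0 (abscissa n v) n := by
  have hc : (0 : ℝ) < (n : ℝ) ^ (2 / 3 : ℝ) := by
    have : (0 : ℝ) < n := by exact_mod_cast hn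
    positivity
  have hinv : ∀ x : ℝ, abscissa n ((x - n) / (2 * (n : ℝ) ^ (2 / 3 : ℝ))) = x := fun x => by
    unfold abscissa
    field_simp
    ring
  have hstrict : StrictMono (abscissa n) := fun u v huv => by
    unfold abscissa
    gcongr
  have hfin : ((fun p : ℝ × ℝ => (p.1 - n) / (2 * (n : ℝ) ^ (2 / 3 : ℝ))) ''
      (S.points ∩ Ioc 0 (abscissa n b) ×ˢ Ioc 0 (n : ℝ)) ∩ Ioc a b).Finite :=
    ((S.finite_rect _ _ _ _).image _).inter_of_left _
  obtain ⟨r, t, ht, hrange⟩ := hfin.fin_param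
  refine ⟨r, t, ht, fun i => ?_, ?_⟩
  · have : t i ∈ range t := mem_range_self i
    rw [hrange] at this
    exact this.2
  intro u hu v hv huv
  wlog hle : u ≤ v generalizing u v
  · exact (this v hv u hu (fun i => (huv i).symm) (le_of_not_ge hle)).symm
  refine le_antisymm (S.lastPassage_mono 0 0 n (abscissa_mono n hle)) ?_
  refine csSup_le_csSup (S.bddAbove_path _ _ _ _) ⟨0, ?_⟩ ?_
  · exact ⟨fun i => i.elim0, fun i => i.elim0, fun i => i.elim0, fun i => i.elim0⟩
  · rintro k ⟨p, h1, h2, h3⟩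
    refine ⟨p, h1, h2, fun i => ⟨(h3 i).1, ⟨(h3 i).2.1.1, ?_⟩, (h3 i).2.2⟩⟩
    by_contra! hlt
    set z := ((p i).1 - n) / (2 * (n : ℝ) ^ (2 / 3 : ℝ)) with hz
    have hzx : abscissa n z = (p i).1 := hinv _
    have huz : u < z := by rwa [← hstrict.lt_iff_lt, hzx]
    have hzv : z ≤ v := by
      rw [← hstrict.le_iff_le, hzx]
      exact (h3 i).2.1.2
    have hmem : z ∈ range t := by
      rw [hrange]
      exact ⟨⟨p i, ⟨(h3 i).1, ⟨(h3 i).2.1.1, (h3 i).2.1.2.trans (abscissa_mono n hv.2)⟩,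
        (h3 i).2.2⟩, rfl⟩, hu.1.trans_lt huz, hzv.trans hv.2⟩
    obtain ⟨j, hj⟩ := hmem
    exact absurd ((huv j).2 (hj ▸ hzv)) (by rw [hj]; exact huz.not_ge)

/-- The continuous part of the profile. -/
noncomputable def drift (n : ℕ) (u : ℝ) : ℝ :=
  u ^ 2 - (abscissa n u + n) / (n : ℝ) ^ (1 / 3 : ℝ)

theorem continuous_drift (n : ℕ) : Continuous (drift n) := by
  unfold drift abscissa
  fun_prop

theorem profile_eq_drift (S : PointConfig) {n : ℕ} (hn : 1 ≤ n) (u : ℝ) :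
    S.profile n u = drift n u + S.lastPassage 0 0 (abscissa n u) n / (n : ℝ) ^ (1 / 3 : ℝ) := by
  have : (0 : ℝ) < n := by exact_mod_cast hn
  rw [profile_eq S (by positivity), drift]
  ring

theorem PointConfig.exists_mem_jumpSet (S : PointConfig) {n : ℕ} (hn : 1 ≤ n) (a b : ℝ) :
    ∃ r q : ℕ, S.cadlagProfile a b n ∈
      Cadlag.jumpSet a b (continuous_drift n) r (1 / ((q : ℝ) + 1)) q := by
  obtain ⟨r, t, ht, hmem, hL⟩ := S.exists_jumps hn a b
  have hex : ∃ c : Finset (Fin r) → ℝ, ∀ u : Icc a b, c (passed t u) =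
      S.lastPassage 0 0 (abscissa n u) n / (n : ℝ) ^ (1 / 3 : ℝ) := by
    classical
    -- The last-passage time depends on `u` only through the set of jumps already passed, so any
    -- representative gives its value; sets that never occur get `0`.
    refine ⟨fun A => if hA : ∃ u : Icc a b, passed t u = A then
      S.lastPassage 0 0 (abscissa n hA.choose) n / (n : ℝ) ^ (1 / 3 : ℝ) else 0, fun u => ?_⟩
    have hA : ∃ v : Icc a b, passed t v = passed t u := ⟨u, rfl⟩
    beta_reduce
    rw [dif_pos hA, hL _ hA.choose.2 _ u.2 (passed_eq_iff.1 hA.choose_spec)]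
  obtain ⟨c, hc⟩ := hex
  have hbound : ∀ᶠ q : ℕ in atTop, ∀ A, |c A| ≤ q :=
    eventually_all.2 fun A => tendsto_natCast_atTop_atTop.eventually_ge_atTop _
  obtain ⟨q, hq1, hq2⟩ := ((exists_jumpsApart ht hmem).and hbound).exists
  refine ⟨r, q, (t, c), ⟨hq1, fun A _ => abs_le.1 (hq2 A)⟩, ?_⟩
  have : ∀ f g : Cadlag a b, f.toFun = g.toFun → f = g := by
    rintro ⟨f, _, _⟩ ⟨g, _, _⟩ h
    cases h
    rfl
  refine this _ _ (funext fun u => ?_)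
  change drift n u + c (passed t u) = S.profile n u
  rw [hc, profile_eq_drift S hn]

/-- The points of mesh `(b - a) / m` in `[a, b]`. -/
noncomputable def gridPoint (a b : ℝ) (m k : ℕ) : ℝ := a + k * ((b - a) / m)

/-- The last of the points of the grid with indices in `A`. -/
noncomputable def lastGridPoint (a b : ℝ) (m : ℕ) (A : Finset (Fin (m + 1))) : ℝ :=
  (insert a (A.image fun k : Fin (m + 1) => gridPoint a b m k)).max' (Finset.insert_nonempty _ _)

theorem gridPoint_le_iff {a b : ℝ} (hab : a < b) {m : ℕ} (hm : 0 < m) {t : ℝ} {k : ℕ} :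
    gridPoint a b m ⌈(t - a) / ((b - a) / m)⌉₊ ≤ gridPoint a b m k ↔ t ≤ gridPoint a b m k := by
  have hd : 0 < (b - a) / m := div_pos (by linarith) (by exact_mod_cast hm)
  unfold gridPoint
  rw [add_le_add_iff_left, mul_le_mul_iff_left₀ hd, Nat.cast_le, Nat.ceil_le, div_le_iff₀ hd,
    sub_le_iff_le_add']

theorem le_gridPoint_ceil {a b : ℝ} (hab : a < b) {m : ℕ} (hm : 0 < m) (t : ℝ) :
    t ≤ gridPoint a b m ⌈(t - a) / ((b - a) / m)⌉₊ := (gridPoint_le_iff hab hm).1 le_rfl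

theorem gridPoint_last {a b : ℝ} {m : ℕ} (hm : 0 < m) : gridPoint a b m m = b := by
  have : (m : ℝ) ≠ 0 := by exact_mod_cast hm.ne'
  unfold gridPoint
  field_simp
  ring

theorem gridPoint_ceil_sub_le {a b : ℝ} (hab : a < b) {m : ℕ} (hm : 0 < m) {t : ℝ} (ht : a ≤ t) :
    gridPoint a b m ⌈(t - a) / ((b - a) / m)⌉₊ - t ≤ (b - a) / m := by
  have hd : 0 < (b - a) / m := div_pos (by linarith) (by exact_mod_cast hm)
  have h := (Nat.ceil_lt_add_one (show 0 ≤ (t - a) / ((b - a) / m) from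
    div_nonneg (by linarith) hd.le)).le
  have := mul_le_mul_of_nonneg_right h hd.le
  rw [add_mul, div_mul_cancel₀ _ hd.ne'] at this
  unfold gridPoint
  linarith

/-- The approximation of the profile that changes only at points of the grid. -/
noncomputable def PointConfig.gridProfile (S : PointConfig) (a b : ℝ) (n m : ℕ) : Cadlag a b :=
  Cadlag.jumpFun a b (continuous_drift n) (fun k : Fin (m + 1) => gridPoint a b m k) fun A =>
    S.lastPassage 0 0 (abscissa n (lastGridPoint a b m A)) n / (n : ℝ) ^ (1 / 3 : ℝ)

/-- A time change carries each jump to the next grid point. The last grid point before `l u` has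
then passed exactly the jumps passed by `u`, so the jump parts agree and only the drift contributes
an error. -/
theorem PointConfig.tendsto_gridProfile (S : PointConfig) {a b : ℝ} (hab : a < b) {n : ℕ}
    (hn : 1 ≤ n) : Tendsto (S.gridProfile a b n) atTop (𝓝 (S.cadlagProfile a b n)) := by
  refine EMetric.tendsto_nhds.2 fun ε hε => ?_
  obtain ⟨ε', hε', hlt⟩ : ∃ ε' : ℝ, 0 < ε' ∧ ENNReal.ofReal ε' < ε := by
    obtain ⟨c, hc, hcε⟩ := ENNReal.lt_iff_exists_nnreal_btwn.1 hε
    exact ⟨c, by exact_mod_cast hc, by simpa using hcε⟩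
  obtain ⟨ρ, hρ, hmod⟩ := exists_uniform_modulus (a := a) (b := b) (continuous_drift n) hε'
  obtain ⟨r, t, ht, hmem, hL⟩ := S.exists_jumps hn a b
  obtain ⟨q, hq⟩ := (exists_jumpsApart ht hmem).exists
  have hlim : Tendsto (fun m : ℕ => r * ((b - a) / m)) atTop (𝓝 0) := by
    simpa using (tendsto_const_div_atTop_nhds_zero_nat (b - a)).const_mul (r : ℝ)
  have hγ : (0 : ℝ) < 1 / ((q : ℝ) + 1) := by positivity
  filter_upwards [hlim.eventually_lt_const (lt_min hγ (lt_min hρ hε')), eventually_gt_atTop 0]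
    with m hm hm0
  set s : Fin r → ℝ := fun i => gridPoint a b m ⌈(t i - a) / ((b - a) / m)⌉₊ with hs
  have hceil : ∀ i, ⌈(t i - a) / ((b - a) / m)⌉₊ < m + 1 := by
    intro i
    have hm' : (0 : ℝ) < m := by exact_mod_cast hm0
    have hba : 0 < b - a := by linarith
    rw [Nat.lt_succ_iff, Nat.ceil_le, div_le_iff₀ (by positivity), mul_div_cancel₀ _ hm'.ne']
    linarith [(hmem i).2]
  have hsum : ∑ i, |s i - t i| ≤ r * ((b - a) / m) := by
    refine (Finset.sum_le_card_nsmul _ _ ((b - a) / m) fun i _ => ?_).trans (by simp)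
    rw [abs_of_nonneg (sub_nonneg.2 (le_gridPoint_ceil hab hm0 _))]
    exact gridPoint_ceil_sub_le hab hm0 (hmem i).1.le
  obtain ⟨e1, e2⟩ := lt_min_iff.1 (hsum.trans_lt hm)
  obtain ⟨e2, e3⟩ := lt_min_iff.1 e2
  have hsb : ∀ i, t i = b → s i = b := by
    intro i hi
    refine le_antisymm ?_ (hi.symm.le.trans (le_gridPoint_ceil hab hm0 _))
    have := (gridPoint_le_iff hab hm0 (t := t i) (k := m)).2
      (by rw [gridPoint_last hm0]; exact (hmem i).2)
    rwa [gridPoint_last hm0] at this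
  obtain ⟨l, hl1, hl2⟩ := exists_timeChange hab.le hγ hq hsb e1
  rw [edist_comm]
  refine lt_of_le_of_lt (Cadlag.edist_le_of_timeChange l (fun u => (hl2 u).trans e3.le)
    fun u => ?_) hlt
  set A := passed (fun k : Fin (m + 1) => gridPoint a b m k) (l u) with hA
  have hv := (insert a (A.image fun k : Fin (m + 1) => gridPoint a b m k)).max'_mem (Finset.insert_nonempty _ _)
  change lastGridPoint a b m A ∈ _ at hv
  have hvA : lastGridPoint a b m A = a ∨ ∃ k ∈ A, gridPoint a b m k = lastGridPoint a b m A := by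
    simpa using hv
  have hav : a ≤ lastGridPoint a b m A := Finset.le_max' _ _ (Finset.mem_insert_self _ _)
  have hvl : lastGridPoint a b m A ≤ l u := by
    rcases hvA with h | ⟨k, hk, h⟩
    · exact h.le.trans (l u).2.1
    · exact h ▸ mem_passed.1 hk
  have hval : S.lastPassage 0 0 (abscissa n u) n =
      S.lastPassage 0 0 (abscissa n (lastGridPoint a b m A)) n := by
    refine hL u u.2 _ ⟨hav, hvl.trans (l u).2.2⟩ fun i => ⟨fun hi => ?_, fun hi => ?_⟩
    · have hk : (⟨_, hceil i⟩ : Fin (m + 1)) ∈ A := mem_passed.2 ((hl1 i u).2 hi)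
      exact (le_gridPoint_ceil hab hm0 _).trans (Finset.le_max' _ _ (Finset.mem_insert_of_mem
        (Finset.mem_image_of_mem (fun k : Fin (m + 1) => gridPoint a b m k) hk)))
    · rcases hvA with h | ⟨k, hk, h⟩
      · exact absurd (hi.trans h.le) (not_le.2 (hmem i).1)
      · refine (hl1 i u).1 (((gridPoint_le_iff hab hm0 (k := k)).2 ?_).trans (mem_passed.1 hk))
        rwa [h]
  change dist (S.profile n u) (drift n (l u) +
    S.lastPassage 0 0 (abscissa n (lastGridPoint a b m A)) n / (n : ℝ) ^ (1 / 3 : ℝ)) ≤ ε'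
  rw [profile_eq_drift S hn, hval, dist_add_right, dist_comm]
  exact hmod _ _ ((hl2 u).trans_lt e2)

section Profile

variable {Ω : Type*} [MeasurableSpace Ω] {P : Measure Ω} {N : Ω → PointConfig}
  (hN : IsPoissonPointProcess P N volume)

include hN

/-- The grid approximation is a continuous function of finitely many last-passage times, hence
Borel, and pointwise limits in the Skorokhod topology stay Borel. -/
theorem measurable_cadlagProfile {a b : ℝ} (hab : a < b) {n : ℕ} (hn : 1 ≤ n) :
    Measurable fun ω => (N ω).cadlagProfile a b n := by
  refine measurable_of_tendsto_metrizable (f := fun m ω => (N ω).gridProfile a b n m) (fun m => ?_)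
    (tendsto_pi_nhds.2 fun ω => (N ω).tendsto_gridProfile hab hn)
  have hc : Continuous fun c : Finset (Fin (m + 1)) → ℝ =>
      Cadlag.jumpFun a b (continuous_drift n) (fun k : Fin (m + 1) => gridPoint a b m k) c := by
    refine LipschitzWith.continuous (K := 1) fun c c' => ?_
    simpa using Cadlag.edist_jumpFun_left (continuous_drift n) _ c c'
  exact hc.measurable.comp (measurable_pi_lambda _ fun A =>
    (measurable_lastPassage hN _ n).div_const _)

theorem exists_isCompact_profile [IsFiniteMeasure P] {a b : ℝ} (hab : a < b) {n : ℕ}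
    (hn : 1 ≤ n) {ε : ENNReal} (hε : 0 < ε) :
    ∃ G : Set (Cadlag a b), IsCompact G ∧ IsClosed G ∧
      P {ω | (N ω).cadlagProfile a b n ∉ G} ≤ ε := by
  refine exists_isCompact_measure_le (measurable_cadlagProfile hN hab hn) (K := fun p =>
    Cadlag.jumpSet a b (continuous_drift n) p.unpair.1 (1 / ((p.unpair.2 : ℝ) + 1)) p.unpair.2)
    (fun p => Cadlag.isCompact_jumpSet hab.le _ _ (by positivity) _) (fun ω => ?_) hε
  obtain ⟨r, q, h⟩ := (N ω).exists_mem_jumpSet hn a b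
  exact ⟨Nat.pair r q, by simpa using h⟩

end Profile

/-! ### Tightness -/

namespace Cadlag

theorem mem_boundedSet_of_modulus {a b : ℝ} (hab : a ≤ b) {δ η : ℝ} (hδ : 0 < δ)
    (M : ℝ) : ∃ R, ∀ f ∈ modulusSet a b δ η, |f ⟨a, left_mem_Icc.2 hab⟩| ≤ M →
      f ∈ boundedSet a b R := by
  obtain ⟨j, hj⟩ := exists_nat_ge ((b - a) / (δ / 2))
  rw [div_le_iff₀ (by positivity)] at hj
  refine ⟨j * η + M, fun f hf hM u => ?_⟩
  have h := dist_left_le_of_mem_modulusSet hδ hf (left_mem_Icc.2 hab) j u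
    (le_trans (by linarith [u.2.2]) hj)
  rw [Real.dist_eq] at h
  have := abs_sub_abs_le_abs_sub (f u) (f ⟨a, left_mem_Icc.2 hab⟩)
  linarith

end Cadlag

section Profile

variable {Ω : Type*} [MeasurableSpace Ω] {P : Measure Ω} [IsProbabilityMeasure P]
  {N : Ω → PointConfig} (hN : IsPoissonPointProcess P N volume)

include hN

theorem exists_modulusSet_compl_le {a b : ℝ} (hab : a < b) {η ε : ℝ} (hη : 0 < η) (hε : 0 < ε) :
    ∃ δ > 0, ∀ᶠ n : ℕ in atTop,
      P {ω | (N ω).cadlagProfile a b n ∉ Cadlag.modulusSet a b δ η} ≤ ENNReal.ofReal ε := by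
  obtain ⟨δ, hδ, h⟩ := exists_profile_oscillation_le hN hab.le hη hε
  refine ⟨δ, hδ, h.mono fun n hn => (measure_mono fun ω hω => ?_).trans hn⟩
  simp only [Cadlag.modulusSet, Set.mem_ofPred_eq, not_forall, not_le] at hω
  obtain ⟨s, t, hst, hd⟩ := hω
  exact ⟨s, s.2, t, t.2, hst, hd⟩

theorem exists_modulus_union_compact {a b : ℝ} (hab : a < b) {η ε : ℝ} (hη : 0 < η) (hε : 0 < ε) :
    ∃ M δ, 0 < δ ∧ ∃ G : Set (Cadlag a b), IsCompact G ∧ IsClosed G ∧ ∀ n : ℕ, 1 ≤ n →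
      P {ω | (N ω).cadlagProfile a b n ∉
        Cadlag.boundedSet a b M ∩ Cadlag.modulusSet a b δ η ∪ G} ≤ ENNReal.ofReal ε := by
  obtain ⟨δ, hδ, h₁⟩ := exists_modulusSet_compl_le hN hab hη (half_pos hε)
  obtain ⟨M, h₂⟩ := exists_profile_abs_gt_le hN a (half_pos hε)
  obtain ⟨R, hR⟩ := Cadlag.mem_boundedSet_of_modulus hab.le hδ M
  obtain ⟨n₀, hn₀⟩ := eventually_atTop.1 (h₁.and h₂)
  have hG : ∀ n : ℕ, ∃ G : Set (Cadlag a b), IsCompact G ∧ IsClosed G ∧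
      (1 ≤ n → P {ω | (N ω).cadlagProfile a b n ∉ G} ≤ ENNReal.ofReal ε) := by
    intro n
    by_cases hn : 1 ≤ n
    · obtain ⟨G, h1, h2, h3⟩ := exists_isCompact_profile hN hab hn (ENNReal.ofReal_pos.2 hε)
      exact ⟨G, h1, h2, fun _ => h3⟩
    · exact ⟨∅, isCompact_empty, isClosed_empty, fun h => absurd h hn⟩
  choose G hG1 hG2 hG3 using hG
  refine ⟨R, δ, hδ, ⋃ n < n₀, G n, (finite_lt_nat n₀).isCompact_biUnion fun n _ => hG1 n,
    (finite_lt_nat n₀).isClosed_biUnion fun n _ => hG2 n, fun n hn => ?_⟩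
  rcases lt_or_ge n n₀ with hlt | hge
  · refine (measure_mono fun ω hω => ?_).trans (hG3 n hn)
    exact fun h => hω (Or.inr (mem_iUnion₂.2 ⟨n, hlt, h⟩))
  · obtain ⟨e1, e2⟩ := hn₀ n hge
    rw [← add_halves ε, ENNReal.ofReal_add (half_pos hε).le (half_pos hε).le]
    refine (measure_mono fun ω hω => ?_).trans ((measure_union_le _ _).trans (add_le_add e1 e2))
    by_contra h
    simp only [mem_union, Set.mem_ofPred_eq, not_or, not_not, not_lt] at h
    exact hω (Or.inl ⟨hR _ h.1 h.2, h.1⟩)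

theorem isTightMeasureSet_profile {a b : ℝ} (hab : a < b) :
    IsTightMeasureSet {μ : Measure (Cadlag a b) |
      ∃ n : ℕ, 1 ≤ n ∧ μ = P.map (fun ω => (N ω).cadlagProfile a b n)} := by
  refine isTightMeasureSet_iff_exists_isCompact_measure_compl_le.2 fun ε hε => ?_
  -- The compact set is an intersection over the moduli `1 / (k + 1)`; the errors are summable so
  -- that the union of the exceptional events has measure at most `ε`.
  obtain ⟨ε', hε', hsum⟩ := ENNReal.exists_pos_sum_of_countable hε.ne' ℕ
  have hstep := fun k : ℕ => exists_modulus_union_compact hN hab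
    (show (0 : ℝ) < 1 / ((k : ℝ) + 1) by positivity) (show (0 : ℝ) < ε' k from hε' k)
  choose M δ hδ G hG1 hG2 hG3 using hstep
  have hclosed : ∀ k : ℕ, IsClosed (Cadlag.boundedSet a b (M k) ∩
      Cadlag.modulusSet a b (δ k) (1 / ((k : ℝ) + 1)) ∪ G k) := fun k =>
    ((Cadlag.isClosed_boundedSet _).inter (Cadlag.isClosed_modulusSet _ _)).union (hG2 k)
  refine ⟨⋂ k : ℕ, (Cadlag.boundedSet a b (M k) ∩
      Cadlag.modulusSet a b (δ k) (1 / ((k : ℝ) + 1)) ∪ G k),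
    Cadlag.isCompact_of_modulus hδ (fun k => by positivity)
      tendsto_one_div_add_atTop_nhds_zero_nat hG1 (isClosed_iInter hclosed)
      (fun k => iInter_subset _ k), ?_⟩
  rintro μ ⟨n, hn, rfl⟩
  rw [Measure.map_apply (measurable_cadlagProfile hN hab hn)
    (isClosed_iInter hclosed).measurableSet.compl, compl_iInter, preimage_iUnion]
  refine (measure_iUnion_le _).trans (le_trans (ENNReal.tsum_le_tsum fun k => ?_) hsum.le)
  exact (hG3 k n hn).trans (by rw [ENNReal.ofReal_coe_nnreal])

/-- Violating a modulus is an open condition in the Skorokhod topology, so the portmanteau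
inequality passes the uniform bounds to the limit. For each `η = 1 / (k + 1)` almost every path then
has some `δ`, and countably many `η` suffice. -/
theorem ae_continuous_of_tendsto {a b : ℝ} (hab : a < b) {φ : ℕ → ℕ} (hφ : Tendsto φ atTop atTop)
    {μ : Measure (Cadlag a b)} [IsProbabilityMeasure μ]
    (h : TendstoInDistribution (fun k ω => (N ω).cadlagProfile a b (φ k)) atTop
        (id : Cadlag a b → Cadlag a b) (fun _ => P) μ) :
    ∀ᵐ f ∂μ, Continuous f.toFun := by
  have hmod : ∀ η > 0, ∀ ε > 0, ∃ δ > 0,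
      μ (Cadlag.modulusSet a b δ η)ᶜ ≤ ENNReal.ofReal ε := by
    intro η hη ε hε
    obtain ⟨δ, hδ, hn⟩ := exists_modulusSet_compl_le hN hab hη hε
    refine ⟨δ, hδ, ?_⟩
    have hopen : IsOpen (Cadlag.modulusSet a b δ η)ᶜ :=
      (Cadlag.isClosed_modulusSet δ η).isOpen_compl
    have hle := ProbabilityMeasure.le_liminf_measure_open_of_tendsto h.tendsto hopen
    simp only [ProbabilityMeasure.coe_mk, Measure.map_id] at hle
    refine hle.trans (liminf_le_of_frequently_le' (Eventually.frequently ?_))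
    filter_upwards [hφ.eventually hn, hφ.eventually (eventually_ge_atTop 1)] with k hk hk1
    rw [Measure.map_apply (measurable_cadlagProfile hN hab hk1) hopen.measurableSet]
    exact hk
  have hae : ∀ k : ℕ, ∀ᵐ f ∂μ, ∃ δ > 0, f ∈ Cadlag.modulusSet a b δ (1 / ((k : ℝ) + 1)) := by
    intro k
    refine le_antisymm (ENNReal.le_of_forall_pos_le_add fun ε hε _ => ?_) zero_le
    obtain ⟨δ, hδ, hle⟩ := hmod (1 / ((k : ℝ) + 1)) (by positivity) ε hε
    rw [zero_add]
    have hsub : {f | ∃ δ > 0, f ∈ Cadlag.modulusSet a b δ (1 / ((k : ℝ) + 1))}ᶜ ⊆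
        (Cadlag.modulusSet a b δ (1 / ((k : ℝ) + 1)))ᶜ := fun f hf hmem => hf ⟨δ, hδ, hmem⟩
    refine (measure_mono hsub).trans (hle.trans ?_)
    rw [ENNReal.ofReal_coe_nnreal]
  filter_upwards [ae_all_iff.2 hae] with f hf
  refine Cadlag.continuous_of_forall_modulus fun η hη => ?_
  obtain ⟨k, hk⟩ := exists_nat_one_div_lt hη
  obtain ⟨δ, hδ, hfδ⟩ := hf k
  exact ⟨δ, hδ, fun s t hst => (hfδ s t hst).trans hk.le⟩

end Profile

theorem theorem1 {Ω : Type*} [MeasurableSpace Ω] (P : Measure Ω) [IsProbabilityMeasure P]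
    (N : Ω → PointConfig) (hN : IsPoissonPointProcess P N volume)
    (a b : ℝ) (hab : a < b) :
    (∀ n : ℕ, 1 ≤ n → Measurable fun ω => (N ω).cadlagProfile a b n) ∧
    IsTightMeasureSet
      {μ : Measure (Cadlag a b) |
        ∃ n : ℕ, 1 ≤ n ∧ μ = P.map (fun ω => (N ω).cadlagProfile a b n)} ∧
    ∀ (φ : ℕ → ℕ) (μ : Measure (Cadlag a b)) [IsProbabilityMeasure μ],
      StrictMono φ →
      TendstoInDistribution (fun k ω => (N ω).cadlagProfile a b (φ k)) atTop
        (id : Cadlag a b → Cadlag a b) (fun _ => P) μ →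
      ∀ᵐ f ∂μ, Continuous f.toFun :=
  ⟨fun _ hn => measurable_cadlagProfile hN hab hn, isTightMeasureSet_profile hN hab,
    fun _ _ _ hφ h => ae_continuous_of_tendsto hN hab hφ.tendsto_atTop h⟩
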